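/- Let $G$ be a Lie group with Lie algebra $\mathfrak g$, $H\subset G$ a closed subgroup with Lie algebra $\mathfrak h$, $X=G/H$, and let $(\tau,V)$ be a unitary representation of $H$ on a (possibly infinite dimensional) Hilbert space. Fix a scalar product on $\mathfrak g$; it fixes Lebesgue measures on all subspaces of $\mathfrak g$. *Notation.* For $x\in X$ let $G_x$ be the stabilizer of $x$ and $\mathfrak g_x$ its Lie algebra. Let $\mathcal V=G\times_H V\to X$ be the associated Hermitian bundle and $\mathcal D^{\alpha}\to X$ the bundle of complex $\alpha$-densities; for $k\in G_x$ let $\tau_x(k)$ and $\sigma_x(k)$ denote its actions on the fibers $\mathcal V_x$ and $\mathcal D^{1/2}_x$ (so $\sigma_x(k)$ is multiplication by $|\det(dk|_{T_xX})|^{-1/2}$). $\operatorname{Ind}_H^G\tau$ is the unitary representation of $G$ by left translation on $L^2(X,\mathcal V\otimes\mathcal D^{1/2})$. For a unitary representation $\pi$ of a Lie group $K$ with Lie algebra $\mathfrak k$, $\operatorname{WF}(\pi)\subset i\mathfrak k^*$ is the closure of the union, over all matrix coefficients $c(k)=\langle\pi(k)u,v\rangle$, of the wave front sets of $c$ at the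 identity: $\xi$ is not in the wave front set of $c$ at the identity iff there are $\varphi\in C_c^\infty(\mathfrak k)$ with $\varphi(0)\ne0$ and a neighborhood $\Omega$ of $\xi$ such that for each $N\ge 0$ there is $C_N$ with $\left|\int_{\mathfrak k}c(e^Y)\varphi(Y)e^{\langle t\zeta,Y\rangle}dY\right|\le C_Nt^{-N}$ for all $t>0$, $\zeta\in\Omega$. For $S\subset i\mathfrak h^*$ put $\operatorname{Ind}_H^GS=\overline{\operatorname{Ad}^*(G)\cdot q^{-1}(S)}$, where $q\colon i\mathfrak g^*\to i\mathfrak h^*$ is restriction. *Wavefront condition U.* For every $\eta\in i\mathfrak g^*\setminus\operatorname{Ind}_H^G\operatorname{WF}(\tau)$ there are a neighborhood $\Omega\subset i\mathfrak g^*\setminus\operatorname{Ind}_H^G\operatorname{WF}(\tau)$ of $\eta$ and a neighborhood $U$ of $0$ in $\mathfrak g$ such that: 1. for every $\varphi\in C_c^\infty(U)$ and every $N\ge0$ there is a constant $C_{N,\varphi}$ such that $$\left|\int_{\mathfrak g_x}\langle\tau_x(e^Y)v_1,v_2\rangle\,(\sigma_x(e^Y)z_1\otimes\overline{z_2})\,\varphi(Y)\,e^{\langle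 t\xi,Y\rangle}\,dY\right|_{\mathcal D^1_x}\le C_{N,\varphi}\,(\|v_1\|\,|z_1|)\otimes(\|v_2\|\,|z_2|)\,t^{-N}$$ for all $t>0$, $\xi\in\Omega$, $x\in X$, $v_1,v_2\in\mathcal V_x$, $z_1,z_2\in\mathcal D_x^{1/2}$ (an inequality of nonnegative $1$-densities on $T_xX$); 2. there is a constant $C$ such that $|\sigma_x(e^Y)z|\le C|z|$ for all $x\in X$, $Y\in\mathfrak g_x\cap U$, $z\in\mathcal D_x^{1/2}$. **Theorem.** If wavefront condition U holds for $(G,H,\tau)$, then $$\operatorname{WF}(\operatorname{Ind}_H^G\tau)\subset\operatorname{Ind}_H^G\operatorname{WF}(\tau).$$ -/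

import Mathlib

open Set Filter Topology MeasureTheory
open scoped Manifold ContDiff ENNReal NNReal Pointwise

namespace InducedWaveFront

section LieTheory

/-! ### The exponential map and the adjoint representation of a Lie group -/

variable {E : Type*} [NormedAddCommGroup E] [NormedSpace ℝ E]
  {G : Type*} [TopologicalSpace G] [ChartedSpace E G]

/-- The differential at `x` of a self-map of a manifold modelled on `E`. Tangent spaces are, by
definition of `TangentSpace`, copies of `E`. -/
noncomputable def tderiv (f : G → G) (x : G) : E →L[ℝ] E :=
  mfderiv 𝓘(ℝ, E) 𝓘(ℝ, E) f x

theorem tderiv_comp {f g : G → G} {x : G} (hf : MDifferentiable 𝓘(ℝ, E) 𝓘(ℝ, E) f)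
    (hg : MDifferentiable 𝓘(ℝ, E) 𝓘(ℝ, E) g) :
    tderiv (E := E) (fun y => f (g y)) x = (tderiv (E := E) f (g x)).comp (tderiv g x) :=
  mfderiv_comp (I' := 𝓘(ℝ, E)) x (hf _) (hg _)

theorem hasMFDerivWithinAt_curve {s : Set ℝ} {γ : ℝ → G} {t : ℝ} {v w : E} {f : G → G}
    (hf : MDifferentiable 𝓘(ℝ, E) 𝓘(ℝ, E) f)
    (h : HasMFDerivWithinAt 𝓘(ℝ, ℝ) 𝓘(ℝ, E) γ s t
      ((1 : ℝ →L[ℝ] ℝ).smulRight v : ℝ →L[ℝ] E)) (hw : w = tderiv f (γ t) v) :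
    HasMFDerivWithinAt 𝓘(ℝ, ℝ) 𝓘(ℝ, E) (fun u => f (γ u)) s t
      ((1 : ℝ →L[ℝ] ℝ).smulRight w : ℝ →L[ℝ] E) := by
  have h2 := (hf (γ t)).hasMFDerivAt.comp_hasMFDerivWithinAt t h
  have e : ((1 : ℝ →L[ℝ] ℝ).smulRight w : ℝ →L[ℝ] E) =
      (tderiv (E := E) f (γ t)).comp ((1 : ℝ →L[ℝ] ℝ).smulRight v : ℝ →L[ℝ] E) := by
    ext; simp [hw]
  rw [e]; exact h2

variable [Group G]

/-- The adjoint representation `Ad g`, the differential at the identity of `x ↦ g x g⁻¹`. The Lie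
algebra `T_1 G` of `G` is `E` as a vector space. -/
noncomputable def lieAd (g : G) : E →L[ℝ] E := tderiv (fun x : G => g * x * g⁻¹) 1

/-- The left invariant vector field of `G` with value `Y` at the identity. -/
noncomputable def leftField (Y : E) (g : G) : E := tderiv (fun x : G => g * x) 1 Y

/-- `γ` is the integral curve through `1` of the left invariant vector field of `Y`, that is, the
one-parameter subgroup `t ↦ exp (t Y)`. -/
def IsExpCurve (Y : E) (γ : ℝ → G) : Prop :=
  γ 0 = 1 ∧ IsMIntegralCurve (I := 𝓘(ℝ, E)) γ
    (fun g : G => leftField (E := E) Y g)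

theorem lieAd_one : (lieAd (1 : G) : E →L[ℝ] E) = ContinuousLinearMap.id ℝ E := by
  have : (fun x : G => 1 * x * 1⁻¹) = id := by ext x; simp
  unfold lieAd tderiv
  rw [this]; exact mfderiv_id

variable [LieGroup 𝓘(ℝ, E) ∞ G]

theorem lieGroup_three : LieGroup 𝓘(ℝ, E) (minSmoothness ℝ 3) G := by
  rw [minSmoothness_of_isRCLikeNormedField]
  refine LieGroup.of_le (n := ∞) ?_
  exact WithTop.coe_le_coe.2 le_top

theorem mdiff_mul_left (g : G) : MDifferentiable 𝓘(ℝ, E) 𝓘(ℝ, E) (fun x : G => g * x) :=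
  (contMDiff_mul_left (I := 𝓘(ℝ, E)) (n := ∞)).mdifferentiable (by simp)

theorem mdiff_mul_right (g : G) : MDifferentiable 𝓘(ℝ, E) 𝓘(ℝ, E) (fun x : G => x * g) :=
  (contMDiff_mul_right (I := 𝓘(ℝ, E)) (n := ∞)).mdifferentiable (by simp)

theorem mdiff_conj (g : G) : MDifferentiable 𝓘(ℝ, E) 𝓘(ℝ, E) (fun x : G => g * x * g⁻¹) :=
  (mdiff_mul_right g⁻¹).comp (mdiff_mul_left g)

theorem lieAd_mul (a b : G) : (lieAd (a * b) : E →L[ℝ] E) = (lieAd a).comp (lieAd b) := by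
  have h : (fun x : G => a * b * x * (a * b)⁻¹) = fun x => a * (b * x * b⁻¹) * a⁻¹ := by
    ext x; simp [mul_assoc]
  unfold lieAd
  rw [h, tderiv_comp (mdiff_conj (E := E) a) (mdiff_conj b)]
  simp

theorem lieAd_cancel (g : G) (Y : E) : lieAd g⁻¹ (lieAd g Y) = Y := by
  have h := lieAd_mul (E := E) g⁻¹ g
  rw [inv_mul_cancel, lieAd_one] at h
  simpa using (congrArg (fun f : E →L[ℝ] E => f Y) h).symm

theorem contMDiff_leftField (Y : E) : ContMDiff 𝓘(ℝ, E) 𝓘(ℝ, E).tangent 1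
    (fun g : G => (⟨g, leftField (E := E) Y g⟩ : TangentBundle 𝓘(ℝ, E) G)) := by
  have := lieGroup_three (E := E) (G := G)
  exact (contMDiff_mulInvariantVectorField (I := 𝓘(ℝ, E)) (G := G) Y).of_le (by
    rw [minSmoothness_of_isRCLikeNormedField]; exact one_le_two)

theorem leftField_mul (Y : E) (g x : G) :
    (leftField Y (g * x) : E) = tderiv (fun y : G => g * y) x (leftField Y x : E) := by
  have h : (fun y : G => g * x * y) = fun y => g * (x * y) := by
    ext y; simp [mul_assoc]
  rw [leftField, leftField, h, tderiv_comp (mdiff_mul_left (E := E) g) (mdiff_mul_left x)]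
  simp

theorem leftField_conj (Y : E) (g x : G) :
    (leftField (lieAd g Y) (g * x * g⁻¹) : E) =
      tderiv (fun y : G => g * y * g⁻¹) x (leftField Y x : E) := by
  have e : (fun y : G => g * (x * y) * g⁻¹) = fun y => g * x * g⁻¹ * (g * y * g⁻¹) := by
    ext y; simp [mul_assoc]
  have e' := congrArg (fun f => (tderiv f (1 : G) : E →L[ℝ] E) Y) e
  rw [tderiv_comp (f := fun y => g * y * g⁻¹) (mdiff_conj (E := E) g) (mdiff_mul_left x),
    tderiv_comp (f := fun y => g * x * g⁻¹ * y) (mdiff_mul_left (E := E) _) (mdiff_conj g)] at e'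
  rw [leftField, leftField, lieAd]
  simpa using e'.symm

theorem exists_isExpCurve [CompleteSpace E] [T2Space G] (Y : E) :
    ∃ γ : ℝ → G, IsExpCurve Y γ := by
  have hv := contMDiff_leftField (G := G) Y
  obtain ⟨γ, h0, hγ⟩ := exists_isMIntegralCurveAt_of_contMDiffAt_boundaryless 0
    (hv.contMDiffAt (x := (1 : G)))
  obtain ⟨ε, hε, hγ⟩ := isMIntegralCurveAt_iff'.mp hγ
  refine exists_isMIntegralCurve_of_isMIntegralCurveOn hv hε (fun x => ?_) 1
  refine ⟨fun t => x * γ t, by simp [h0], fun t ht => ?_⟩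
  have h1 := hγ t (by simpa [Real.ball_eq_Ioo] using ht)
  rw [Real.ball_eq_Ioo, zero_sub, zero_add] at h1
  exact hasMFDerivWithinAt_curve (mdiff_mul_left x) h1 (leftField_mul Y x (γ t))

theorem IsExpCurve.unique [T2Space G] {Y : E} {γ γ' : ℝ → G} (h : IsExpCurve Y γ)
    (h' : IsExpCurve Y γ') : γ = γ' :=
  isMIntegralCurve_Ioo_eq_of_contMDiff_boundaryless (t₀ := 0) (contMDiff_leftField (G := G) Y)
    h.2 h'.2 (h.1.trans h'.1.symm)

theorem IsExpCurve.conj {Y : E} {γ : ℝ → G} (h : IsExpCurve Y γ) (g : G) :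
    IsExpCurve (lieAd g Y) (fun t => g * γ t * g⁻¹) := by
  have h0 : γ 0 = 1 := h.1
  refine ⟨by simp [h0], fun t => ?_⟩
  exact hasMFDerivWithinAt_univ.1 (hasMFDerivWithinAt_curve (mdiff_conj g)
    (hasMFDerivWithinAt_univ.2 (h.2 t)) (leftField_conj Y g (γ t)))

/-- The exponential map `𝔤 → G`. -/
noncomputable def lieExp [CompleteSpace E] [T2Space G] (Y : E) : G :=
  (exists_isExpCurve (G := G) Y).choose 1

theorem lieExp_eq [CompleteSpace E] [T2Space G] {Y : E} {γ : ℝ → G} (h : IsExpCurve Y γ) :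
    lieExp Y = γ 1 :=
  congrFun ((exists_isExpCurve (G := G) Y).choose_spec.unique h) 1

theorem lieExp_conj [CompleteSpace E] [T2Space G] (g : G) (Y : E) :
    (lieExp (lieAd g Y) : G) = g * lieExp Y * g⁻¹ :=
  lieExp_eq ((exists_isExpCurve (G := G) Y).choose_spec.conj g)

/-! ### Closed subgroups -/

variable [CompleteSpace E] [T2Space G]

variable (E) in
/-- The Lie algebra of a closed subgroup `K` of `G`: the set of all `Y` with `exp (t Y) ∈ K` for all
real `t`. (For closed `K` this set is a linear subspace, so that taking the span adds nothing.) -/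
noncomputable def lieAlg (K : Subgroup G) : Submodule ℝ E :=
  Submodule.span ℝ {Y : E | ∀ t : ℝ, lieExp (t • Y) ∈ K}

open Classical in
/-- The exponential map `𝔨 → K` of a closed subgroup `K`, the restriction of that of `G`. (For
closed `K` the first case always applies.) -/
noncomputable def subExp (K : Subgroup G) (Y : lieAlg E K) : K :=
  if h : lieExp (Y : E) ∈ K then ⟨lieExp (Y : E), h⟩ else 1

theorem lieAd_mem {K : Subgroup G} (k : K) {Y : E} (hY : Y ∈ lieAlg E K) :
    lieAd (k : G) Y ∈ lieAlg E K := by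
  induction hY using Submodule.span_induction with
  | mem Y h =>
    refine Submodule.subset_span fun t => ?_
    rw [← map_smul, lieExp_conj]
    exact K.mul_mem (K.mul_mem k.2 (h t)) (K.inv_mem k.2)
  | zero => simp
  | add Y Z _ _ h1 h2 => rw [map_add]; exact Submodule.add_mem _ h1 h2
  | smul c Y _ h => rw [map_smul]; exact Submodule.smul_mem _ c h

/-- The tangent space at `x` of a homogeneous space `X = G/H`, where `K` is the stabilizer of `x`:
the differential at `1` of `g ↦ g x` identifies it with `𝔤/𝔨`. -/
abbrev TangentQuot (E : Type*) [NormedAddCommGroup E] [NormedSpace ℝ E] {G : Type*}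
    [TopologicalSpace G] [ChartedSpace E G] [Group G] [LieGroup 𝓘(ℝ, E) ∞ G] [CompleteSpace E]
    [T2Space G] (K : Subgroup G) : Type _ := E ⧸ lieAlg E K

/-- The isotropy representation: the differential at `x` of the action of `k ∈ K = G_x` on `X`, as
an automorphism of `T_x X = 𝔤/𝔨`. Since `k exp(tY) x = exp(t Ad(k)Y) x`, it is induced by
`Ad k`. -/
noncomputable def isotropy (K : Subgroup G) (k : K) : TangentQuot E K ≃ₗ[ℝ] TangentQuot E K :=
  LinearEquiv.ofLinearMap
    ((lieAlg E K).mapQ (lieAlg E K) (lieAd (k : G) : E →L[ℝ] E).toLinearMap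
      fun _ hY => lieAd_mem k hY)
    ((lieAlg E K).mapQ (lieAlg E K) (lieAd ((k⁻¹ : K) : G) : E →L[ℝ] E).toLinearMap
      fun _ hY => lieAd_mem k⁻¹ hY)
    (by
      ext Y
      have := lieAd_cancel (E := E) ((k : G)⁻¹) Y
      rw [inv_inv] at this
      simp [this])
    (by
      ext Y
      simp [lieAd_cancel])

end LieTheory

section Densities

/-! ### Densities on a real vector space -/

/-- A frame, that is, an ordered basis, of `W`. -/
abbrev Frame (W : Type*) [AddCommGroup W] [Module ℝ W] :=
  Module.Basis (Fin (Module.finrank ℝ W)) ℝ W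

/-- `V`-valued `α`-densities on the real vector space `W`, i.e. elements of `V ⊗ 𝒟^α` where `𝒟^α`
is the complex line of classes `[b, z]` (`b` a frame, `z ∈ ℂ`) with
`[b ∘ A, z] = [b, |det A| ^ (-α) z]`. A density is given by its coefficient `z` at each frame. -/
@[ext]
structure Density (α : ℝ) (W : Type*) [AddCommGroup W] [Module ℝ W]
    (V : Type*) [AddCommGroup V] [Module ℂ V] where
  /-- The coefficient at a frame. -/
  coeff : Frame W → V
  /-- The transformation law under a change of frame. -/
  coeff_change : ∀ b b' : Frame W, coeff b' = ((|b.det b'| ^ α : ℝ) : ℂ) • coeff b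

variable {α : ℝ} {W : Type*} [AddCommGroup W] [Module ℝ W]
  {V : Type*} [AddCommGroup V] [Module ℂ V]

/-- The action `[b, z] ↦ [A ∘ b, z]` of a linear automorphism on densities. -/
noncomputable def Density.map (A : W ≃ₗ[ℝ] W) (z : Density α W V) : Density α W V where
  coeff b := z.coeff (b.map A.symm)
  coeff_change b b' := by
    rw [z.coeff_change (b.map A.symm) (b'.map A.symm), Module.Basis.det_map]
    have h : (A.symm.symm ∘ ((b'.map A.symm : Frame W) : _ → W)) = b' := by
      ext i; simp
    rw [h]

/-- The pairing `⟨v₁, v₂⟩ z₁ ⊗ z̄₂ ∈ 𝒟^1` of `v₁ ⊗ z₁, v₂ ⊗ z₂ ∈ V ⊗ 𝒟^(1/2)`. -/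
noncomputable def Density.pair {V : Type*} [NormedAddCommGroup V] [InnerProductSpace ℂ V]
    (z₁ z₂ : Density (1 / 2) W V) : Density 1 W ℂ where
  coeff b := inner ℂ (z₂.coeff b) (z₁.coeff b)
  coeff_change b b' := by
    rw [z₁.coeff_change b b', z₂.coeff_change b b', inner_smul_left, inner_smul_right,
      Complex.conj_ofReal, ← mul_assoc, ← Complex.ofReal_mul,
      ← Real.rpow_add' (abs_nonneg _) (by norm_num), smul_eq_mul]
    norm_num

end Densities

section Representations

/-! ### Unitary representations and wave front sets -/

/-- A unitary representation of the topological group `K` on the Hilbert space `V`: a strongly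
continuous homomorphism to the unitary group of `V`. -/
structure UnitaryRep (K : Type*) [Group K] [TopologicalSpace K]
    (V : Type*) [NormedAddCommGroup V] [InnerProductSpace ℂ V] where
  /-- The underlying homomorphism. -/
  hom : K →* (V ≃ₗᵢ[ℂ] V)
  continuous_hom : ∀ v : V, Continuous fun k => hom k v

/-- The matrix coefficients `k ↦ ⟨π(k) u, v⟩` of a unitary representation. -/
def UnitaryRep.matrixCoeffs {K : Type*} [Group K] [TopologicalSpace K]
    {V : Type*} [NormedAddCommGroup V] [InnerProductSpace ℂ V] (π : UnitaryRep K V) :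
    Set (K → ℂ) :=
  {c | ∃ u v : V, c = fun k => inner ℂ v (π.hom k u)}

variable {W : Type*} [NormedAddCommGroup W] [InnerProductSpace ℝ W] [FiniteDimensional ℝ W]
  [MeasurableSpace W] [BorelSpace W]

/-- The fiber over `0` of the wave front set of a function `f` on a Euclidean space `W`. An element
`iξ` of `iW*` is represented by the real functional `ξ`. Its complement consists of the `ξ` for
which there are a smooth cutoff `φ` with `φ 0 ≠ 0` and a neighborhood `Ω` of `ξ` such that the
Fourier transform of `φ f` decays rapidly at `t ζ`, uniformly in `ζ ∈ Ω`. -/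
def waveFrontAtZero (f : W → ℂ) : Set (StrongDual ℝ W) :=
  {ξ | ¬ ∃ φ : W → ℂ, ContDiff ℝ ∞ φ ∧ HasCompactSupport φ ∧ φ 0 ≠ 0 ∧
    ∃ Ω ∈ 𝓝 ξ, ∀ N : ℕ, ∃ C : ℝ, ∀ t : ℝ, 0 < t → ∀ ζ ∈ Ω,
      ‖∫ Y : W, f Y * φ Y * Complex.exp (Complex.I * t * ζ Y)‖ ≤ C * (t ^ N)⁻¹}

/-- The closure of the union of the wave front sets at the identity of a family of functions on a
Lie group `K` with exponential map `e : W → K`. The exponential map is a diffeomorphism near `0`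
with differential the identity, so it serves as chart at the identity. For the matrix
coefficients of a unitary representation this is the wave front set of the representation. -/
def waveFrontSet {K : Type*} (e : W → K) (coeffs : Set (K → ℂ)) : Set (StrongDual ℝ W) :=
  closure (⋃ c ∈ coeffs, waveFrontAtZero fun Y => c (e Y))

end Representations

section BruhatFunction

/-! ### Integration over `G/H` -/

/-- Existence of nonnegative functions on `G` whose integral over every left coset of `H` is `1`. -/
theorem exists_bruhat {G : Type*} [Group G] [TopologicalSpace G] [IsTopologicalGroup G]
    [LocallyCompactSpace G] [SecondCountableTopology G] [MeasurableSpace G] [BorelSpace G]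
    (H : Subgroup G) (hH : IsClosed (H : Set G)) :
    ∃ (ν : Measure H) (χ : G → ℝ≥0), ν.IsHaarMeasure ∧ Measurable χ ∧
      ∀ g : G, ∫⁻ h : H, (χ (g * h) : ℝ≥0∞) ∂ν = 1 := by
  have : LocallyCompactSpace H := hH.isClosedEmbedding_subtypeVal.locallyCompactSpace
  let ν : Measure H := Measure.haar
  have : SecondCountableTopology H :=
    TopologicalSpace.Subtype.secondCountableTopology (H : Set G)
  have : SFinite ν := inferInstanceAs (SFinite (Measure.haar : Measure H))
  let K := CompactExhaustion.choice G
  let U : ℕ → Set G := fun n => interior (K n)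
  have hU : ∀ n, MeasurableSet (U n) := fun n => isOpen_interior.measurableSet
  let M : ℕ → ℝ≥0∞ := fun n => ν {h : H | (h : G) ∈ (K n : Set G)⁻¹ * (K n : Set G)}
  have hM : ∀ n, M n < ⊤ := fun n =>
    (hH.isClosedEmbedding_subtypeVal.isCompact_preimage
      ((K.isCompact n).inv.mul (K.isCompact n))).measure_lt_top
  have hψ : ∀ n (g : G), ν {h : H | g * h ∈ U n} ≤ M n := by
    intro n g
    rcases Set.eq_empty_or_nonempty {h : H | g * h ∈ U n} with h0 | ⟨h0, hh0⟩
    · simp [h0]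
    · calc ν {h : H | g * h ∈ U n}
          ≤ ν ((fun h => h0⁻¹ * h) ⁻¹' {h : H | (h : G) ∈ (K n : Set G)⁻¹ * (K n : Set G)}) := by
            refine measure_mono fun h hh => ?_
            refine Set.mem_mul.2 ⟨(g * h0)⁻¹, ?_, g * h, interior_subset hh, ?_⟩
            · simpa using interior_subset hh0
            · simp [mul_assoc]
        _ = M n := measure_preimage_mul ν h0⁻¹ _
  let c : ℕ → ℝ≥0∞ := fun n => 2⁻¹ ^ n / (M n + 1)
  have hc0 : ∀ n, c n ≠ 0 := fun n =>
    (ENNReal.div_pos (by simp) (by simp [(hM n).ne])).ne'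
  have hcM : ∀ n, c n * M n ≤ 2⁻¹ ^ n := fun n => by
    calc c n * M n ≤ c n * (M n + 1) := by gcongr; exact le_self_add
      _ = _ := ENNReal.div_mul_cancel (by simp) (by simp [(hM n).ne])
  have hc1 : ∀ n, c n ≤ 2⁻¹ ^ n := fun n => ENNReal.div_le_of_le_mul (by
    calc (2⁻¹ : ℝ≥0∞) ^ n = 2⁻¹ ^ n * 1 := by simp
      _ ≤ _ := by gcongr; simp)
  have hsum : ∑' n, (2⁻¹ : ℝ≥0∞) ^ n ≠ ⊤ := by
    rw [ENNReal.tsum_geometric]; simp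
  let w : G → ℝ≥0∞ := fun g => ∑' n, (U n).indicator (fun _ => c n) g
  have hw : Measurable w := Measurable.tsum fun n => measurable_const.indicator (hU n)
  have hwfin : ∀ g, w g ≠ ⊤ := fun g => ne_top_of_le_ne_top hsum
    (ENNReal.tsum_le_tsum fun n => (Set.indicator_le_self' (by simp) g).trans (hc1 n))
  let q : G → ℝ≥0∞ := fun g => ∫⁻ h : H, w (g * h) ∂ν
  have hqm : Measurable q :=
    Measurable.lintegral_prod_right' (f := fun p : G × H => w (p.1 * p.2))
      (hw.comp (measurable_fst.mul (measurable_subtype_coe.comp measurable_snd)))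
  have hq : ∀ g, q g = ∑' n, c n * ν {h : H | g * h ∈ U n} := by
    intro g
    have hm : ∀ n, MeasurableSet {h : H | g * h ∈ U n} := fun n =>
      (measurable_const_mul g |>.comp measurable_subtype_coe) (hU n)
    have e : ∀ n (h : H), (U n).indicator (fun _ => c n) (g * h) =
      ({h : H | g * h ∈ U n}).indicator (fun _ => c n) h := fun n h => rfl
    simp only [q, w, e]
    rw [lintegral_tsum fun n => (measurable_const.indicator (hm n)).aemeasurable]
    simp [lintegral_indicator (hm _)]
  have hqtop : ∀ g, q g ≠ ⊤ := fun g => by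
    rw [hq]
    exact ne_top_of_le_ne_top hsum (ENNReal.tsum_le_tsum fun n =>
      (by gcongr; exact hψ n g : c n * ν {h : H | g * h ∈ U n} ≤ c n * M n).trans (hcM n))
  have hq0 : ∀ g, q g ≠ 0 := fun g => by
    obtain ⟨n, hn⟩ := K.exists_mem g
    have hn' : g ∈ U (n + 1) := K.subset_interior_succ n hn
    rw [hq]
    intro h0
    have h1 := ENNReal.tsum_eq_zero.1 h0 (n + 1)
    have ho : IsOpen {h : H | g * h ∈ U (n + 1)} :=
      isOpen_interior.preimage (by fun_prop)
    exact (mul_ne_zero (hc0 _) (ho.measure_pos ν ⟨1, by simpa using hn'⟩).ne') h1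
  have hqH : ∀ g (h : H), q (g * h) = q g := fun g h => by
    have := lintegral_mul_left_eq_self (μ := ν) (fun h' : H => w (g * h')) h
    simpa [q, mul_assoc] using this
  refine ⟨ν, fun g => (w g / q g).toNNReal, inferInstance, (hw.div hqm).ennreal_toNNReal, ?_⟩
  intro g
  have e : ∀ h : H, (((w (g * h) / q (g * h)).toNNReal : ℝ≥0) : ℝ≥0∞) = w (g * h) * (q g)⁻¹ := by
    intro h
    rw [ENNReal.coe_toNNReal (ENNReal.div_ne_top (hwfin _) (hq0 _)), hqH, div_eq_mul_inv]
  simp only [e]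
  have hm : Measurable fun h : H => w (g * h) :=
    hw.comp (measurable_const_mul g |>.comp measurable_subtype_coe)
  rw [lintegral_mul_const _ hm]
  exact ENNReal.mul_inv_cancel (hq0 g) (hqtop g)

variable {G : Type*} [Group G] [TopologicalSpace G] [IsTopologicalGroup G]
  [LocallyCompactSpace G] [SecondCountableTopology G] [MeasurableSpace G] [BorelSpace G]

/-- A function `χ ≥ 0` on `G` such that the integral of `h ↦ χ (g h)` against a fixed left Haar
measure of `H` is `1` for all `g`. -/
noncomputable def bruhat (H : Subgroup G) (hH : IsClosed (H : Set G)) : G → ℝ≥0 :=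
  (exists_bruhat H hH).choose_spec.choose

theorem bruhat_spec (H : Subgroup G) (hH : IsClosed (H : Set G)) :
    ∃ ν : Measure H, ν.IsHaarMeasure ∧ Measurable (bruhat H hH) ∧
      ∀ g : G, ∫⁻ h : H, (bruhat H hH (g * h) : ℝ≥0∞) ∂ν = 1 :=
  ⟨_, (exists_bruhat H hH).choose_spec.choose_spec⟩

/-- The measure `χ dg` on `G`, where `dg` is left Haar measure. A `1`-density on `X = G/H` is a
function `ρ` on `G` with values in the densities on `T_{eH} X` such that `ρ (g h) = h⁻¹ ρ (g)`. In
terms of a frame of `T_{eH} X` this reads `ρ (g h) = |det(dh)| ρ (g)`. By Weil's formula, the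
integral of the density over `X` is, up to a positive constant which only depends on normalizations,
the integral of `ρ` against `χ dg`. -/
noncomputable def bruhatMeasure (H : Subgroup G) (hH : IsClosed (H : Set G)) : Measure G :=
  Measure.haar.withDensity fun g => (bruhat H hH g : ℝ≥0∞)

end BruhatFunction

section Induction

/-! ### Induced representations and induced cones -/

variable {E : Type*} [NormedAddCommGroup E] [InnerProductSpace ℝ E] [FiniteDimensional ℝ E]
  {G : Type*} [TopologicalSpace G] [ChartedSpace E G] [Group G]
  [LieGroup 𝓘(ℝ, E) ∞ G] [T2Space G]
  {V : Type*} [NormedAddCommGroup V] [InnerProductSpace ℂ V]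

/-- The coadjoint action of `G` on `𝔤*`. -/
noncomputable def coAd (g : G) (ξ : StrongDual ℝ E) : StrongDual ℝ E := ξ.comp (lieAd g⁻¹)

/-- The restriction map `q : 𝔤* → 𝔥*`. -/
noncomputable def restrictDual (H : Subgroup G) (ξ : StrongDual ℝ E) :
    StrongDual ℝ (lieAlg E H) := ξ.comp (lieAlg E H).subtypeL

/-- The set `Ind_H^G S`, the closure of `Ad*(G) q⁻¹(S)`. -/
def inducedSet (H : Subgroup G) (S : Set (StrongDual ℝ (lieAlg E H))) : Set (StrongDual ℝ E) :=
  closure {ξ | ∃ g : G, ∃ ζ : StrongDual ℝ E, restrictDual H ζ ∈ S ∧ ξ = coAd g ζ}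

section
variable [MeasurableSpace E] [BorelSpace E]

variable (E) in
/-- The wave front set of a unitary representation of the closed subgroup `H`. -/
def subgroupWF (H : Subgroup G) (τ : UnitaryRep H V) : Set (StrongDual ℝ (lieAlg E H)) :=
  waveFrontSet (subExp H) τ.matrixCoeffs

variable [SecondCountableTopology G] [MeasurableSpace G] [BorelSpace G]

variable (E G) in
/-- Left Haar measure on the Lie group `G`. -/
noncomputable def lieHaar : Measure G :=
  haveI : IsTopologicalGroup G := topologicalGroup_of_lieGroup 𝓘(ℝ, E) ∞
  haveI : LocallyCompactSpace G := Manifold.locallyCompact_of_finiteDimensional 𝓘(ℝ, E)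
  Measure.haar

variable (E) in
/-- The measure `χ dg` on the Lie group `G` which computes integrals of densities over `G/H`. -/
noncomputable def quotMeasure (H : Subgroup G) (hH : IsClosed (H : Set G)) : Measure G :=
  haveI : IsTopologicalGroup G := topologicalGroup_of_lieGroup 𝓘(ℝ, E) ∞
  haveI : LocallyCompactSpace G := Manifold.locallyCompact_of_finiteDimensional 𝓘(ℝ, E)
  bruhatMeasure H hH

/-- The integral over `X = G/H` of a `1`-density given as a function `ρ` on `G` with values in the
densities on `T_{eH} X`. The fixed reference frame only affects the normalization. -/
noncomputable def densityIntegral (H : Subgroup G) (hH : IsClosed (H : Set G))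
    (ρ : G → Density 1 (TangentQuot E H) ℂ) : ℂ :=
  ∫ g, (ρ g).coeff (Module.finBasis ℝ (TangentQuot E H)) ∂(quotMeasure E H hH)

/-- The square integrable sections of `𝒱 ⊗ 𝒟^(1/2)` over `X = G/H`, where `𝒱 = G ×_H V`. As
`𝒱 ⊗ 𝒟^(1/2)` is the homogeneous bundle `G ×_H (V ⊗ 𝒟^(1/2)_{eH})`, its sections are the functions
`F` from `G` to `V`-valued half densities on `T_{eH} X` such that `F (g h) = h⁻¹ F (g)`; the value of
the section at `g H` is the class `[g, F g]`. -/
def IsL2Section (H : Subgroup G) (hH : IsClosed (H : Set G)) (τ : UnitaryRep H V)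
    (F : G → Density (1 / 2) (TangentQuot E H) V) : Prop :=
  (∀ (g : G) (h : H) (b : Frame (TangentQuot E H)),
    (F (g * h)).coeff b = τ.hom h⁻¹ (((F g).map (isotropy H h⁻¹)).coeff b)) ∧
  ∀ b : Frame (TangentQuot E H),
    AEStronglyMeasurable (fun g => (F g).coeff b) (lieHaar E G) ∧
    MemLp (fun g => (F g).coeff b) 2 (quotMeasure E H hH)

variable (E) in
/-- The matrix coefficients of `Ind_H^G τ`, the unitary representation of `G` by
`(k F)(g) = F (k⁻¹ g)` on the Hilbert space `L²(X, 𝒱 ⊗ 𝒟^(1/2))`, whose inner product is the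
integral over `X` of the pairing. -/
def inducedCoeffs (H : Subgroup G) (hH : IsClosed (H : Set G)) (τ : UnitaryRep H V) :
    Set (G → ℂ) :=
  {c | ∃ F₁ F₂ : G → Density (1 / 2) (TangentQuot E H) V,
    IsL2Section H hH τ F₁ ∧ IsL2Section H hH τ F₂ ∧
    c = fun k => densityIntegral H hH fun g => (F₁ (k⁻¹ * g)).pair (F₂ g)}

variable (E) in
/-- The wave front set of the unitary representation `Ind_H^G τ`. -/
def inducedWF (H : Subgroup G) (hH : IsClosed (H : Set G)) (τ : UnitaryRep H V) :
    Set (StrongDual ℝ E) :=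
  waveFrontSet lieExp (inducedCoeffs E H hH τ)

end

/-! ### Wavefront condition U -/

/-- The stabilizer `G_x` of the point `x = gH` of `X = G/H`. -/
abbrev stab (H : Subgroup G) (g : G) : Subgroup G := MulAction.stabilizer G (g : G ⧸ H)

/-- The homomorphism `G_x → H`, `k ↦ g⁻¹ k g`, for `x = gH`. -/
def conjHom (H : Subgroup G) (g : G) : stab H g →* H where
  toFun k := ⟨g⁻¹ * k * g, by
    have h := k.2
    rw [MulAction.mem_stabilizer_iff, MulAction.Quotient.smul_coe, smul_eq_mul, eq_comm,
      QuotientGroup.eq] at h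
    simpa [mul_assoc] using h⟩
  map_one' := by ext; simp
  map_mul' a b := by ext; simp [mul_assoc]

variable (E) in
/-- The unitary representation `τ_x` of `G_x` on the fiber `𝒱_x`, `x = gH`. The fiber of
`𝒱 = G ×_H V` at `x` is identified with `V` by `v ↦ [g, v]`, an isometry, and
`k [g, v] = [k g, v] = [g, τ(g⁻¹ k g) v]`. -/
noncomputable def fiberRep (H : Subgroup G) (τ : UnitaryRep H V) (g : G) :
    UnitaryRep (stab H g) V where
  hom := τ.hom.comp (conjHom H g)
  continuous_hom v := by
    have : IsTopologicalGroup G := topologicalGroup_of_lieGroup 𝓘(ℝ, E) ∞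
    refine (τ.continuous_hom v).comp (Continuous.subtype_mk ?_ _)
    fun_prop

/-- The representation `σ_x` of `G_x` on the half densities `𝒟_x^(1/2)` at `x = gH`. -/
noncomputable def halfDensityRep (H : Subgroup G) (g : G) (k : stab H g)
    (z : Density (1 / 2) (TangentQuot E (stab H g)) ℂ) :
    Density (1 / 2) (TangentQuot E (stab H g)) ℂ :=
  z.map (isotropy (stab H g) k)

variable (E) in
/-- Wavefront condition U for `G`, `H`, `τ`. The point `x = gH` of `X` runs over all of `X` as `g`
runs over `G`, and `Y` is integrated over `𝔤_x` with the Lebesgue measure given by the scalar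
product. Inequalities between elements of `𝒟^1_x` or `𝒟^(1/2)_x` are inequalities between their
coefficients at all frames of `T_x X`. -/
def WavefrontConditionU [MeasurableSpace E] [BorelSpace E] (H : Subgroup G) (τ : UnitaryRep H V) :
    Prop :=
  ∀ η : StrongDual ℝ E, η ∉ inducedSet H (subgroupWF E H τ) →
    ∃ Ω ∈ 𝓝 η, Ω ⊆ (inducedSet H (subgroupWF E H τ))ᶜ ∧ ∃ U ∈ 𝓝 (0 : E),
      (∀ φ : E → ℂ, ContDiff ℝ ∞ φ → HasCompactSupport φ → tsupport φ ⊆ U →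
        ∀ N : ℕ, ∃ C : ℝ, ∀ t : ℝ, 0 < t → ∀ ξ ∈ Ω, ∀ g : G, ∀ v₁ v₂ : V,
          ∀ z₁ z₂ : Density (1 / 2) (TangentQuot E (stab H g)) ℂ,
          ∀ b : Frame (TangentQuot E (stab H g)),
          ‖∫ Y : lieAlg E (stab H g),
              inner ℂ v₂ ((fiberRep E H τ g).hom (subExp (stab H g) Y) v₁) *
              ((halfDensityRep H g (subExp (stab H g) Y) z₁).pair z₂).coeff b *
              φ (Y : E) * Complex.exp (Complex.I * t * ξ (Y : E))‖
            ≤ C * ((‖v₁‖ * ‖z₁.coeff b‖) * (‖v₂‖ * ‖z₂.coeff b‖)) * (t ^ N)⁻¹) ∧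
      ∃ C : ℝ, ∀ (g : G) (Y : lieAlg E (stab H g)), (Y : E) ∈ U →
        ∀ (z : Density (1 / 2) (TangentQuot E (stab H g)) ℂ)
          (b : Frame (TangentQuot E (stab H g))),
          ‖(halfDensityRep H g (subExp (stab H g) Y) z).coeff b‖ ≤ C * ‖z.coeff b‖

end Induction

end InducedWaveFront

open InducedWaveFront

set_option linter.unusedSectionVars false

namespace InducedWaveFront

/-! ### Smooth dependence of solutions of an ODE on a parameter -/

section SmoothODE

/-! Let η lie outside the induced set, and write x = gH. The Fourier transform of a matrix
coefficient of the induced representation is an integral over g of slices ∫ ⟨F₁(e^{-Y} g), F₂(g)⟩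
φ(Y) e^{itζ(Y)} dY. It suffices to bound each slice by C t^{-N} ‖F₂(g)‖ ∫ ‖F₁(e^{-Y} g)‖ dY, the
Y-integral being over a ball, with C independent of g. The product ‖F₂(g)‖ ‖F₁(e^{-Y} g)‖ is then
integrable in (g, Y), because left translations are uniformly bounded on L².

F₁ has no smoothness, so the decay must come from the stabilizer directions. If e^{m(W,Y)} = e^W e^Y
with W in 𝔤_x, then equivariance turns F₁(e^{-m(W,Y)} g) into the action of e^W under τ_x ⊗ σ_x on
F₁(e^{-Y} g) (`IsL2Section.inner_coeff_mul`). Substituting m(W, ·) for Y and averaging over W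
against a bump α rewrites the slice as an integral over Y of oscillatory integrals over W in 𝔤_x. In
each of them α times a matrix coefficient of τ_x ⊗ σ_x is paired with a smooth function of phase
tζ(m(W,Y)).

Fourier inversion separates the two factors (`exists_oscillatory_bound`). At frequencies in a cone
around tη the first factor decays, which is part 1 of condition U; part 2 bounds its L¹ norm
uniformly in x. At all other frequencies the second factor decays by nonstationary phase
(`exists_fourier_decay`), because m(W,Y) is close to W + Y and so the gradient in W of its phase is
close to tζ. The mass of α on 𝔤_x is bounded below uniformly in x, since volumes of balls in
subspaces depend only on the dimension. This gives `WavefrontConditionU.exists_slice_bound`. The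
neighborhood of η obtained does not depend on the coefficient, so it also survives the closure in
the wave front set.

The argument rests on basic Lie theory: exp is a local diffeomorphism (`exists_expChart`), a closed
subgroup is locally the image of its Lie algebra (`eventually_mem_lieAlg`), and the modular
character is |det Ad|. The last fact makes |det| of the isotropy action equal to Δ_G/Δ_H
(`abs_det_isotropy`), which is the factor needed for integrals over G/H to be independent of the
cutoff and for translations to be bounded. -/

theorem exists_openPartialHomeomorph_contDiffOn {E F : Type*} [NormedAddCommGroup E]
    [NormedSpace ℝ E] [CompleteSpace E] [NormedAddCommGroup F] [NormedSpace ℝ F] {f : E → F}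
    {a : E} (hf : ∀ᶠ x in 𝓝 a, ContDiffAt ℝ ∞ f x) {f' : E ≃L[ℝ] F}
    (hf' : HasFDerivAt f (f' : E →L[ℝ] F) a) :
    ∃ e : OpenPartialHomeomorph E F, a ∈ e.source ∧ (∀ x, e x = f x) ∧
      (∀ x ∈ e.source, ContDiffAt ℝ ∞ f x) ∧ ∀ y ∈ e.target, ContDiffAt ℝ ∞ e.symm y := by
  have h0 : ContDiffAt ℝ ∞ f a := hf.self_of_nhds
  let e := h0.toOpenPartialHomeomorph f hf' (by simp)
  have hcont : ContinuousAt (fderiv ℝ f) a :=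
    (h0.fderiv_right (m := 0) (by simp)).continuousAt
  -- Invertible operators form an open set, so after shrinking the source the derivative is
  -- invertible at every point, and the inverse is smooth on the whole target rather than at one
  -- point.
  have hev : ∀ᶠ x in 𝓝 a, ContDiffAt ℝ ∞ f x ∧
      ∃ g : E ≃L[ℝ] F, (g : E →L[ℝ] F) = fderiv ℝ f x := by
    refine hf.and (hcont.eventually (p := fun L => ∃ g : E ≃L[ℝ] F, (g : E →L[ℝ] F) = L) ?_)
    rw [hf'.fderiv]
    exact ContinuousLinearEquiv.nhds f'
  obtain ⟨s, hs, hso, has⟩ := mem_nhds_iff.1 hev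
  refine ⟨e.restrOpen s hso, ?_, fun x => rfl, fun x hx => (hs ?_).1, fun y hy => ?_⟩
  · rw [e.restrOpen_source]
    exact ⟨h0.mem_toOpenPartialHomeomorph_source hf' (by simp), has⟩
  · rw [e.restrOpen_source] at hx; exact hx.2
  · have hx : (e.restrOpen s hso).symm y ∈ (e.restrOpen s hso).source :=
      (e.restrOpen s hso).map_target hy
    rw [e.restrOpen_source] at hx
    obtain ⟨h1, g, hg⟩ := hs hx.2
    refine (e.restrOpen s hso).contDiffAt_symm hy (f₀' := g) ?_ h1
    rw [hg]
    exact (h1.differentiableAt (by simp)).hasFDerivAt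

variable {I : Type*} [TopologicalSpace I] [CompactSpace I]

/-- Pointwise application of a continuous family of operators to a continuous family of vectors. -/
noncomputable def pointwiseApply (I : Type*) [TopologicalSpace I] [CompactSpace I] (E F : Type*)
    [NormedAddCommGroup E] [NormedSpace ℝ E] [NormedAddCommGroup F] [NormedSpace ℝ F] :=
  LinearMap.mkContinuous₂
    (LinearMap.mk₂ ℝ (fun (T : C(I, E →L[ℝ] F)) (f : C(I, E)) =>
        (⟨fun i => T i (f i), by fun_prop⟩ : C(I, F)))
      (fun _ _ _ => by ext; simp) (fun _ _ _ => by ext; simp)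
      (fun _ _ _ => by ext; simp) (fun _ _ _ => by ext; simp)) 1
    (fun T f => by
      rw [one_mul, ContinuousMap.norm_le _ (mul_nonneg (norm_nonneg T) (norm_nonneg f))]
      intro i
      exact ((T i).le_opNorm _).trans
        (mul_le_mul (T.norm_coe_le_norm i) (f.norm_coe_le_norm i) (norm_nonneg _) (norm_nonneg T)))

theorem contDiff_pointwiseApply {E F : Type*} [NormedAddCommGroup E] [NormedSpace ℝ E]
    [NormedAddCommGroup F] [NormedSpace ℝ F] {n : WithTop ℕ∞} :
    ContDiff ℝ n (fun T : C(I, E →L[ℝ] F) => pointwiseApply I E F T) :=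
  IsBoundedLinearMap.contDiff ⟨⟨map_add _, map_smul _⟩, 1, one_pos, fun T => by
    rw [one_mul]
    refine ContinuousLinearMap.opNorm_le_bound _ (norm_nonneg T) fun f => ?_
    rw [ContinuousMap.norm_le _ (mul_nonneg (norm_nonneg T) (norm_nonneg f))]
    exact fun i => ((T i).le_opNorm _).trans
      (mul_le_mul (T.norm_coe_le_norm i) (f.norm_coe_le_norm i) (norm_nonneg _) (norm_nonneg T))⟩

/-- Superposition with a fixed continuous function. -/
def superpose (I : Type*) [TopologicalSpace I] {E F : Type*} [TopologicalSpace E]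
    [TopologicalSpace F] (g : C(E, F)) (γ : C(I, E)) : C(I, F) := g.comp γ

universe u in
-- The derivative of γ ↦ g ∘ γ is pointwise multiplication by g' ∘ γ, again a superposition
-- operator, so induction on n applies. The target is quantified inside the induction because it
-- changes from F to E →L F.
theorem contDiff_superpose {E : Type u} [NormedAddCommGroup E] [NormedSpace ℝ E]
    [FiniteDimensional ℝ E] (n : ℕ) : ∀ {F : Type u} [NormedAddCommGroup F] [NormedSpace ℝ F]
    (g : C(E, F)), ContDiff ℝ ∞ g → ContDiff ℝ n (superpose I g) := by
  have : ProperSpace E := FiniteDimensional.proper ℝ E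
  induction n with
  | zero =>
    intro F _ _ g _
    rw [Nat.cast_zero, contDiff_zero]
    exact ContinuousMap.continuous_postcomp g
  | succ n ih =>
    intro F _ _ g hg
    have hg' : ContDiff ℝ ∞ (fderiv ℝ g) := hg.fderiv_right (by simp)
    let g' : C(E, E →L[ℝ] F) := ⟨fderiv ℝ g, hg'.continuous⟩
    rw [Nat.cast_succ, contDiff_succ_iff_hasFDerivAt]
    refine ⟨fun γ => pointwiseApply I E F (superpose I g' γ),
      contDiff_pointwiseApply.comp (ih g' hg'), fun γ => ?_⟩
    rw [hasFDerivAt_iff_isLittleO_nhds_zero, Asymptotics.isLittleO_iff]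
    intro ε hε
    -- For ‖h‖ < 1 all values of γ and γ + h lie in this ball; uniform continuity of g' there makes
    -- the first order remainder small uniformly over `I`.
    have huc : UniformContinuousOn (fderiv ℝ g) (Metric.closedBall 0 (‖γ‖ + 1)) :=
      (isCompact_closedBall _ _).uniformContinuousOn_of_continuous hg'.continuous.continuousOn
    obtain ⟨δ, hδ, hu⟩ := Metric.uniformContinuousOn_iff_le.1 huc ε hε
    filter_upwards [Metric.ball_mem_nhds (0 : C(I, E)) (lt_min hδ one_pos)] with h hh
    rw [mem_ball_zero_iff, lt_min_iff] at hh
    rw [ContinuousMap.norm_le _ (by positivity)]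
    intro i
    have hi : ‖h i‖ ≤ ‖h‖ := h.norm_coe_le_norm i
    have hγi : ‖γ i‖ ≤ ‖γ‖ := γ.norm_coe_le_norm i
    have key := (convex_closedBall (γ i) ‖h‖).norm_image_sub_le_of_norm_hasFDerivWithin_le'
      (f := g) (f' := fderiv ℝ g) (φ := fderiv ℝ g (γ i)) (C := ε) (x := γ i) (y := γ i + h i)
      (fun x _ => ((hg.differentiable (by simp)) x).hasFDerivAt.hasFDerivWithinAt)
      (fun x hx => by
        rw [← dist_eq_norm]
        rw [mem_closedBall_iff_norm] at hx
        refine hu x ?_ (γ i) ?_ ?_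
        · rw [mem_closedBall_zero_iff]
          calc ‖x‖ = ‖γ i + (x - γ i)‖ := by congr 1; abel
            _ ≤ ‖γ i‖ + ‖x - γ i‖ := norm_add_le _ _
            _ ≤ _ := by linarith
        · rw [mem_closedBall_zero_iff]; linarith
        · rw [dist_eq_norm]; linarith)
      (Metric.mem_closedBall_self (norm_nonneg _)) (by simpa using hi)
    simp only [add_sub_cancel_left] at key
    exact key.trans (by gcongr)

/-- The operator `f ↦ ∫_0^t f` on continuous functions on `[-2, 2]`. -/
noncomputable def primitive (E : Type*) [NormedAddCommGroup E] [NormedSpace ℝ E] [CompleteSpace E] :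
    C(Icc (-2 : ℝ) 2, E) →L[ℝ] C(Icc (-2 : ℝ) 2, E) :=
  LinearMap.mkContinuous
    { toFun := fun f => ⟨fun t => ∫ s in (0 : ℝ)..t, IccExtend (by norm_num) f s,
        ((intervalIntegral.differentiable_integral_of_continuous
          (f.continuous.Icc_extend' (h := by norm_num))).continuous).comp continuous_subtype_val⟩
      map_add' := fun f g => by
        ext t
        simp only [ContinuousMap.coe_mk, ContinuousMap.add_apply]
        rw [← intervalIntegral.integral_add
          ((f.continuous.Icc_extend' (h := by norm_num)).intervalIntegrable _ _)
          ((g.continuous.Icc_extend' (h := by norm_num)).intervalIntegrable _ _)]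
        rfl
      map_smul' := fun c f => by
        ext t
        simp only [ContinuousMap.coe_mk, ContinuousMap.smul_apply, RingHom.id_apply]
        rw [← intervalIntegral.integral_smul]
        rfl } 2 (fun f => by
      rw [ContinuousMap.norm_le _ (by positivity)]
      intro t
      refine (intervalIntegral.norm_integral_le_of_norm_le_const (C := ‖f‖)
        fun s _ => f.norm_coe_le_norm _).trans ?_
      rw [mul_comm, sub_zero]
      gcongr
      exact abs_le.2 ⟨t.2.1, t.2.2⟩)

/-- Smooth dependence on the parameter `Y` of the solution of `c' = A(c) Y`, `c(0) = 0`. -/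
theorem exists_smooth_solution {E : Type*} [NormedAddCommGroup E] [NormedSpace ℝ E]
    [FiniteDimensional ℝ E] {A : E → E →L[ℝ] E} (hA : ContDiff ℝ ∞ A) :
    ∃ c : E → ℝ → E, c 0 = 0 ∧ (∀ᶠ Y in 𝓝 0, ContDiffAt ℝ ∞ (fun Z => c Z 1) Y) ∧
      (∀ Y, Continuous (c Y)) ∧ (∀ Y, c Y 0 = 0) ∧
      (∀ ε > 0, ∀ᶠ Y in 𝓝 (0 : E), ∀ t, ‖c Y t‖ < ε) ∧
      ∀ᶠ Y in 𝓝 0, ∀ t ∈ Ioo (-2 : ℝ) 2, HasDerivAt (c Y) (A (c Y t) Y) t := by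
  have : CompleteSpace E := FiniteDimensional.complete ℝ E
  let I := Icc (-2 : ℝ) 2
  let X := C(I, E)
  let A' : C(E, E →L[ℝ] E) := ⟨A, hA.continuous⟩
  let κ : E →L[ℝ] X := LinearMap.mkContinuous
    { toFun := fun Y => ContinuousMap.const I Y
      map_add' := fun _ _ => rfl
      map_smul' := fun _ _ => rfl } 1 (fun Y => by
        rw [one_mul, ContinuousMap.norm_le _ (norm_nonneg _)]
        exact fun _ => le_rfl)
  let R : E × X → X := fun p => primitive E (pointwiseApply I E E (superpose I A' p.2) (κ p.1))
  have hsup : ContDiff ℝ ∞ (superpose I A') :=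
    contDiff_infty.2 fun n => contDiff_superpose n A' hA
  have hR : ContDiff ℝ ∞ R := by
    refine (primitive E).contDiff.comp (ContDiff.clm_apply ?_ (κ.contDiff.comp contDiff_fst))
    exact contDiff_pointwiseApply.comp (hsup.comp contDiff_snd)
  let T : E →L[ℝ] X := (primitive E).comp ((pointwiseApply I E E (superpose I A' 0)).comp κ)
  -- The integral equation γ = R(Y, γ) reads Φ(Y, γ) = (Y, 0). As R is linear in Y and vanishes at Y
  -- = 0, the derivative of Φ at the origin is unipotent, and the inverse function theorem gives γ
  -- smoothly in Y.
  let Φ : E × X → E × X := fun p => (p.1, p.2 - R p)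
  have hΦ : ContDiff ℝ ∞ Φ := contDiff_fst.prodMk (contDiff_snd.sub hR)
  have hR' : HasFDerivAt R (T.comp (ContinuousLinearMap.fst ℝ E X)) (0, 0) := by
    have h1 : HasFDerivAt (fun p : E × X => pointwiseApply I E E (superpose I A' p.2)) _
        ((0 : E), (0 : X)) :=
      ((contDiff_pointwiseApply.comp (hsup.comp contDiff_snd)).differentiable
        (by simp) _).hasFDerivAt
    have h2 : HasFDerivAt (fun p : E × X => κ p.1) _ ((0 : E), (0 : X)) :=
      (κ.comp (ContinuousLinearMap.fst ℝ E X)).hasFDerivAt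
    have h3 := (primitive E).hasFDerivAt.comp _ (h1.clm_apply h2)
    refine h3.congr_fderiv ?_
    ext p <;> simp [T]
  let D : (E × X) ≃L[ℝ] (E × X) :=
    (ContinuousLinearEquiv.refl ℝ E).skewProd (ContinuousLinearEquiv.refl ℝ X) (-T)
  have hD : HasFDerivAt Φ (D : (E × X) →L[ℝ] (E × X)) ((0 : E), (0 : X)) := by
    have := (hasFDerivAt_fst (𝕜 := ℝ) (E := E) (F := X) (p := (0, 0))).prodMk
      ((hasFDerivAt_snd (𝕜 := ℝ) (E := E) (F := X) (p := (0, 0))).sub hR')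
    refine this.congr_fderiv ?_
    ext p <;> simp [D]
  obtain ⟨e, he0, he, -, hes⟩ := exists_openPartialHomeomorph_contDiffOn
    (Eventually.of_forall fun x => hΦ.contDiffAt) hD
  have hR0 : ∀ γ, R (0, γ) = 0 := fun γ => by simp [R]
  have hΦ0 : Φ (0, 0) = (0, 0) := by simp [Φ, hR0]
  have ht0 : ((0 : E), (0 : X)) ∈ e.target := by
    rw [← hΦ0, ← he]; exact e.map_source he0
  have hs0 : e.symm (0, 0) = (0, 0) := by
    conv_lhs => rw [← hΦ0, ← he]
    exact e.left_inv he0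
  let γ : E → X := fun Y => (e.symm (Y, 0)).2
  have hin : Tendsto (fun Y : E => (Y, (0 : X))) (𝓝 0) (𝓝 (0, 0)) :=
    (Continuous.prodMk_left (0 : X)).tendsto' 0 _ rfl
  have hmem : ∀ᶠ Y : E in 𝓝 0, (Y, (0 : X)) ∈ e.target := hin (e.open_target.mem_nhds ht0)
  have hγs : ∀ᶠ Y in 𝓝 0, ContDiffAt ℝ ∞ γ Y := hmem.mono fun Y hY =>
    contDiffAt_snd.comp Y ((hes _ hY).comp Y (contDiffAt_id.prodMk contDiffAt_const))
  have hγ0 : γ 0 = 0 := by simp [γ, hs0]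
  have hγ : ∀ᶠ Y in 𝓝 0, γ Y = R (Y, γ Y) := hmem.mono fun Y hY => by
    have h1 : Φ (e.symm (Y, 0)) = (Y, 0) := by rw [← he]; exact e.right_inv hY
    have h2 : (e.symm (Y, 0)).1 = Y := congrArg Prod.fst h1
    have h3 : e.symm (Y, 0) = (Y, γ Y) := Prod.ext h2 rfl
    rw [h3] at h1
    exact sub_eq_zero.1 (congrArg Prod.snd h1)
  have hle : (-2 : ℝ) ≤ 2 := by norm_num
  have hmem0 : (0 : ℝ) ∈ I := ⟨by norm_num, by norm_num⟩
  have hmem1 : (1 : ℝ) ∈ I := ⟨by norm_num, by norm_num⟩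
  have h00 : ∀ Y, γ Y ⟨0, hmem0⟩ = R (Y, γ Y) ⟨0, hmem0⟩ → γ Y ⟨0, hmem0⟩ = 0 := fun Y h => by
    rw [h]; exact intervalIntegral.integral_same
  -- Subtracting the value at 0 enforces c Y 0 = 0 for every Y, even where γ does not solve the
  -- equation; near Y = 0 the subtracted term vanishes.
  refine ⟨fun Y t => IccExtend hle (γ Y) t - γ Y ⟨0, hmem0⟩, ?_, ?_, ?_, ?_, ?_, ?_⟩
  · funext t; simp [hγ0, IccExtend]; exact sub_self (0 : E)
  · have ev : ∀ t : I, ContDiff ℝ ∞ (fun f : X => f t) := fun t =>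
      (LinearMap.mkContinuous (LinearMap.mk (AddHom.mk (fun f : X => f t) fun _ _ => rfl)
        fun _ _ => rfl) 1 fun f => by
          rw [one_mul]; exact f.norm_coe_le_norm t).contDiff
    refine hγs.mono fun Y hY => ?_
    have : (fun Z => IccExtend hle (γ Z) 1 - γ Z ⟨0, hmem0⟩) =
        fun Z => γ Z ⟨1, hmem1⟩ - γ Z ⟨0, hmem0⟩ := by
      funext Z; rw [IccExtend_of_mem hle _ hmem1]
    rw [this]
    exact ((ev _).contDiffAt.comp Y hY).sub ((ev _).contDiffAt.comp Y hY)
  · exact fun Y => ((γ Y).continuous.Icc_extend').sub continuous_const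
  · intro Y
    change IccExtend hle (γ Y) 0 - γ Y ⟨0, hmem0⟩ = 0
    rw [IccExtend_of_mem hle _ hmem0, sub_self]
  · intro ε hε
    have h1 : ContinuousAt γ 0 := hγs.self_of_nhds.continuousAt
    have h2 := h1.eventually (Metric.ball_mem_nhds (γ 0) (half_pos hε))
    filter_upwards [h2] with Y hY t
    rw [hγ0, dist_zero_right] at hY
    calc ‖IccExtend hle (γ Y) t - γ Y ⟨0, hmem0⟩‖ ≤ ‖IccExtend hle (γ Y) t‖ + ‖γ Y ⟨0, hmem0⟩‖ :=
          norm_sub_le _ _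
      _ ≤ ‖γ Y‖ + ‖γ Y‖ := add_le_add ((γ Y).norm_coe_le_norm _) ((γ Y).norm_coe_le_norm _)
      _ < ε := by linarith
  · filter_upwards [hγ] with Y hY t ht
    have hz := h00 Y (by rw [← hY])
    have hc : Continuous fun s => A (IccExtend hle (γ Y) s) Y := by
      have := (γ Y).continuous.Icc_extend' (h := hle)
      exact (hA.continuous.comp this).clm_apply continuous_const
    have hd := (intervalIntegral.integral_hasDerivAt_right (hc.intervalIntegrable 0 t)
      (hc.stronglyMeasurableAtFilter _ _) hc.continuousAt)
    simp only [hz, sub_zero]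
    refine hd.congr_of_eventuallyEq ?_
    filter_upwards [Ioo_mem_nhds ht.1 ht.2] with s hs
    have hs' : s ∈ I := ⟨hs.1.le, hs.2.le⟩
    rw [IccExtend_of_mem hle _ hs']
    exact congrArg (fun f : X => f ⟨s, hs'⟩) hY

end SmoothODE

/-! ### The exponential map as a local diffeomorphism -/

section ExpChart

variable {E : Type*} [NormedAddCommGroup E] [InnerProductSpace ℝ E] [FiniteDimensional ℝ E]
  {G : Type*} [TopologicalSpace G] [ChartedSpace E G]

/-- The inverse of the preferred chart at `1`, centered at the origin. -/
noncomputable def centeredChart (G : Type*) [TopologicalSpace G] [ChartedSpace E G] [One G]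
    (x : E) : G :=
  (chartAt E (1 : G)).symm (x + chartAt E (1 : G) 1)

theorem centeredChart_zero [One G] : centeredChart G (0 : E) = 1 := by
  simp [centeredChart]

/-- Tangent vectors at `1` are read in the preferred chart at `1`, so the inverse of this chart has
derivative exactly the identity. -/
theorem hasMFDerivAt_centeredChart_zero [One G] [IsManifold 𝓘(ℝ, E) ∞ G] :
    HasMFDerivAt 𝓘(ℝ, E) 𝓘(ℝ, E) (centeredChart G : E → G) 0 (ContinuousLinearMap.id ℝ E) := by
  set φ := chartAt E (1 : G)
  have ht : (0 : E) + φ 1 ∈ φ.target := by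
    rw [zero_add]; exact φ.map_source (mem_chart_source E 1)
  have hev : ∀ᶠ x : E in 𝓝 0, x + φ 1 ∈ φ.target :=
    (continuous_id.add continuous_const).continuousAt.eventually (φ.open_target.mem_nhds ht)
  refine ⟨?_, ?_⟩
  · have h1 : ContinuousAt (fun x : E => x + φ 1) 0 := by fun_prop
    exact ContinuousAt.comp (f := fun x : E => x + φ 1) (g := φ.symm)
      (φ.continuousAt_symm ht) h1
  · have h2 : (writtenInExtChartAt 𝓘(ℝ, E) 𝓘(ℝ, E) (0 : E) (centeredChart G : E → G))
        =ᶠ[𝓝 0] fun x => x + φ 1 := by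
      filter_upwards [hev] with x hx
      simp only [writtenInExtChartAt, centeredChart_zero, mfld_simps]
      exact φ.right_inv hx
    have h3 := ((hasFDerivAt_id (𝕜 := ℝ) (0 : E)).add_const (φ 1)).congr_of_eventuallyEq h2
    exact h3.hasFDerivWithinAt

theorem contMDiffAt_centeredChart [One G] [IsManifold 𝓘(ℝ, E) ∞ G] :
    ∀ᶠ x : E in 𝓝 0, ContMDiffAt 𝓘(ℝ, E) 𝓘(ℝ, E) ∞ (centeredChart G : E → G) x := by
  set φ := chartAt E (1 : G)
  have ht : (0 : E) + φ 1 ∈ φ.target := by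
    rw [zero_add]; exact φ.map_source (mem_chart_source E 1)
  have hev : ∀ᶠ x : E in 𝓝 0, x + φ 1 ∈ φ.target :=
    (continuous_id.add continuous_const).continuousAt.eventually (φ.open_target.mem_nhds ht)
  filter_upwards [hev] with x hx
  have h1 : ContMDiffAt 𝓘(ℝ, E) 𝓘(ℝ, E) ∞ φ.symm (x + φ 1) :=
    (contMDiffOn_chart_symm (I := 𝓘(ℝ, E)) (n := ∞) (x := (1 : G))).contMDiffAt
      (φ.open_target.mem_nhds hx)
  have h2 : ContMDiffAt 𝓘(ℝ, E) 𝓘(ℝ, E) ∞ (fun x : E => x + φ 1) x :=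
    (contDiff_id.add contDiff_const).contDiffAt.contMDiffAt
  exact ContMDiffAt.comp (f := fun x : E => x + φ 1) x h1 h2

variable [Group G] [LieGroup 𝓘(ℝ, E) ∞ G]

/-- Group multiplication in the centered chart. -/
noncomputable def chartMul (G : Type*) [TopologicalSpace G] [ChartedSpace E G] [Group G]
    (p : E × E) : E :=
  chartAt E (1 : G) (centeredChart G p.1 * centeredChart G p.2) - chartAt E (1 : G) 1

variable (E G) in
theorem eventually_chartMul : ∀ᶠ p : E × E in 𝓝 0, ContDiffAt ℝ ∞ (chartMul G) p ∧
    centeredChart G (chartMul G p) = centeredChart G p.1 * centeredChart G p.2 := by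
  set φ := chartAt E (1 : G)
  have : IsTopologicalGroup G := topologicalGroup_of_lieGroup 𝓘(ℝ, E) ∞
  have hc := contMDiffAt_centeredChart (E := E) (G := G)
  have h1 : ∀ᶠ p : E × E in 𝓝 0, ContMDiffAt 𝓘(ℝ, E) 𝓘(ℝ, E) ∞ (centeredChart G : E → G) p.1 :=
    (continuous_fst.tendsto' (0 : E × E) 0 rfl).eventually hc
  have h2 : ∀ᶠ p : E × E in 𝓝 0, ContMDiffAt 𝓘(ℝ, E) 𝓘(ℝ, E) ∞ (centeredChart G : E → G) p.2 :=
    (continuous_snd.tendsto' (0 : E × E) 0 rfl).eventually hc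
  have hm : ∀ p : E × E, ContMDiffAt 𝓘(ℝ, E) 𝓘(ℝ, E) ∞ (centeredChart G : E → G) p.1 →
      ContMDiffAt 𝓘(ℝ, E) 𝓘(ℝ, E) ∞ (centeredChart G : E → G) p.2 →
      ContMDiffAt 𝓘(ℝ, E × E) 𝓘(ℝ, E) ∞
        (fun p : E × E => centeredChart G p.1 * centeredChart G p.2) p := by
    intro p h1 h2
    have k1 : ContMDiffAt 𝓘(ℝ, E × E) 𝓘(ℝ, E) ∞ (fun p : E × E => p.1) p :=
      contDiff_fst.contDiffAt.contMDiffAt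
    have k2 : ContMDiffAt 𝓘(ℝ, E × E) 𝓘(ℝ, E) ∞ (fun p : E × E => p.2) p :=
      contDiff_snd.contDiffAt.contMDiffAt
    exact ContMDiffAt.mul (ContMDiffAt.comp (f := fun p : E × E => p.1) p h1 k1)
      (ContMDiffAt.comp (f := fun p : E × E => p.2) p h2 k2)
  have h3 : ∀ᶠ p : E × E in 𝓝 0, centeredChart G p.1 * centeredChart G p.2 ∈ φ.source := by
    refine ((hm 0 h1.self_of_nhds h2.self_of_nhds).continuousAt).eventually
      (φ.open_source.mem_nhds ?_)
    simp only [Prod.fst_zero, Prod.snd_zero, centeredChart_zero, mul_one]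
    exact mem_chart_source E 1
  filter_upwards [h1, h2, h3] with p h1 h2 h3
  constructor
  · have h4 : ContMDiffAt 𝓘(ℝ, E) 𝓘(ℝ, E) ∞ φ (centeredChart G p.1 * centeredChart G p.2) :=
      (contMDiffOn_chart (I := 𝓘(ℝ, E)) (n := ∞) (x := (1 : G))).contMDiffAt
        (φ.open_source.mem_nhds h3)
    have h5 := ContMDiffAt.comp (f := fun p : E × E => centeredChart G p.1 * centeredChart G p.2)
      p h4 (hm p h1 h2)
    exact h5.contDiffAt.sub contDiffAt_const
  · simp only [centeredChart, chartMul, sub_add_cancel]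
    exact φ.left_inv h3

theorem eventually_chartMul_zero : ∀ᶠ x : E in 𝓝 0, chartMul G (x, 0) = x := by
  set φ := chartAt E (1 : G)
  have ht : (0 : E) + φ 1 ∈ φ.target := by
    rw [zero_add]; exact φ.map_source (mem_chart_source E 1)
  have hev : ∀ᶠ x : E in 𝓝 0, x + φ 1 ∈ φ.target :=
    (continuous_id.add continuous_const).continuousAt.eventually (φ.open_target.mem_nhds ht)
  filter_upwards [hev] with x hx
  simp only [chartMul, centeredChart_zero, mul_one]
  simp only [centeredChart]
  rw [φ.right_inv hx, add_sub_cancel_right]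

/-- The left invariant vector field of `Y` in the centered chart, as a linear function of `Y`. -/
noncomputable def chartField (G : Type*) [TopologicalSpace G] [ChartedSpace E G] [Group G]
    (x : E) : E →L[ℝ] E :=
  fderiv ℝ (fun y => chartMul G (x, y)) 0

/-- Obtained by differentiating at y = 0 the identity that `chartMul` becomes group multiplication
under `centeredChart`. It transports the ODE of the left invariant field to the vector space `E`. -/
theorem eventually_chartField : ∀ᶠ x : E in 𝓝 0, ContDiffAt ℝ ∞ (chartField G) x ∧
    MDifferentiableAt 𝓘(ℝ, E) 𝓘(ℝ, E) (centeredChart G : E → G) x ∧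
    ∀ Y : E, (mfderiv 𝓘(ℝ, E) 𝓘(ℝ, E) (centeredChart G : E → G) x : E →L[ℝ] E)
      (chartField G x Y) = leftField Y (centeredChart G x) := by
  have h1 : ∀ᶠ x : E in 𝓝 0, ∀ᶠ p : E × E in 𝓝 (x, 0), ContDiffAt ℝ ∞ (chartMul G) p ∧
      centeredChart G (chartMul G p) = centeredChart G p.1 * centeredChart G p.2 :=
    ((Continuous.prodMk_left (0 : E)).tendsto' (0 : E) (0 : E × E) rfl).eventually
      (eventually_chartMul E G).eventually_nhds
  filter_upwards [h1, eventually_chartMul_zero (G := G),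
    contMDiffAt_centeredChart (G := G)] with x hx h0 hc
  refine ⟨ContDiffAt.fderiv (n := ∞) (f := fun x y => chartMul G (x, y)) (g := fun _ => 0)
    hx.self_of_nhds.1 contDiffAt_const (by simp), hc.mdifferentiableAt (by simp), fun Y => ?_⟩
  have hcd : DifferentiableAt ℝ (fun y => chartMul G (x, y)) 0 :=
    (hx.self_of_nhds.1.comp (0 : E) (contDiffAt_const.prodMk contDiffAt_id)).differentiableAt
      (by simp)
  have hin : Tendsto (fun y : E => (x, y)) (𝓝 0) (𝓝 (x, 0)) :=
    (Continuous.prodMk_right x).tendsto _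
  have e1 : (fun y => centeredChart G (chartMul G (x, y))) =ᶠ[𝓝 0]
      fun y => centeredChart G x * centeredChart G y :=
    (hin.eventually hx).mono fun y hy => hy.2
  have hL : HasMFDerivAt 𝓘(ℝ, E) 𝓘(ℝ, E) (fun y => centeredChart G (chartMul G (x, y))) (0 : E)
      ((mfderiv 𝓘(ℝ, E) 𝓘(ℝ, E) (centeredChart G : E → G) x : E →L[ℝ] E).comp
        (chartField (E := E) G x)) := by
    have hd : HasMFDerivAt 𝓘(ℝ, E) 𝓘(ℝ, E) (centeredChart G : E → G) (chartMul G (x, (0 : E)))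
        (mfderiv 𝓘(ℝ, E) 𝓘(ℝ, E) (centeredChart G : E → G) x : E →L[ℝ] E) := by
      rw [h0]; exact (hc.mdifferentiableAt (by simp)).hasMFDerivAt
    have hd' : HasMFDerivAt 𝓘(ℝ, E) 𝓘(ℝ, E) (fun y => chartMul G (x, y)) (0 : E)
        (chartField (E := E) G x) := HasFDerivAt.hasMFDerivAt (by exact hcd.hasFDerivAt)
    exact HasMFDerivAt.comp (g := (centeredChart G : E → G)) (f := fun y => chartMul G (x, y))
      (0 : E) hd hd'
  have hR : HasMFDerivAt 𝓘(ℝ, E) 𝓘(ℝ, E) (fun y => centeredChart G x * centeredChart G y) (0 : E)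
      ((tderiv (fun z : G => centeredChart G x * z) 1 : E →L[ℝ] E).comp
        (ContinuousLinearMap.id ℝ E)) := by
    have hd : HasMFDerivAt 𝓘(ℝ, E) 𝓘(ℝ, E) (fun z : G => centeredChart G x * z)
        (centeredChart G (0 : E))
        (tderiv (fun z : G => centeredChart G x * z) 1 : E →L[ℝ] E) := by
      rw [centeredChart_zero]
      exact (mdiff_mul_left (E := E) (centeredChart G x) 1).hasMFDerivAt
    exact HasMFDerivAt.comp (0 : E) hd hasMFDerivAt_centeredChart_zero
  have := hasMFDerivAt_unique hL (hR.congr_of_eventuallyEq e1)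
  exact congrArg (fun f : E →L[ℝ] E => f Y) this

theorem chartField_zero : chartField G (0 : E) = ContinuousLinearMap.id ℝ E := by
  obtain ⟨-, -, h⟩ := (eventually_chartField (E := E) (G := G)).self_of_nhds
  ext Y
  have h1 := h Y
  rw [hasMFDerivAt_centeredChart_zero.mfderiv, centeredChart_zero] at h1
  have h2 : (leftField Y (1 : G) : E) = Y := by
    have : (fun x : G => 1 * x) = id := by ext; simp
    unfold leftField tderiv
    rw [this, mfderiv_id]; rfl
  exact h1.trans h2

variable [T2Space G]

/-- The exponential map is a local diffeomorphism at the origin. -/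
theorem exists_expChart (E G : Type*) [NormedAddCommGroup E] [InnerProductSpace ℝ E]
    [FiniteDimensional ℝ E] [TopologicalSpace G] [ChartedSpace E G] [Group G]
    [LieGroup 𝓘(ℝ, E) ∞ G] [T2Space G] :
    ∃ e : OpenPartialHomeomorph E G, 0 ∈ e.source ∧ (∀ x ∈ e.source, e x = lieExp x) ∧
      ContMDiffOn 𝓘(ℝ, E) 𝓘(ℝ, E) ∞ e e.source ∧
      ContMDiffOn 𝓘(ℝ, E) 𝓘(ℝ, E) ∞ e.symm e.target := by
  obtain ⟨s, hs, hso, h0s⟩ := mem_nhds_iff.1 (eventually_chartField (E := E) (G := G))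
  obtain ⟨ρ, hρ, hρs⟩ := Metric.isOpen_iff.1 hso 0 h0s
  let β : ContDiffBump (0 : E) := ⟨ρ / 4, ρ / 2, by positivity, by linarith⟩
  -- The cutoff makes the field globally smooth. For small Y the solution stays in the ball of
  -- radius ρ / 4, where nothing has changed.
  let A : E → E →L[ℝ] E := fun x => β x • chartField G x
  have hA : ContDiff ℝ ∞ A := by
    rw [contDiff_iff_contDiffAt]
    intro x
    by_cases hx : x ∈ s
    · exact β.contDiffAt.smul (hs hx).1
    · have hx' : x ∉ tsupport β := fun h => hx (hρs (by
        rw [β.tsupport_eq] at h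
        exact Metric.closedBall_subset_ball (show ρ / 2 < ρ by linarith) h))
      have : A =ᶠ[𝓝 x] 0 := by
        filter_upwards [(isClosed_tsupport β).isOpen_compl.mem_nhds hx'] with y hy
        simp [A, image_eq_zero_of_notMem_tsupport hy]
      exact contDiffAt_const.congr_of_eventuallyEq this
  have hAeq : ∀ x : E, ‖x‖ < ρ / 4 → A x = chartField G x := fun x hx => by
    simp [A, β.one_of_mem_closedBall (show x ∈ Metric.closedBall 0 (ρ / 4) by simpa using hx.le)]
  obtain ⟨c, hc0, hcs, hcc, hcz, hcsmall, hcd⟩ := exists_smooth_solution hA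
  have hexp : ∀ᶠ Y : E in 𝓝 0, lieExp Y = centeredChart G (c Y 1) := by
    filter_upwards [hcsmall (ρ / 4) (by positivity), hcd] with Y h1 h2
    obtain ⟨γ, hγ⟩ := exists_isExpCurve (G := G) Y
    rw [lieExp_eq hγ]
    have hint : IsMIntegralCurveOn (I := 𝓘(ℝ, E)) (fun t => centeredChart G (c Y t))
        (fun g : G => leftField (E := E) Y g) (Ioo (-2) 2) := by
      intro t ht
      have hmem : c Y t ∈ s := hρs (by
        rw [mem_ball_zero_iff]; exact (h1 t).trans (by linarith))
      obtain ⟨-, hd, hl⟩ := hs hmem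
      have h3 := h2 t ht
      rw [hAeq _ (h1 t)] at h3
      have h4 := (HasMFDerivAt.comp t hd.hasMFDerivAt
        h3.hasFDerivAt.hasMFDerivAt).hasMFDerivWithinAt (s := Ioo (-2) 2)
      have h5 : ((1 : ℝ →L[ℝ] ℝ).smulRight (leftField Y (centeredChart G (c Y t))) : ℝ →L[ℝ] E) =
          (mfderiv 𝓘(ℝ, E) 𝓘(ℝ, E) (centeredChart G : E → G) (c Y t) : E →L[ℝ] E).comp
            (ContinuousLinearMap.toSpanSingleton ℝ (chartField G (c Y t) Y)) := by
        ext
        simp only [ContinuousLinearMap.smulRight_apply, one_apply_eq_self, one_smul]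
        exact (hl Y).symm.trans (congrArg (mfderiv 𝓘(ℝ, E) 𝓘(ℝ, E) (centeredChart G : E → G)
          (c Y t) : E →L[ℝ] E) (one_smul ℝ _).symm)
      exact HasMFDerivWithinAt.congr_mfderiv h4 h5.symm
    -- Uniqueness of integral curves on (-2, 2), an open interval containing time 1.
    refine (isMIntegralCurveOn_Ioo_eqOn_of_contMDiff_boundaryless (t₀ := 0) (a := -2) (b := 2)
      (by norm_num) (contMDiff_leftField (G := G) Y) (hγ.2.isMIntegralCurveOn _) hint ?_)
      (show (1 : ℝ) ∈ Ioo (-2) 2 by norm_num)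
    simp only [hγ.1, hcz, centeredChart_zero]
  -- Along a short solution curve A is within ε of A(0) = id, so the mean value inequality for
  -- c(Y,t) - tY gives ‖c(Y,1) - Y‖ ≤ ε‖Y‖.
  have hder : HasFDerivAt (fun Y => c Y 1) (ContinuousLinearMap.id ℝ E) 0 := by
    rw [hasFDerivAt_iff_isLittleO_nhds_zero, Asymptotics.isLittleO_iff]
    intro ε hε
    have hA0 : A 0 = ContinuousLinearMap.id ℝ E := by
      rw [hAeq 0 (by rw [norm_zero]; positivity), chartField_zero]
    obtain ⟨δ, hδ, hAδ⟩ := Metric.continuousAt_iff.1 (hA.continuous.continuousAt (x := 0)) ε hε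
    filter_upwards [hcsmall δ hδ, hcd] with Y h1 h2
    have hd : ∀ t ∈ Icc (0 : ℝ) 1, HasDerivWithinAt (fun t => c Y t - t • Y)
        (A (c Y t) Y - Y) (Icc 0 1) t := fun t ht => by
      have := (h2 t ⟨by linarith [ht.1], by linarith [ht.2]⟩).sub
        ((hasDerivAt_id t).smul_const Y)
      simpa [Pi.sub_def] using this.hasDerivWithinAt
    have hb := norm_image_sub_le_of_norm_deriv_le_segment_01' (C := ε * ‖Y‖) hd (fun t ht => by
      have h3 := hAδ (x := c Y t) (by rw [dist_zero_right]; exact h1 t)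
      rw [hA0, dist_eq_norm] at h3
      calc ‖A (c Y t) Y - Y‖ = ‖(A (c Y t) - ContinuousLinearMap.id ℝ E) Y‖ := by simp
        _ ≤ ‖A (c Y t) - ContinuousLinearMap.id ℝ E‖ * ‖Y‖ := ContinuousLinearMap.le_opNorm _ _
        _ ≤ ε * ‖Y‖ := by gcongr)
    simpa [hcz, hc0] using hb
  set φ := chartAt E (1 : G)
  let f : E → E := fun Y => c Y 1 + φ 1
  obtain ⟨e₁, h₁0, he₁, he₁s, he₁t⟩ := exists_openPartialHomeomorph_contDiffOn
    (f := f) (a := 0) (hcs.mono fun Y hY => hY.add contDiffAt_const)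
    (f' := ContinuousLinearEquiv.refl ℝ E) (hder.add_const _)
  obtain ⟨u, hu, huo, h0u⟩ := mem_nhds_iff.1 hexp
  let e₂ := e₁.restrOpen u huo
  have hf0 : f 0 = φ 1 := by simp [f, hc0]
  have hsrc : ∀ x ∈ (e₂.trans φ.symm).source, x ∈ e₁.source ∧ x ∈ u ∧ e₁ x ∈ φ.target := by
    intro x hx
    rw [OpenPartialHomeomorph.trans_source, e₁.restrOpen_source] at hx
    exact ⟨hx.1.1, hx.1.2, hx.2⟩
  have htgt : ∀ y ∈ (e₂.trans φ.symm).target, y ∈ φ.source ∧ φ y ∈ e₁.target := by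
    intro y hy
    rw [OpenPartialHomeomorph.trans_target] at hy
    refine ⟨hy.1, ?_⟩
    have h1 := e₂.map_target hy.2
    rw [e₁.restrOpen_source] at h1
    have h2 := e₁.map_source h1.1
    rwa [show e₁ (e₂.symm (φ.symm.symm y)) = φ y from e₂.right_inv hy.2] at h2
  refine ⟨e₂.trans φ.symm, ?_, fun x hx => ?_, fun x hx => ?_, fun y hy => ?_⟩
  · rw [OpenPartialHomeomorph.trans_source, e₁.restrOpen_source]
    refine ⟨⟨h₁0, h0u⟩, ?_⟩
    change e₁ 0 ∈ φ.target
    rw [he₁, hf0]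
    exact φ.map_source (mem_chart_source E 1)
  · obtain ⟨-, h2, -⟩ := hsrc x hx
    rw [show lieExp x = centeredChart G (c x 1) from hu h2]
    change φ.symm (e₁ x) = _
    rw [he₁]; rfl
  · obtain ⟨h1, -, h3⟩ := hsrc x hx
    have k1 : ContMDiffAt 𝓘(ℝ, E) 𝓘(ℝ, E) ∞ φ.symm (e₁ x) :=
      (contMDiffOn_chart_symm (I := 𝓘(ℝ, E)) (n := ∞) (x := (1 : G))).contMDiffAt
        (φ.open_target.mem_nhds h3)
    have k2 : ContMDiffAt 𝓘(ℝ, E) 𝓘(ℝ, E) ∞ e₁ x := by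
      rw [show (e₁ : E → E) = f from funext he₁]
      exact (he₁s x h1).contMDiffAt
    exact (ContMDiffAt.comp x k1 k2).contMDiffWithinAt
  · obtain ⟨h1, h2⟩ := htgt y hy
    have k1 : ContMDiffAt 𝓘(ℝ, E) 𝓘(ℝ, E) ∞ φ y :=
      (contMDiffOn_chart (I := 𝓘(ℝ, E)) (n := ∞) (x := (1 : G))).contMDiffAt
        (φ.open_source.mem_nhds h1)
    exact (ContMDiffAt.comp y (he₁t _ h2).contMDiffAt k1).contMDiffWithinAt

end ExpChart

/-! ### One-parameter subgroups and the closed subgroup theorem -/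

section ClosedSubgroups

variable {E : Type*} [NormedAddCommGroup E] [InnerProductSpace ℝ E] [FiniteDimensional ℝ E]
  {G : Type*} [TopologicalSpace G] [ChartedSpace E G] [Group G] [LieGroup 𝓘(ℝ, E) ∞ G] [T2Space G]

/-- Left invariance of the field; with uniqueness it yields the homomorphism law γ(s + t) = γ(s)
γ(t). -/
theorem IsExpCurve.mul_left_shift {Y : E} {γ : ℝ → G} (h : IsExpCurve Y γ) (s : ℝ) :
    IsExpCurve Y (fun t => (γ s)⁻¹ * γ (t + s)) := by
  refine ⟨by simp, fun t => ?_⟩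
  exact hasMFDerivWithinAt_univ.1 (hasMFDerivWithinAt_curve (mdiff_mul_left _)
    (hasMFDerivWithinAt_univ.2 ((h.2.comp_add s) t)) (leftField_mul Y _ (γ (t + s))))

theorem IsExpCurve.map_add {Y : E} {γ : ℝ → G} (h : IsExpCurve Y γ) (s t : ℝ) :
    γ (s + t) = γ s * γ t := by
  have := congrFun ((h.mul_left_shift s).unique h) t
  rw [← this, mul_inv_cancel_left, add_comm]

theorem leftField_smul (a : ℝ) (Y : E) (g : G) :
    (leftField (a • Y) g : E) = a • (leftField Y g : E) :=
  map_smul (tderiv (fun x : G => g * x) 1 : E →L[ℝ] E) a Y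

theorem IsExpCurve.comp_mul {Y : E} {γ : ℝ → G} (h : IsExpCurve Y γ) (a : ℝ) :
    IsExpCurve (a • Y) (fun t => γ (t * a)) := by
  refine ⟨by simp [h.1], ?_⟩
  have h1 := IsMIntegralCurve.comp_mul h.2 a
  intro t
  have h2 := h1 t
  exact HasMFDerivAt.congr_mfderiv h2 (congrArg (fun v : E => (1 : ℝ →L[ℝ] ℝ).smulRight v)
    (leftField_smul a Y (γ (t * a))).symm)

theorem IsExpCurve.eq_lieExp {Y : E} {γ : ℝ → G} (h : IsExpCurve Y γ) (t : ℝ) :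
    γ t = lieExp (t • Y) := by
  rw [lieExp_eq (h.comp_mul t), one_mul]

theorem lieExp_add_smul (s t : ℝ) (Y : E) :
    (lieExp ((s + t) • Y) : G) = lieExp (s • Y) * lieExp (t • Y) := by
  obtain ⟨γ, hγ⟩ := exists_isExpCurve (G := G) Y
  rw [← hγ.eq_lieExp, ← hγ.eq_lieExp, ← hγ.eq_lieExp, hγ.map_add]

theorem lieExp_zero : (lieExp (0 : E) : G) = 1 := by
  have := lieExp_add_smul (G := G) 0 0 (0 : E)
  simpa using this

theorem lieExp_neg (Y : E) : (lieExp (-Y) : G) = (lieExp Y)⁻¹ := by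
  have := lieExp_add_smul (G := G) (-1) 1 Y
  rw [neg_add_cancel, zero_smul, lieExp_zero, one_smul, neg_one_smul] at this
  exact eq_inv_of_mul_eq_one_left this.symm

theorem lieExp_nsmul (n : ℕ) (Y : E) : (lieExp (n • Y) : G) = lieExp Y ^ n := by
  induction n with
  | zero => simp [lieExp_zero]
  | succ n ih =>
    have := lieExp_add_smul (G := G) n 1 Y
    rw [one_smul] at this
    rw [pow_succ, ← ih, ← Nat.cast_smul_eq_nsmul ℝ, ← Nat.cast_smul_eq_nsmul ℝ, ← this,
      Nat.cast_succ]

variable (E G) in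
/-- The exponential map near the origin as a chart. -/
noncomputable def expChart : OpenPartialHomeomorph E G := (exists_expChart E G).choose

variable (E G) in
theorem zero_mem_expChart : (0 : E) ∈ (expChart E G).source :=
  (exists_expChart E G).choose_spec.1

theorem expChart_apply {x : E} (hx : x ∈ (expChart E G).source) : expChart E G x = lieExp x :=
  (exists_expChart E G).choose_spec.2.1 x hx

variable (E G) in
theorem expChart_source_mem : (expChart E G).source ∈ 𝓝 (0 : E) :=
  (expChart E G).open_source.mem_nhds (zero_mem_expChart E G)

variable (E G) in
theorem one_mem_expChart : (1 : G) ∈ (expChart E G).target := by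
  rw [← lieExp_zero (E := E), ← expChart_apply (zero_mem_expChart E G)]
  exact (expChart E G).map_source (zero_mem_expChart E G)

theorem contMDiffAt_lieExp : ∀ᶠ x : E in 𝓝 0,
    ContMDiffAt 𝓘(ℝ, E) 𝓘(ℝ, E) ∞ (lieExp : E → G) x := by
  filter_upwards [(expChart E G).open_source.eventually_mem (zero_mem_expChart E G)] with x hx
  have h1 := ((exists_expChart E G).choose_spec.2.2.1).contMDiffAt
    ((expChart E G).open_source.mem_nhds hx)
  refine h1.congr_of_eventuallyEq ?_
  filter_upwards [(expChart E G).open_source.mem_nhds hx] with y hy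
  exact (expChart_apply hy).symm

theorem contMDiffAt_expChart_symm {g : G} (hg : g ∈ (expChart E G).target) :
    ContMDiffAt 𝓘(ℝ, E) 𝓘(ℝ, E) ∞ (expChart E G).symm g :=
  ((exists_expChart E G).choose_spec.2.2.2).contMDiffAt ((expChart E G).open_target.mem_nhds hg)

variable (E G) in
-- Continuity near 0 spreads to all of `E` through exp Y = exp(Y/(n+1))^{n+1}.
theorem continuous_lieExp : Continuous (lieExp : E → G) := by
  have : IsTopologicalGroup G := topologicalGroup_of_lieGroup 𝓘(ℝ, E) ∞
  rw [continuous_iff_continuousAt]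
  intro X
  have h1 : Tendsto (fun n : ℕ => ((n : ℝ) + 1)⁻¹ • X) atTop (𝓝 0) := by
    have h2 : Tendsto (fun n : ℕ => ((n : ℝ) + 1)⁻¹) atTop (𝓝 0) := by
      simpa using tendsto_one_div_add_atTop_nhds_zero_nat (𝕜 := ℝ)
    simpa using h2.smul_const X
  obtain ⟨n, hn⟩ := (h1.eventually (contMDiffAt_lieExp (E := E) (G := G))).exists
  have h2 : (lieExp : E → G) = fun Y => (lieExp (((n : ℝ) + 1)⁻¹ • Y) : G) ^ (n + 1) := by
    funext Y
    rw [← lieExp_nsmul, ← Nat.cast_smul_eq_nsmul ℝ, smul_smul, Nat.cast_succ,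
      mul_inv_cancel₀ (by positivity), one_smul]
  rw [h2]
  have h3 : ContinuousAt (fun Y : E => ((n : ℝ) + 1)⁻¹ • Y) X := by fun_prop
  exact (ContinuousAt.comp (g := (lieExp : E → G)) hn.continuousAt h3).pow _

/-- Group multiplication in exponential coordinates. -/
noncomputable def logMul (G : Type*) [TopologicalSpace G] [ChartedSpace E G] [Group G]
    [LieGroup 𝓘(ℝ, E) ∞ G] [T2Space G] (p : E × E) : E :=
  (expChart E G).symm (lieExp p.1 * lieExp p.2)

theorem logMul_left_zero {x : E} (hx : x ∈ (expChart E G).source) : logMul G (0, x) = x := by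
  rw [logMul, lieExp_zero, one_mul, ← expChart_apply hx, (expChart E G).left_inv hx]

theorem logMul_right_zero {x : E} (hx : x ∈ (expChart E G).source) : logMul G (x, 0) = x := by
  rw [logMul, lieExp_zero, mul_one, ← expChart_apply hx, (expChart E G).left_inv hx]

variable (E G) in
theorem eventually_logMul : ∀ᶠ p : E × E in 𝓝 0, ContDiffAt ℝ ∞ (logMul G) p ∧
    logMul G p ∈ (expChart E G).source ∧
    (lieExp (logMul G p) : G) = lieExp p.1 * lieExp p.2 := by
  have : IsTopologicalGroup G := topologicalGroup_of_lieGroup 𝓘(ℝ, E) ∞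
  have h1 := (continuous_fst.tendsto' (0 : E × E) 0 rfl).eventually
    (contMDiffAt_lieExp (E := E) (G := G))
  have h2 := (continuous_snd.tendsto' (0 : E × E) 0 rfl).eventually
    (contMDiffAt_lieExp (E := E) (G := G))
  have hc : Continuous fun p : E × E => (lieExp p.1 * lieExp p.2 : G) :=
    ((continuous_lieExp E G).comp continuous_fst).mul ((continuous_lieExp E G).comp continuous_snd)
  have h3 : ∀ᶠ p : E × E in 𝓝 0, (lieExp p.1 * lieExp p.2 : G) ∈ (expChart E G).target := by
    refine hc.continuousAt.eventually ((expChart E G).open_target.mem_nhds ?_)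
    simpa [lieExp_zero] using one_mem_expChart E G
  filter_upwards [h1, h2, h3] with p h1 h2 h3
  refine ⟨?_, (expChart E G).map_target h3, ?_⟩
  · have k1 : ContMDiffAt 𝓘(ℝ, E × E) 𝓘(ℝ, E) ∞ (fun p : E × E => p.1) p :=
      contDiff_fst.contDiffAt.contMDiffAt
    have k2 : ContMDiffAt 𝓘(ℝ, E × E) 𝓘(ℝ, E) ∞ (fun p : E × E => p.2) p :=
      contDiff_snd.contDiffAt.contMDiffAt
    have k3 := ContMDiffAt.mul (ContMDiffAt.comp (f := fun p : E × E => p.1) p h1 k1)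
      (ContMDiffAt.comp (f := fun p : E × E => p.2) p h2 k2)
    exact (ContMDiffAt.comp p (contMDiffAt_expChart_symm h3) k3).contDiffAt
  · rw [logMul, ← expChart_apply ((expChart E G).map_target h3)]
    exact (expChart E G).right_inv h3

variable (E G) in
theorem logMul_zero : logMul G (0 : E × E) = 0 :=
  logMul_left_zero (zero_mem_expChart E G)

variable (E G) in
-- Both partial derivatives are the identity, because multiplying by exp 0 = 1 on either side
-- changes nothing.
theorem hasStrictFDerivAt_logMul : HasStrictFDerivAt (logMul G)
    (ContinuousLinearMap.fst ℝ E E + ContinuousLinearMap.snd ℝ E E) (0 : E × E) := by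
  have h := ((eventually_logMul E G).self_of_nhds.1).hasStrictFDerivAt (n := ∞) (by simp)
  have hD : fderiv ℝ (logMul G) (0 : E × E) =
      ContinuousLinearMap.fst ℝ E E + ContinuousLinearMap.snd ℝ E E := by
    set D := fderiv ℝ (logMul G) (0 : E × E) with hDdef
    have k1 : HasFDerivAt (fun x : E => logMul G (x, 0)) (D.comp (.inl ℝ E E)) 0 := by
      have hp : HasFDerivAt (fun x : E => (x, (0 : E))) (.inl ℝ E E) (0 : E) :=
        hasFDerivAt_prodMk_left 0 0
      exact HasFDerivAt.comp (g := logMul G) (0 : E) h.hasFDerivAt hp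
    have k2 : HasFDerivAt (fun x : E => logMul G (0, x)) (D.comp (.inr ℝ E E)) 0 := by
      have hp : HasFDerivAt (fun x : E => ((0 : E), x)) (.inr ℝ E E) (0 : E) :=
        hasFDerivAt_prodMk_right 0 0
      exact HasFDerivAt.comp (g := logMul G) (0 : E) h.hasFDerivAt hp
    have hs := expChart_source_mem E G
    have j1 : HasFDerivAt (fun x : E => logMul G (x, 0)) (ContinuousLinearMap.id ℝ E) 0 :=
      (hasFDerivAt_id (0 : E)).congr_of_eventuallyEq
        (Filter.mem_of_superset hs fun x hx => logMul_right_zero hx)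
    have j2 : HasFDerivAt (fun x : E => logMul G (0, x)) (ContinuousLinearMap.id ℝ E) 0 :=
      (hasFDerivAt_id (0 : E)).congr_of_eventuallyEq
        (Filter.mem_of_superset hs fun x hx => logMul_left_zero hx)
    have e1 := k1.unique j1
    have e2 := k2.unique j2
    ext x
    · simpa using congrArg (fun f : E →L[ℝ] E => f x) e1
    · simpa using congrArg (fun f : E →L[ℝ] E => f x) e2
  rwa [hD] at h

/-- The product formula exp(Y + Z) = lim (exp(Y/n) exp(Z/n))^n, a consequence of the derivative of
`logMul` at the origin, together with closedness of K. It shows that the span in `lieAlg` adds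
nothing. -/
theorem lieExp_smul_add_mem {K : Subgroup G} (hK : IsClosed (K : Set G)) {Y Z : E}
    (hY : ∀ t : ℝ, (lieExp (t • Y) : G) ∈ K) (hZ : ∀ t : ℝ, (lieExp (t • Z) : G) ∈ K) :
    (lieExp (Y + Z) : G) ∈ K := by
  let a : ℕ → ℝ := fun n => ((n : ℝ) + 1)⁻¹
  have ha : Tendsto a atTop (𝓝 0) := by
    simpa [a] using tendsto_one_div_add_atTop_nhds_zero_nat (𝕜 := ℝ)
  have hline : HasDerivAt (fun s : ℝ => (s • Y, s • Z)) (Y, Z) 0 := by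
    simpa using ((hasDerivAt_id (0 : ℝ)).smul_const Y).prodMk ((hasDerivAt_id (0 : ℝ)).smul_const Z)
  have hder : HasDerivAt (fun s : ℝ => logMul G (s • Y, s • Z)) (Y + Z) 0 := by
    have h0 := (hasStrictFDerivAt_logMul E G).hasFDerivAt
    have h1 : HasFDerivAt (logMul G) (ContinuousLinearMap.fst ℝ E E + ContinuousLinearMap.snd ℝ E E)
        ((fun s : ℝ => (s • Y, s • Z)) 0) := by
      simp only [zero_smul]; exact h0
    simpa [Function.comp_def] using h1.comp_hasDerivAt (0 : ℝ) hline
  have hlim : Tendsto (fun n => (n + 1) • logMul G (a n • Y, a n • Z)) atTop (𝓝 (Y + Z)) := by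
    have h1 := hasDerivAt_iff_tendsto_slope_zero.1 hder
    have h2 : Tendsto a atTop (𝓝[≠] 0) := tendsto_nhdsWithin_iff.2
      ⟨ha, Eventually.of_forall fun n => (show (0 : ℝ) < a n by positivity).ne'⟩
    refine (h1.comp h2).congr fun n => ?_
    have h0 : logMul G ((0 : E), (0 : E)) = 0 := logMul_zero E G
    simp only [Function.comp_apply, zero_add, zero_smul, h0, sub_zero, a, inv_inv]
    rw [← Nat.cast_smul_eq_nsmul ℝ, Nat.cast_succ]
  have hin : Tendsto (fun n => (a n • Y, a n • Z)) atTop (𝓝 (0 : E × E)) := by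
    have := (ha.smul_const Y).prodMk_nhds (ha.smul_const Z)
    rwa [zero_smul, zero_smul] at this
  refine hK.mem_of_tendsto (((continuous_lieExp E G).tendsto _).comp hlim) ?_
  filter_upwards [hin.eventually (eventually_logMul E G)] with n hn
  simp only [Function.comp_apply]
  rw [lieExp_nsmul, hn.2.2]
  exact K.pow_mem (K.mul_mem (hY _) (hZ _)) _

theorem mem_lieAlg_iff {K : Subgroup G} (hK : IsClosed (K : Set G)) {Y : E} :
    Y ∈ lieAlg E K ↔ ∀ t : ℝ, (lieExp (t • Y) : G) ∈ K := by
  refine ⟨fun h => ?_, fun h => Submodule.subset_span h⟩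
  induction h using Submodule.span_induction with
  | mem Y h => exact h
  | zero => intro t; rw [smul_zero, lieExp_zero]; exact K.one_mem
  | add Y Z _ _ h1 h2 =>
    intro t
    rw [smul_add]
    exact lieExp_smul_add_mem hK (fun s => by rw [smul_smul]; exact h1 _)
      (fun s => by rw [smul_smul]; exact h2 _)
  | smul c Y _ h => intro t; rw [smul_smul]; exact h _

theorem lieExp_mem {K : Subgroup G} (hK : IsClosed (K : Set G)) {Y : E} (hY : Y ∈ lieAlg E K) :
    (lieExp Y : G) ∈ K := by
  simpa using (mem_lieAlg_iff hK).1 hY 1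

theorem subExp_coe {K : Subgroup G} (hK : IsClosed (K : Set G)) (Y : lieAlg E K) :
    (subExp K Y : G) = lieExp (Y : E) := by
  rw [subExp, dif_pos (lieExp_mem hK Y.2)]

theorem lieExp_zsmul_mem {K : Subgroup G} {x : E} (hx : (lieExp x : G) ∈ K) (n : ℤ) :
    (lieExp ((n : ℝ) • x) : G) ∈ K := by
  obtain ⟨m, rfl | rfl⟩ := n.eq_nat_or_neg
  · rw [Int.cast_natCast, Nat.cast_smul_eq_nsmul, lieExp_nsmul]
    exact K.pow_mem hx m
  · rw [Int.cast_neg, Int.cast_natCast, neg_smul, lieExp_neg, Nat.cast_smul_eq_nsmul, lieExp_nsmul]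
    exact K.inv_mem (K.pow_mem hx m)

/-- The integer multiples ⌊t/‖xₙ‖⌋ xₙ exponentiate into K and converge to t v, since rounding costs
at most ‖xₙ‖. -/
theorem lieExp_smul_mem_of_tendsto {K : Subgroup G} (hK : IsClosed (K : Set G)) {x : ℕ → E}
    (hx : Tendsto x atTop (𝓝 0)) (hx0 : ∀ n, x n ≠ 0) (hxK : ∀ n, (lieExp (x n) : G) ∈ K) {v : E}
    (hv : Tendsto (fun n => ‖x n‖⁻¹ • x n) atTop (𝓝 v)) (t : ℝ) : (lieExp (t • v) : G) ∈ K := by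
  have h1 : Tendsto (fun n => (⌊t / ‖x n‖⌋ : ℝ) * ‖x n‖) atTop (𝓝 t) := by
    have hn : Tendsto (fun n => ‖x n‖) atTop (𝓝 0) := by simpa using hx.norm
    refine tendsto_of_tendsto_of_tendsto_of_le_of_le (g := fun n => t - ‖x n‖) (h := fun _ => t)
      (by simpa using hn.const_sub t) tendsto_const_nhds (fun n => ?_) (fun n => ?_)
    · have hp : 0 < ‖x n‖ := norm_pos_iff.2 (hx0 n)
      have := Int.lt_floor_add_one (t / ‖x n‖)
      rw [div_lt_iff₀ hp] at this
      simp only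
      nlinarith
    · have hp : 0 < ‖x n‖ := norm_pos_iff.2 (hx0 n)
      have := Int.floor_le (t / ‖x n‖)
      rwa [le_div_iff₀ hp] at this
  have h2 : Tendsto (fun n => (⌊t / ‖x n‖⌋ : ℝ) • x n) atTop (𝓝 (t • v)) := by
    refine (h1.smul hv).congr fun n => ?_
    rw [smul_smul, mul_assoc, mul_inv_cancel₀ (norm_ne_zero_iff.2 (hx0 n)), mul_one]
  exact hK.mem_of_tendsto (((continuous_lieExp E G).tendsto _).comp h2)
    (Eventually.of_forall fun n => lieExp_zsmul_mem (hxK n) _)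

/-- Near the identity a closed subgroup is the image of its Lie algebra. -/
theorem eventually_mem_lieAlg {K : Subgroup G} (hK : IsClosed (K : Set G)) :
    ∀ᶠ Y : E in 𝓝 0, (lieExp Y : G) ∈ K → Y ∈ lieAlg E K := by
  set k := lieAlg E K
  let P : E →L[ℝ] E := k.starProjection
  let Q : E →L[ℝ] E := ContinuousLinearMap.id ℝ E - P
  -- Coordinates X ↦ log(exp(PX) exp(QX)) adapted to 𝔨 ⊕ 𝔨ᗮ; the derivative at 0 is P + Q = id.
  let Ψ : E → E := fun X => logMul G (P X, Q X)
  have hPQ : Tendsto (fun X => (P X, Q X)) (𝓝 0) (𝓝 (0 : E × E)) :=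
    (P.continuous.prodMk Q.continuous).tendsto' 0 0 (by simp)
  have hΨd : HasFDerivAt Ψ ((ContinuousLinearEquiv.refl ℝ E : E ≃L[ℝ] E) : E →L[ℝ] E) 0 := by
    have h1 : HasFDerivAt (fun X => (P X, Q X)) (P.prod Q) (0 : E) :=
      P.hasFDerivAt.prodMk Q.hasFDerivAt
    have h2 : HasFDerivAt (logMul G) (ContinuousLinearMap.fst ℝ E E + ContinuousLinearMap.snd ℝ E E)
        ((fun X => (P X, Q X)) 0) := by
      simp only [map_zero]; exact (hasStrictFDerivAt_logMul E G).hasFDerivAt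
    refine (HasFDerivAt.comp (0 : E) h2 h1).congr_fderiv ?_
    ext X; simp [Q]
  have hΨs : ∀ᶠ X in 𝓝 0, ContDiffAt ℝ ∞ Ψ X :=
    (hPQ.eventually (eventually_logMul E G)).mono fun X hX =>
      ContDiffAt.comp (g := logMul G) X hX.1 (P.contDiff.contDiffAt.prodMk Q.contDiff.contDiffAt)
  obtain ⟨e, he0, he, -, -⟩ := exists_openPartialHomeomorph_contDiffOn hΨs hΨd
  have hΨ0 : Ψ 0 = 0 := by simp only [Ψ, map_zero]; exact logMul_zero E G
  have ht0 : (0 : E) ∈ e.target := by rw [← hΨ0, ← he]; exact e.map_source he0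
  have hes0 : e.symm 0 = 0 := by
    conv_lhs => rw [← hΨ0, ← he]
    exact e.left_inv he0
  have hes : Tendsto e.symm (𝓝 0) (𝓝 0) := by
    have := (e.continuousAt_symm ht0).tendsto
    rwa [hes0] at this
  by_contra hcon
  rw [not_eventually] at hcon
  have hev : ∀ᶠ Y : E in 𝓝 0, Y ∈ e.target ∧
      (lieExp (logMul G (P (e.symm Y), Q (e.symm Y))) : G) =
        lieExp (P (e.symm Y)) * lieExp (Q (e.symm Y)) ∧
      P (e.symm Y) ∈ (expChart E G).source :=
    (e.open_target.eventually_mem ht0).and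
      (((hPQ.comp hes).eventually (eventually_logMul E G)).mono (fun Y hY => hY.2.2) |>.and
        ((P.continuous.tendsto' 0 0 (by simp)).comp hes |>.eventually
          (expChart_source_mem E G)))
  obtain ⟨y, hy0, hy⟩ := exists_seq_forall_of_frequently (hcon.and_eventually hev)
  -- From counterexamples yₙ → 0, dividing exp yₙ by the 𝔨-factor leaves exp xₙ in K with xₙ in 𝔨ᗮ,
  -- nonzero since otherwise yₙ would lie in 𝔨. A limit direction of xₙ would be a unit vector in
  -- both 𝔨 and 𝔨ᗮ.
  let x : ℕ → E := fun n => Q (e.symm (y n))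
  have hPk : ∀ z, P z ∈ k := fun z => k.starProjection_apply_mem z
  have hyeq : ∀ n, y n = logMul G (P (e.symm (y n)), Q (e.symm (y n))) := fun n => by
    have := e.right_inv (hy n).2.1
    rw [he] at this
    exact this.symm
  have hxK : ∀ n, (lieExp (x n) : G) ∈ K := fun n => by
    have h1 := (hy n).2.2.1
    rw [← hyeq] at h1
    have h2 : (lieExp (x n) : G) = (lieExp (P (e.symm (y n))))⁻¹ * lieExp (y n) := by
      rw [h1]; simp [x]
    rw [h2]
    exact K.mul_mem (K.inv_mem (lieExp_mem hK (hPk _))) (Classical.not_imp.1 (hy n).1).1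
  have hx0 : ∀ n, x n ≠ 0 := fun n h => by
    have h1 := hyeq n
    rw [show Q (e.symm (y n)) = 0 from h, logMul_right_zero (hy n).2.2.2] at h1
    refine (Classical.not_imp.1 (hy n).1).2 ?_
    rw [h1]
    exact hPk _
  have hxt : Tendsto x atTop (𝓝 0) := by
    have : Tendsto (fun Y => Q (e.symm Y)) (𝓝 0) (𝓝 0) :=
      (Q.continuous.tendsto' 0 0 (by simp)).comp hes
    exact this.comp hy0
  have hperp : ∀ n, x n ∈ kᗮ := fun n =>
    k.sub_starProjection_mem_orthogonal (e.symm (y n))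
  have hsph : ∀ n, ‖x n‖⁻¹ • x n ∈ Metric.sphere (0 : E) 1 := fun n => by
    rw [mem_sphere_zero_iff_norm, norm_smul, norm_inv, norm_norm,
      inv_mul_cancel₀ (norm_ne_zero_iff.2 (hx0 n))]
  obtain ⟨v, hv, θ, hθ, hlim⟩ := (isCompact_sphere (0 : E) 1).tendsto_subseq hsph
  have hvk : v ∈ k := (mem_lieAlg_iff hK).2 fun t =>
    lieExp_smul_mem_of_tendsto hK (hxt.comp hθ.tendsto_atTop) (fun n => hx0 _) (fun n => hxK _)
      hlim t
  have hvp : v ∈ kᗮ := (Submodule.isClosed_orthogonal k).mem_of_tendsto hlim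
    (Eventually.of_forall fun n => kᗮ.smul_mem _ (hperp _))
  have : v = 0 := by
    have := Submodule.inner_right_of_mem_orthogonal hvk hvp
    simpa using this
  rw [this] at hv
  simp at hv

end ClosedSubgroups

/-! ### Haar measure and the modular character in exponential coordinates -/

section ModularCharacter

variable {K : Type*} [Group K] [TopologicalSpace K] [IsTopologicalGroup K] [LocallyCompactSpace K]
  [SecondCountableTopology K] [T2Space K] [MeasurableSpace K] [BorelSpace K]
  {W : Type*} [NormedAddCommGroup W] [NormedSpace ℝ W] [FiniteDimensional ℝ W]
  [MeasurableSpace W] [BorelSpace W]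

/-- Local exponential coordinates on a topological group: a continuous map `e` from a vector space
which is an open embedding near the origin, such that the multiplication in these coordinates is
strictly differentiable at the origin. -/
structure IsExpCoordinate (e : W → K) (m : W × W → W) (R : ℝ) : Prop where
  continuous : Continuous e
  neg : ∀ x, e (-x) = (e x)⁻¹
  radius_pos : 0 < R
  injOn : InjOn e (Metric.ball 0 R)
  isOpen_image : ∀ B ⊆ Metric.ball 0 R, IsOpen B → IsOpen (e '' B)
  mul : ∀ᶠ p : W × W in 𝓝 0, e (m p) = e p.1 * e p.2
  zero : m 0 = 0
  strict : HasStrictFDerivAt m (ContinuousLinearMap.fst ℝ W W + ContinuousLinearMap.snd ℝ W W) 0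

/-- In exponential coordinates Haar measure is comparable to Lebesgue measure. -/
theorem IsExpCoordinate.haar_comparable {e : W → K} {m : W × W → W} {R : ℝ}
    (h : IsExpCoordinate e m R) (μ : Measure W) [μ.IsAddHaarMeasure] (ν : Measure K)
    [ν.IsHaarMeasure] :
    ∃ a b : ℝ≥0∞, a ≠ 0 ∧ b ≠ ⊤ ∧ ∃ δ > 0, ∀ B : Set W, IsOpen B → B ⊆ Metric.ball 0 δ →
      a * μ B ≤ ν (e '' B) ∧ ν (e '' B) ≤ b * μ B := by
  have hdet : (ContinuousLinearMap.id ℝ W).det = 1 := by simp [ContinuousLinearMap.det]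
  -- Maps sufficiently close to the identity in the Lipschitz sense distort Lebesgue measure by a
  -- factor of at most 2 either way.
  have hA1 := addHaar_image_le_mul_of_det_lt μ (ContinuousLinearMap.id ℝ W) (m := 2)
    (by rw [hdet]; norm_num)
  have hA2 := mul_le_addHaar_image_of_lt_det μ (ContinuousLinearMap.id ℝ W) (m := 2⁻¹)
    (by rw [hdet]; norm_num)
  have hA3 : ∀ᶠ η : ℝ≥0 in 𝓝[>] 0, η ≤ 1 :=
    nhdsWithin_le_nhds (Iic_mem_nhds one_pos)
  have hA4 : ∀ᶠ η : ℝ≥0 in 𝓝[>] 0, 0 < η := self_mem_nhdsWithin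
  obtain ⟨η, ⟨⟨hη1, hη2⟩, hη3⟩, hη4⟩ := (((hA1.and hA2).and hA3).and hA4).exists
  obtain ⟨s, hs, happ⟩ := h.strict.approximates_deriv_on_nhds (c := η) (Or.inr hη4)
  obtain ⟨r, hr, hrs⟩ := Metric.mem_nhds_iff.1 (inter_mem hs h.mul)
  let r₀ := min r R
  have hr₀ : 0 < r₀ := lt_min hr h.radius_pos
  set ρ := r₀ / 16 with hρ
  have hρ0 : 0 < ρ := by positivity
  have hρR : 16 * ρ ≤ R := by rw [hρ]; linarith [min_le_right r R]
  have hmem : ∀ x u : W, ‖x‖ < 16 * ρ → ‖u‖ < 16 * ρ → (x, u) ∈ s ∧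
      e (m (x, u)) = e x * e u := by
    intro x u hx hu
    refine hrs ?_
    rw [mem_ball_zero_iff, Prod.norm_def, max_lt_iff]
    have : 16 * ρ ≤ r := by rw [hρ]; linarith [min_le_left r R]
    exact ⟨hx.trans_le this, hu.trans_le this⟩
  have happ1 : ∀ u : W, ‖u‖ < 16 * ρ → ApproximatesLinearOn (fun x => m (x, u))
      (ContinuousLinearMap.id ℝ W) (Metric.ball 0 (16 * ρ)) η := by
    intro u hu x hx y hy
    rw [mem_ball_zero_iff] at hx hy
    have := happ _ (hmem x u hx hu).1 _ (hmem y u hy hu).1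
    simpa using this
  have hnorm : ∀ x u : W, ‖x‖ < 16 * ρ → ‖u‖ < 16 * ρ → ‖m (x, u)‖ ≤ 2 * (‖x‖ + ‖u‖) := by
    intro x u hx hu
    have h16 : (0 : ℝ) < 16 * ρ := by positivity
    have h1 := happ _ (hmem x u hx hu).1 _ (hmem 0 0 (by simpa using hρ0) (by simpa using hρ0)).1
    rw [show ((0 : W), (0 : W)) = 0 from rfl, h.zero, sub_zero, sub_zero] at h1
    have h2 : ‖(x, u)‖ ≤ ‖x‖ + ‖u‖ := by
      rw [Prod.norm_def]
      exact max_le (le_add_of_nonneg_right (norm_nonneg _)) (le_add_of_nonneg_left (norm_nonneg _))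
    have h3 : (η : ℝ) * ‖(x, u)‖ ≤ 1 * (‖x‖ + ‖u‖) :=
      mul_le_mul (by exact_mod_cast hη3) h2 (norm_nonneg _) zero_le_one
    calc ‖m (x, u)‖ = ‖(m (x, u) - (x + u)) + (x + u)‖ := by congr 1; abel
      _ ≤ ‖m (x, u) - (x + u)‖ + ‖x + u‖ := norm_add_le _ _
      _ ≤ 1 * (‖x‖ + ‖u‖) + (‖x‖ + ‖u‖) := add_le_add (h1.trans h3) (norm_add_le _ _)
      _ = _ := by ring
  -- With ‖m(x, u)‖ ≤ 2(‖x‖ + ‖u‖) the radii close up: 2(ρ + 4ρ) < 16ρ keeps products in the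
  -- injectivity ball, 2(ρ + ρ/8) ≤ 4ρ puts quotients in N, and 2(ρ/8 + ρ/4) < ρ puts them in P.
  set δ := ρ / 8 with hδ
  let P : Set W := Metric.ball 0 ρ
  let N : Set K := e '' Metric.closedBall 0 (4 * ρ)
  let N' : Set K := e '' Metric.ball 0 (ρ / 4)
  have : ProperSpace W := FiniteDimensional.proper ℝ W
  have hNc : IsCompact N := (isCompact_closedBall _ _).image h.continuous
  have hN : ν N < ⊤ := hNc.measure_lt_top
  have hNm : MeasurableSet N := hNc.measurableSet
  have hN'o : IsOpen N' :=
    h.isOpen_image _ (Metric.ball_subset_ball (by linarith)) Metric.isOpen_ball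
  have hN' : ν N' ≠ 0 :=
    (hN'o.measure_pos ν ⟨_, mem_image_of_mem e (Metric.mem_ball_self (by positivity))⟩).ne'
  have hP0 : μ P ≠ 0 := (Metric.measure_ball_pos μ 0 hρ0).ne'
  have hPt : μ P ≠ ⊤ := measure_ball_lt_top.ne
  refine ⟨(μ P)⁻¹ * (2⁻¹ * ν N'), (μ P)⁻¹ * (2 * ν N), by simp [hPt, hN'], ?_, δ, by positivity,
    fun B hBo hB => ?_⟩
  · exact ENNReal.mul_ne_top (by simp [hP0]) (ENNReal.mul_ne_top (by simp) hN.ne)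
  have hBn : ∀ b ∈ B, ‖b‖ < δ := fun b hb => by simpa using hB hb
  set S := e '' B
  have hSo : IsOpen S := h.isOpen_image _ (hB.trans (Metric.ball_subset_ball (by linarith))) hBo
  let A : K → Set W := fun y => {x | x ∈ P ∧ e x * y ∈ S}
  -- Tonelli for {(x, y) : x ∈ P, e x * y ∈ S}. Slices at fixed x have Haar measure ν S by left
  -- invariance. Slices at y = e u correspond to parts of B under x ↦ m(x, u), which compares them
  -- with Lebesgue measure.
  have hton : μ P * ν S = ∫⁻ y, μ (A y) ∂ν := by
    let T : Set (W × K) := {p | p.1 ∈ P ∧ e p.1 * p.2 ∈ S}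
    have hTo : IsOpen T := (Metric.isOpen_ball.preimage continuous_fst).inter
      (hSo.preimage ((h.continuous.comp continuous_fst).mul continuous_snd))
    have h1 := Measure.prod_apply (μ := μ) (ν := ν) hTo.measurableSet
    have h2 := Measure.prod_apply_symm (μ := μ) (ν := ν) hTo.measurableSet
    have h3 : ∀ x, ν (Prod.mk x ⁻¹' T) = P.indicator (fun _ => ν S) x := fun x => by
      by_cases hx : x ∈ P
      · rw [indicator_of_mem hx, ← measure_preimage_mul ν (e x) S]
        congr 1; ext y; simp [T, hx]
      · rw [indicator_of_notMem hx]
        convert measure_empty (μ := ν) using 2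
        ext y; simp [T, hx]
    rw [h2] at h1
    simp only [h3] at h1
    rw [lintegral_indicator Metric.isOpen_ball.measurableSet, setLIntegral_const, mul_comm] at h1
    rw [← h1]; rfl
  have hinj : ∀ x u b : W, ‖x‖ < ρ → ‖u‖ ≤ 4 * ρ → b ∈ B → e x * e u = e b → m (x, u) = b := by
    intro x u b hx hu hb heq
    have h1 := hmem x u (by linarith) (by linarith)
    refine h.injOn ?_ ?_ (h1.2.trans heq)
    · rw [mem_ball_zero_iff]
      have := hnorm x u (by linarith) (by linarith)
      linarith
    · rw [mem_ball_zero_iff]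
      have := hBn b hb
      linarith
  have hAsub : ∀ y, A y ⊆ Metric.ball 0 (16 * ρ) := fun y x hx =>
    Metric.ball_subset_ball (by linarith) hx.1
  have hup : μ P * ν S ≤ 2 * ν N * μ B := by
    rw [hton]
    calc ∫⁻ y, μ (A y) ∂ν ≤ ∫⁻ y, N.indicator (fun _ => 2 * μ B) y ∂ν := by
          refine lintegral_mono fun y => ?_
          by_cases hy : y ∈ N
          · rw [indicator_of_mem hy]
            obtain ⟨u, hu, rfl⟩ := hy
            rw [mem_closedBall_zero_iff] at hu
            have h1 := hη2 (A (e u)) (fun x => m (x, u))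
              ((happ1 u (by linarith)).mono_set (hAsub _))
            have h2 : (fun x => m (x, u)) '' A (e u) ⊆ B := by
              rintro _ ⟨x, ⟨hx, b, hb, hbe⟩, rfl⟩
              change m (x, u) ∈ B
              rw [hinj x u b (by simpa [P] using hx) hu hb hbe.symm]
              exact hb
            have h3 := h1.trans (measure_mono h2)
            rw [ENNReal.coe_inv two_ne_zero, ENNReal.coe_ofNat,
              ENNReal.inv_mul_le_iff (by simp) (by simp)] at h3
            exact h3
          · rw [indicator_of_notMem hy, nonpos_iff_eq_zero]
            convert measure_empty (μ := μ) using 2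
            rw [eq_empty_iff_forall_notMem]
            rintro x ⟨hx, b, hb, hbe⟩
            refine hy ⟨m (-x, b), ?_, ?_⟩
            · have hx' : ‖x‖ < ρ := by simpa [P] using hx
              have hb' := hBn b hb
              rw [mem_closedBall_zero_iff]
              have := hnorm (-x) b (by rw [norm_neg]; linarith) (by linarith)
              rw [norm_neg] at this
              linarith
            · have hx' : ‖x‖ < ρ := by simpa [P] using hx
              have hb' := hBn b hb
              rw [(hmem (-x) b (by rw [norm_neg]; linarith) (by linarith)).2, h.neg, hbe]
              simp
      _ = 2 * ν N * μ B := by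
          rw [lintegral_indicator hNm, setLIntegral_const]; ring
  have hlow : 2⁻¹ * ν N' * μ B ≤ μ P * ν S := by
    rw [hton]
    calc 2⁻¹ * ν N' * μ B = ∫⁻ y, N'.indicator (fun _ => 2⁻¹ * μ B) y ∂ν := by
          rw [lintegral_indicator hN'o.measurableSet, setLIntegral_const]; ring
      _ ≤ _ := by
          refine lintegral_mono fun y => ?_
          by_cases hy : y ∈ N'
          · rw [indicator_of_mem hy]
            obtain ⟨u, hu, rfl⟩ := hy
            rw [mem_ball_zero_iff] at hu
            have h1 := hη1 (A (e u)) (fun x => m (x, u))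
              ((happ1 u (by linarith)).mono_set (hAsub _))
            have h2 : B ⊆ (fun x => m (x, u)) '' A (e u) := by
              intro b hb
              have hb' := hBn b hb
              have hx := hnorm b (-u) (by linarith) (by rw [norm_neg]; linarith)
              rw [norm_neg] at hx
              have hxρ : ‖m (b, -u)‖ < ρ := by linarith
              have hxe : e (m (b, -u)) * e u = e b := by
                rw [(hmem b (-u) (by linarith) (by rw [norm_neg]; linarith)).2, h.neg]
                simp
              exact ⟨m (b, -u), ⟨by simpa [P] using hxρ, b, hb, hxe.symm⟩,
                hinj _ u b hxρ (by linarith) hb hxe⟩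
            rw [ENNReal.inv_mul_le_iff (by simp) (by simp)]
            exact (measure_mono h2).trans h1
          · rw [indicator_of_notMem hy]; exact zero_le
  constructor
  · rw [mul_assoc, ENNReal.inv_mul_le_iff hP0 hPt]; exact hlow
  · rw [mul_assoc, ← ENNReal.mul_le_iff_le_inv hP0 hPt]; exact hup

/-- The modular character of a group with exponential coordinates is the absolute value of the
determinant of the adjoint representation. -/
theorem IsExpCoordinate.modularCharacterFun_eq {e : W → K} {m : W × W → W} {R : ℝ}
    (h : IsExpCoordinate e m R) (L : K → W →L[ℝ] W) (hL1 : L 1 = ContinuousLinearMap.id ℝ W)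
    (hLmul : ∀ k l, L (k * l) = (L k).comp (L l)) (hLe : ∀ k x, e (L k x) = k * e x * k⁻¹) (k : K) :
    (Measure.modularCharacterFun k : ℝ) = |(L k).det| := by
  let μ : Measure W := Measure.addHaar
  let ν : Measure K := Measure.haar
  obtain ⟨a, b, ha, hb, δ, hδ, hab⟩ := h.haar_comparable μ ν
  have hone : |(L 1).det| = 1 := by rw [hL1]; simp [ContinuousLinearMap.det]
  have hmul : ∀ k l, |(L (k * l)).det| = |(L k).det| * |(L l).det| := fun k l => by
    rw [hLmul, ← abs_mul]
    congr 1
    exact LinearMap.det_comp _ _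
  have hinv : ∀ k, (L k).comp (L k⁻¹) = ContinuousLinearMap.id ℝ W := fun k => by
    rw [← hLmul, mul_inv_cancel, hL1]
  -- Conjugating e(B) by k scales Haar measure by the modular character, while L k scales the
  -- Lebesgue measure of B by |det|; comparability links the two.
  have key : ∀ k, a * ENNReal.ofReal |(L k).det| ≤ b * Measure.modularCharacterFun k := by
    intro k
    obtain ⟨r, hr, ⟨hrδ, hrR⟩, hrL⟩ : ∃ r > 0, (r ≤ δ ∧ r ≤ R) ∧ ∀ x, ‖x‖ < r → ‖L k x‖ < δ := by
      have h1 := (L k).continuous.tendsto' 0 0 (map_zero _)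
      obtain ⟨r, hr, h2⟩ := Metric.eventually_nhds_iff_ball.1
        (h1.eventually (Metric.ball_mem_nhds 0 hδ))
      exact ⟨min r (min δ R), lt_min hr (lt_min hδ h.radius_pos),
        ⟨(min_le_right _ _).trans (min_le_left _ _), (min_le_right _ _).trans (min_le_right _ _)⟩,
        fun x hx => by simpa using h2 x (by simpa using hx.trans_le (min_le_left _ _))⟩
    set B := Metric.ball (0 : W) r
    have hLBo : IsOpen (L k '' B) := by
      have : L k '' B = (L k⁻¹) ⁻¹' B := by
        refine Set.image_eq_preimage_of_inverse (fun x => ?_) (fun x => ?_) |> fun h => h ▸ rfl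
        · have := hinv k⁻¹
          rw [inv_inv] at this
          exact congrArg (fun f : W →L[ℝ] W => f x) this
        · exact congrArg (fun f : W →L[ℝ] W => f x) (hinv k)
      rw [this]
      exact Metric.isOpen_ball.preimage (L k⁻¹).continuous
    have hLBs : L k '' B ⊆ Metric.ball 0 δ := by
      rintro _ ⟨x, hx, rfl⟩
      rw [mem_ball_zero_iff]
      exact hrL x (by simpa [B] using hx)
    have h1 := (hab _ hLBo hLBs).1
    have h2 := (hab B Metric.isOpen_ball (Metric.ball_subset_ball hrδ)).2
    have h3 : ν (e '' (L k '' B)) = Measure.modularCharacterFun k * ν (e '' B) := by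
      have e1 : e '' (L k '' B) = (fun x => k⁻¹ * x) ⁻¹' ((fun x => x * k) ⁻¹' (e '' B)) := by
        ext y
        simp only [mem_image, mem_preimage, exists_exists_and_eq_and]
        constructor
        · rintro ⟨x, hx, rfl⟩
          exact ⟨x, hx, by rw [hLe]; group⟩
        · rintro ⟨x, hx, hxy⟩
          exact ⟨x, hx, by rw [hLe, hxy]; group⟩
      have hBo : IsOpen (e '' B) :=
        h.isOpen_image _ (Metric.ball_subset_ball hrR) Metric.isOpen_ball
      rw [e1, measure_preimage_mul]
      have h4 := Measure.map_right_mul_eq_modularCharacterFun_smul ν k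
      have h5 := congrArg (fun m : Measure K => m (e '' B)) h4
      rw [Measure.map_apply (measurable_mul_const k) hBo.measurableSet] at h5
      rw [h5]; rfl
    have hμ : μ (L k '' B) = ENNReal.ofReal |(L k).det| * μ B :=
      Measure.addHaar_image_continuousLinearMap μ (L k) B
    rw [h3, hμ] at h1
    have h6 : a * ENNReal.ofReal |(L k).det| * μ B ≤ b * Measure.modularCharacterFun k * μ B := by
      calc a * ENNReal.ofReal |(L k).det| * μ B
          = a * (ENNReal.ofReal |(L k).det| * μ B) := by ring
        _ ≤ Measure.modularCharacterFun k * ν (e '' B) := h1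
        _ ≤ Measure.modularCharacterFun k * (b * μ B) := by gcongr
        _ = _ := by ring
    exact (ENNReal.mul_le_mul_iff_left (Metric.measure_ball_pos μ 0 hr).ne'
      measure_ball_lt_top.ne).1 h6
  set D : K → ℝ := fun k => |(L k).det| with hD
  set Δ : K → ℝ := fun k => (Measure.modularCharacterFun k : ℝ) with hΔ
  have hΔ0 : ∀ k, 0 < Δ k := fun k => NNReal.coe_pos.2 (Measure.modularCharacterFun_pos k)
  have hΔmul : ∀ k l, Δ (k * l) = Δ k * Δ l := fun k l => by
    simp only [hΔ, Measure.modularCharacterFun_map_mul, NNReal.coe_mul]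
  have hΔ1 : Δ 1 = 1 := by simp only [hΔ, Measure.modularCharacterFun_map_one, NNReal.coe_one]
  have hD0 : ∀ k, 0 ≤ D k := fun k => abs_nonneg _
  -- The minimum with 1 guards against a = ⊤, whose `toReal` would be 0.
  obtain ⟨c, hc, hcD⟩ : ∃ c > 0, ∀ k, c * D k ≤ b.toReal * Δ k := by
    have ha' : min a 1 ≠ ⊤ := ne_top_of_le_ne_top ENNReal.one_ne_top (min_le_right _ _)
    refine ⟨(min a 1).toReal, ENNReal.toReal_pos (by simp [ha]) ha', fun k => ?_⟩
    have h1 : min a 1 * ENNReal.ofReal (D k) ≤ b * Measure.modularCharacterFun k :=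
      (by gcongr; exact min_le_left _ _ :
        min a 1 * ENNReal.ofReal (D k) ≤ a * ENNReal.ofReal (D k)).trans (key k)
    have h2 := ENNReal.toReal_mono (ENNReal.mul_ne_top hb ENNReal.coe_ne_top) h1
    rwa [ENNReal.toReal_mul, ENNReal.toReal_mul, ENNReal.toReal_ofReal (hD0 k),
      ENNReal.coe_toReal] at h2
  -- Both sides are multiplicative, so applying the comparison to kⁿ and letting n grow removes the
  -- constants. The reverse inequality follows by passing to k⁻¹.
  have hle : ∀ k, D k ≤ Δ k := by
    intro k
    by_contra hlt
    rw [not_le] at hlt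
    have hpow : ∀ n : ℕ, D (k ^ n) = D k ^ n ∧ Δ (k ^ n) = Δ k ^ n := fun n => by
      induction n with
      | zero => simp [hΔ1, hD, hone]
      | succ n ih => rw [pow_succ, pow_succ, pow_succ, hΔmul, ih.2, ← ih.1]; exact ⟨hmul _ _, rfl⟩
    have h1 : 1 < D k / Δ k := (one_lt_div (hΔ0 k)).2 hlt
    obtain ⟨n, hn⟩ := pow_unbounded_of_one_lt (b.toReal / c) h1
    have h2 := hcD (k ^ n)
    rw [(hpow n).1, (hpow n).2] at h2
    rw [div_pow, div_lt_div_iff₀ hc (pow_pos (hΔ0 k) n)] at hn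
    linarith
  refine le_antisymm ?_ (hle k)
  have h1 := hle k⁻¹
  have h2 : D k⁻¹ * D k = 1 := by
    rw [hD]; simp only; rw [← hmul, inv_mul_cancel, hone]
  have h3 : Δ k⁻¹ * Δ k = 1 := by rw [← hΔmul, inv_mul_cancel, hΔ1]
  have h4 : D k⁻¹ * Δ k ≤ 1 := h3 ▸ mul_le_mul_of_nonneg_right h1 (hΔ0 k).le
  have h5 : 0 < D k := lt_of_le_of_ne (hD0 k) (fun h => by rw [← h, mul_zero] at h2; norm_num at h2)
  have h6 : 0 < D k⁻¹ := by
    by_contra h; rw [not_lt] at h; nlinarith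
  change Δ k ≤ D k
  nlinarith

end ModularCharacter

/-! ### Modular characters of G and H, and the isotropy determinant -/

section LieModular

variable {E : Type*} [NormedAddCommGroup E] [InnerProductSpace ℝ E] [FiniteDimensional ℝ E]
  {G : Type*} [TopologicalSpace G] [ChartedSpace E G] [Group G] [LieGroup 𝓘(ℝ, E) ∞ G] [T2Space G]

variable (E G) in
theorem exists_isExpCoordinate_lieExp : ∃ R, IsExpCoordinate (lieExp : E → G) (logMul G) R := by
  obtain ⟨R, hR, hRs⟩ := Metric.isOpen_iff.1 (expChart E G).open_source 0 (zero_mem_expChart E G)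
  have heq : EqOn (expChart E G) lieExp (Metric.ball 0 R) := fun x hx => expChart_apply (hRs hx)
  refine ⟨R, continuous_lieExp E G, lieExp_neg, hR, ?_, fun B hB hBo => ?_, ?_, logMul_zero E G,
    hasStrictFDerivAt_logMul E G⟩
  · exact ((expChart E G).injOn.mono hRs).congr heq
  · rw [← (heq.mono hB).image_eq]
    exact (expChart E G).isOpen_image_of_subset_source hBo (hB.trans hRs)
  · exact (eventually_logMul E G).mono fun p hp => hp.2.2

/-- By `eventually_mem_lieAlg` the logarithm of a product of small elements of exp 𝔨 lies in 𝔨. The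
orthogonal projection therefore does not alter it near 0; it only makes the multiplication map
𝔨-valued everywhere. -/
theorem exists_isExpCoordinate_subExp {K : Subgroup G} (hK : IsClosed (K : Set G)) :
    ∃ m R, IsExpCoordinate (subExp K : lieAlg E K → K) m R := by
  obtain ⟨R₁, h₁⟩ := exists_isExpCoordinate_lieExp E G
  obtain ⟨R₂, hR₂, h₂⟩ := Metric.eventually_nhds_iff_ball.1 (eventually_mem_lieAlg (E := E) hK)
  let k := lieAlg E K
  have hcoe : ∀ Y : k, (subExp K Y : G) = lieExp (Y : E) := subExp_coe hK
  let ι : k × k →L[ℝ] E × E := k.subtypeL.prodMap k.subtypeL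
  let P : E →L[ℝ] k := k.orthogonalProjectionOnto
  have hι : Tendsto ι (𝓝 0) (𝓝 0) := ι.continuous.tendsto' _ _ (map_zero _)
  have hstrict : HasStrictFDerivAt (fun p => P (logMul G (ι p)))
      (ContinuousLinearMap.fst ℝ k k + ContinuousLinearMap.snd ℝ k k) 0 := by
    have h3 : HasStrictFDerivAt (logMul G)
        (ContinuousLinearMap.fst ℝ E E + ContinuousLinearMap.snd ℝ E E) (ι 0) := by
      rw [map_zero]; exact hasStrictFDerivAt_logMul E G
    have h4 := P.hasStrictFDerivAt.comp (0 : k × k)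
      (HasStrictFDerivAt.comp (0 : k × k) h3 ι.hasStrictFDerivAt)
    refine h4.congr_fderiv ?_
    ext x
    · simp [ι, P]
    · simp [ι, P]
  refine ⟨fun p => P (logMul G (ι p)), min R₁ R₂, ?_, fun x => ?_, lt_min h₁.radius_pos hR₂,
    fun x hx y hy hxy => ?_, fun B hB hBo => ?_, ?_, ?_, hstrict⟩
  · rw [continuous_induced_rng]
    exact ((continuous_lieExp E G).comp continuous_subtype_val).congr fun Y => (hcoe Y).symm
  · ext
    rw [hcoe, Subgroup.coe_inv, hcoe, Submodule.coe_neg, lieExp_neg]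
  · rw [mem_ball_zero_iff, lt_min_iff] at hx hy
    have := h₁.injOn (mem_ball_zero_iff.2 hx.1) (mem_ball_zero_iff.2 hy.1)
      ((hcoe x).symm.trans ((congrArg Subtype.val hxy).trans (hcoe y)))
    exact Subtype.ext this
  · obtain ⟨B', hB'o, hB'⟩ := isOpen_induced_iff.1 hBo
    let C := B' ∩ Metric.ball 0 (min R₁ R₂)
    have hC : C ⊆ Metric.ball 0 R₁ := inter_subset_right.trans
      (Metric.ball_subset_ball (min_le_left _ _))
    have h3 := h₁.isOpen_image C hC (hB'o.inter Metric.isOpen_ball)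
    have h4 : subExp K '' B = Subtype.val ⁻¹' (lieExp '' C) := by
      ext x
      constructor
      · rintro ⟨Y, hY, rfl⟩
        refine ⟨Y, ⟨?_, ?_⟩, (hcoe Y).symm⟩
        · rw [← hB'] at hY; exact hY
        · have := hB hY
          rw [mem_ball_zero_iff] at this ⊢
          exact this
      · rintro ⟨Y, ⟨hY1, hY2⟩, hYx⟩
        have hmem : Y ∈ k := h₂ Y (Metric.ball_subset_ball (min_le_right _ _) hY2) (by
          rw [hYx]; exact x.2)
        refine ⟨⟨Y, hmem⟩, ?_, Subtype.ext ((hcoe _).trans hYx)⟩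
        rw [← hB']; exact hY1
    rw [h4]
    exact h3.preimage continuous_subtype_val
  · have h5 : ∀ᶠ q : E × E in 𝓝 0, logMul G q ∈ Metric.ball (0 : E) R₂ := by
      have := (eventually_logMul E G).self_of_nhds.1.continuousAt.eventually
        (Metric.isOpen_ball.mem_nhds (show logMul G (0 : E × E) ∈ Metric.ball (0 : E) R₂ by
          rw [logMul_zero]; exact Metric.mem_ball_self hR₂))
      exact this
    filter_upwards [hι.eventually (eventually_logMul E G), hι.eventually h5] with p hp hp5
    have h6 : (lieExp (logMul G (ι p)) : G) = lieExp (p.1 : E) * lieExp (p.2 : E) := hp.2.2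
    have hmem : logMul G (ι p) ∈ k := h₂ _ hp5 (by
      rw [h6, ← hcoe, ← hcoe]; exact K.mul_mem (subExp K p.1).2 (subExp K p.2).2)
    ext
    rw [hcoe, Subgroup.coe_mul, hcoe, hcoe, ← h6]
    congr 1
    exact Submodule.starProjection_eq_self_iff.2 hmem
  · simp only [map_zero, logMul_zero]

variable [MeasurableSpace E] [BorelSpace E]

/-- The modular character of a Lie group. -/
theorem modularCharacterFun_lieGroup [IsTopologicalGroup G] [LocallyCompactSpace G]
    [SecondCountableTopology G] (g : G) :
    (Measure.modularCharacterFun g : ℝ) = |(lieAd g : E →L[ℝ] E).det| := by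
  borelize G
  obtain ⟨R, h⟩ := exists_isExpCoordinate_lieExp E G
  exact h.modularCharacterFun_eq lieAd lieAd_one lieAd_mul lieExp_conj g

/-- The adjoint representation of a closed subgroup on its Lie algebra. -/
noncomputable def subAd (K : Subgroup G) (k : K) : lieAlg E K →L[ℝ] lieAlg E K :=
  ((lieAd (k : G)).comp (lieAlg E K).subtypeL).codRestrict _ fun Y => lieAd_mem k Y.2

/-- The modular character of a closed subgroup of a Lie group. -/
theorem modularCharacterFun_subgroup [IsTopologicalGroup G] [LocallyCompactSpace G]
    [SecondCountableTopology G] {K : Subgroup G} (hK : IsClosed (K : Set G))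
    [LocallyCompactSpace K] (k : K) :
    (Measure.modularCharacterFun k : ℝ) = |(subAd K k : lieAlg E K →L[ℝ] lieAlg E K).det| := by
  borelize G
  have : SecondCountableTopology K :=
    TopologicalSpace.Subtype.secondCountableTopology (K : Set G)
  obtain ⟨m, R, h⟩ := exists_isExpCoordinate_subExp (E := E) hK
  refine h.modularCharacterFun_eq (subAd K) ?_ (fun k l => ?_) (fun k Y => ?_) k
  · ext Y
    simp [subAd, lieAd_one]
  · ext Y
    simp [subAd, lieAd_mul]
    rfl
  · ext
    rw [subExp_coe hK, Subgroup.coe_mul, Subgroup.coe_mul, Subgroup.coe_inv, subExp_coe hK,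
      ← lieExp_conj]
    rfl

/-- The determinant of the isotropy representation is the quotient of those of the adjoint
representations. -/
theorem det_lieAd_eq (K : Subgroup G) (k : K) :
    (lieAd (k : G) : E →L[ℝ] E).det = (subAd K k : lieAlg E K →L[ℝ] lieAlg E K).det *
      LinearMap.det (isotropy (E := E) K k : TangentQuot E K →ₗ[ℝ] TangentQuot E K) := by
  have := LinearMap.det_eq_det_mul_det (lieAlg E K) (lieAd (k : G) : E →L[ℝ] E).toLinearMap
    (fun Y hY => lieAd_mem k hY)
  exact this

/-- Ad on 𝔤 is block triangular with blocks on 𝔨 and 𝔤/𝔨, and the modular characters are |det Ad| on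
𝔤 and on 𝔨. The quotient is the factor in Weil's formula, so 1-densities are what can be integrated
over the homogeneous space. -/
theorem abs_det_isotropy [IsTopologicalGroup G] [LocallyCompactSpace G]
    [SecondCountableTopology G] {K : Subgroup G} (hK : IsClosed (K : Set G))
    [LocallyCompactSpace K] (k : K) :
    |LinearMap.det (isotropy (E := E) K k : TangentQuot E K →ₗ[ℝ] TangentQuot E K)| =
      Measure.modularCharacterFun (k : G) / Measure.modularCharacterFun k := by
  rw [eq_div_iff (NNReal.coe_pos.2 (Measure.modularCharacterFun_pos k)).ne',
    modularCharacterFun_lieGroup (E := E) (k : G),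
    modularCharacterFun_subgroup (E := E) hK, det_lieAd_eq,
    abs_mul, mul_comm]

end LieModular

/-! ### Integration of densities over G/H -/

section QuotientIntegral

theorem lintegral_mul_right_eq_modular {G : Type*} [Group G] [TopologicalSpace G]
    [IsTopologicalGroup G] [LocallyCompactSpace G] [SecondCountableTopology G] [T2Space G]
    [MeasurableSpace G] [BorelSpace G] (μ : Measure G) [μ.IsHaarMeasure] (k : G) (f : G → ℝ≥0∞) :
    ∫⁻ g, f (g * k) ∂μ = Measure.modularCharacterFun k * ∫⁻ g, f g ∂μ := by
  have h1 : ∫⁻ g, f (g * k) ∂μ = ∫⁻ g, f g ∂(μ.map (MeasurableEquiv.mulRight k)) :=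
    (lintegral_map_equiv f (MeasurableEquiv.mulRight k)).symm
  have h2 : μ.map (MeasurableEquiv.mulRight k) = Measure.modularCharacterFun k • μ :=
    Measure.map_right_mul_eq_modularCharacterFun_smul μ k
  rw [h1, h2, lintegral_smul_measure]
  rfl

/-- The character at g is the integral of a right translate of a fixed compactly supported f divided
by that of f. For g in a compact neighborhood the translates live on one compact set, so the
integral is continuous in g. -/
theorem continuous_modularCharacterFun {K : Type*} [Group K] [TopologicalSpace K]
    [IsTopologicalGroup K] [LocallyCompactSpace K] [SecondCountableTopology K] [T2Space K] :
    Continuous (Measure.modularCharacterFun : K → ℝ≥0) := by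
  borelize K
  let ν : Measure K := Measure.haar
  obtain ⟨⟨f, f_cont⟩, f_comp, f_nonneg, f_one⟩ :
    ∃ f : C(K, ℝ), HasCompactSupport f ∧ 0 ≤ f ∧ f 1 ≠ 0 := exists_continuous_nonneg_pos 1
  have hpos : 0 < ∫ x, f x ∂ν :=
    f_cont.integral_pos_of_hasCompactSupport_nonneg_nonzero f_comp f_nonneg f_one
  have heq : ∀ g : K, (Measure.modularCharacterFun g : ℝ) =
      (∫ x, f (x * g) ∂ν) / ∫ x, f x ∂ν := fun g => by
    rw [eq_div_iff hpos.ne', ← smul_eq_mul, ← NNReal.smul_def, ← integral_smul_nnreal_measure,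
      ← Measure.map_right_mul_eq_modularCharacterFun_smul ν g,
      integral_map (measurable_mul_const g).aemeasurable f_cont.aestronglyMeasurable]
  rw [NNReal.isEmbedding_coe.continuous_iff]
  refine Continuous.congr (f := fun g : K => (∫ x, f (x * g) ∂ν) / ∫ x, f x ∂ν) ?_
    (fun g => (heq g).symm)
  refine Continuous.div_const ?_ _
  rw [continuous_iff_continuousAt]
  intro g₀
  obtain ⟨C, hC, hCg⟩ := exists_compact_mem_nhds g₀
  let S : Set K := tsupport f * C⁻¹
  have hS : IsCompact S := f_comp.isCompact.mul hC.inv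
  have hcont : Continuous fun g : K => ∫ x in S, f (x * g) ∂ν :=
    continuous_parametric_integral_of_continuous
      (f := fun g x => f (x * g)) (f_cont.comp (continuous_snd.mul continuous_fst)) hS
  refine hcont.continuousAt.congr ?_
  filter_upwards [hCg] with g hg
  refine setIntegral_eq_integral_of_forall_compl_eq_zero fun x hx => ?_
  by_contra hne
  exact hx ⟨x * g, subset_tsupport f hne, g⁻¹, by simpa using hg, by simp⟩

/-- Integration of `f (h⁻¹)` against a left Haar measure weighted with the modular character is
again a left Haar integral. -/
theorem exists_lintegral_inv_modular {K : Type*} [Group K] [TopologicalSpace K]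
    [IsTopologicalGroup K] [LocallyCompactSpace K] [SecondCountableTopology K] [T2Space K]
    [MeasurableSpace K] [BorelSpace K] (ν : Measure K) [ν.IsHaarMeasure] :
    ∃ c : ℝ≥0, ∀ f : K → ℝ≥0∞, Measurable f →
      ∫⁻ h, Measure.modularCharacterFun h * f h⁻¹ ∂ν = c * ∫⁻ h, f h ∂ν := by
  have hΔc : Continuous (Measure.modularCharacterFun : K → ℝ≥0) :=
    continuous_modularCharacterFun
  have hΔ : Measurable fun h : K => (Measure.modularCharacterFun h : ℝ≥0∞) :=
    hΔc.measurable.coe_nnreal_ennreal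
  -- The weight compensates the failure of right invariance of ν, so its image under inversion is
  -- left invariant and finite on compacts, hence a multiple of ν.
  let ν' : Measure K := (ν.withDensity fun h => (Measure.modularCharacterFun h : ℝ≥0∞)).map Inv.inv
  have hν' : ∀ f : K → ℝ≥0∞, Measurable f →
      ∫⁻ h, f h ∂ν' = ∫⁻ h, Measure.modularCharacterFun h * f h⁻¹ ∂ν := fun f hf => by
    rw [lintegral_map hf measurable_inv,
      lintegral_withDensity_eq_lintegral_mul (f := fun h : K => (Measure.modularCharacterFun h : ℝ≥0∞))
        (g := fun h => f h⁻¹) _ hΔ (hf.comp measurable_inv)]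
    rfl
  have hinv : ν'.IsMulLeftInvariant := by
    refine ⟨fun k => Measure.ext fun s hs => ?_⟩
    have hm : Measurable (s.indicator (1 : K → ℝ≥0∞)) := measurable_one.indicator hs
    rw [← lintegral_indicator_one hs, ← lintegral_indicator_one hs,
      lintegral_map hm (measurable_const_mul k),
      hν' (fun x => s.indicator 1 (k * x)) (hm.comp (measurable_const_mul k)), hν' _ hm]
    set f := s.indicator (1 : K → ℝ≥0∞)
    have h1 := lintegral_mul_right_eq_modular ν k⁻¹
      (fun h => Measure.modularCharacterFun (h * k) * f h⁻¹)
    simp only [mul_inv_rev, inv_inv, inv_mul_cancel_right] at h1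
    rw [h1]
    have h2 : ∀ h : K, ((Measure.modularCharacterFun (h * k) : ℝ≥0) : ℝ≥0∞) * f h⁻¹ =
        Measure.modularCharacterFun k * (Measure.modularCharacterFun h * f h⁻¹) := fun h => by
      rw [Measure.modularCharacterFun_map_mul, ENNReal.coe_mul]; ring
    simp only [h2]
    rw [lintegral_const_mul' _ _ ENNReal.coe_ne_top, ← mul_assoc, ← ENNReal.coe_mul,
      ← Measure.modularCharacterFun_map_mul, inv_mul_cancel, Measure.modularCharacterFun_map_one,
      ENNReal.coe_one, one_mul]
  have hfin : IsFiniteMeasureOnCompacts ν' := by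
    refine ⟨fun C hC => ?_⟩
    rw [Measure.map_apply measurable_inv hC.measurableSet, withDensity_apply _
      (measurable_inv hC.measurableSet)]
    have hC' : IsCompact (Inv.inv ⁻¹' C : Set K) := by
      rw [Set.inv_preimage]; exact hC.inv
    obtain ⟨M, hM⟩ := hC'.exists_bound_of_continuousOn
      (f := fun h => (Measure.modularCharacterFun h : ℝ))
      (NNReal.continuous_coe.comp hΔc).continuousOn
    calc ∫⁻ h in Inv.inv ⁻¹' C, (Measure.modularCharacterFun h : ℝ≥0∞) ∂ν
        ≤ ∫⁻ _ in Inv.inv ⁻¹' C, ENNReal.ofReal M ∂ν := by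
          refine setLIntegral_mono' hC'.measurableSet fun h hh => ?_
          have := hM h hh
          rw [Real.norm_of_nonneg (NNReal.coe_nonneg _)] at this
          rw [← ENNReal.ofReal_coe_nnreal]
          exact ENNReal.ofReal_le_ofReal this
      _ = ENNReal.ofReal M * ν (Inv.inv ⁻¹' C) := setLIntegral_const _ _
      _ < ⊤ := ENNReal.mul_lt_top ENNReal.ofReal_lt_top hC'.measure_lt_top
  refine ⟨Measure.haarScalarFactor ν' ν, fun f hf => ?_⟩
  have h1 := congrArg (fun m : Measure K => ∫⁻ h, f h ∂m) (Measure.isMulLeftInvariant_eq_smul ν' ν)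
  simp only [lintegral_smul_measure] at h1
  rw [← hν' f hf]
  exact h1

variable {G : Type*} [Group G] [TopologicalSpace G] [IsTopologicalGroup G]
  [LocallyCompactSpace G] [SecondCountableTopology G] [T2Space G] [MeasurableSpace G] [BorelSpace G]

/-- The integral over `G/H` of a nonnegative density, as a function on `G`, does not depend on the
cut-off function, up to a constant. -/
theorem exists_lintegral_cutoff_eq {H : Subgroup G}
    [LocallyCompactSpace H] (μ : Measure G) [μ.IsHaarMeasure] (ν : Measure H) [ν.IsHaarMeasure] :
    ∃ c : ℝ≥0, ∀ (ρ : G → ℝ≥0∞) (χ χ' : G → ℝ≥0∞), AEMeasurable ρ μ → Measurable χ →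
      Measurable χ' → (∀ (g : G) (h : H), ρ (g * h) =
        (Measure.modularCharacterFun (h : G) / Measure.modularCharacterFun h : ℝ≥0) * ρ g) →
      (∀ g, ∫⁻ h : H, χ (g * h) ∂ν = 1) → (∀ g, ∫⁻ h : H, χ' (g * h) ∂ν = 1) →
      ∫⁻ g, ρ g * χ' g ∂μ = c * ∫⁻ g, ρ g * χ g ∂μ := by
  have : SecondCountableTopology H := TopologicalSpace.Subtype.secondCountableTopology (H : Set G)
  obtain ⟨c, hc⟩ := exists_lintegral_inv_modular ν
  refine ⟨c, fun ρ χ χ' hρ hχ hχ' hequiv h1 h1' => ?_⟩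
  have hmul : Measurable fun p : G × H => p.1 * (p.2 : G) :=
    measurable_fst.mul (measurable_subtype_coe.comp measurable_snd)
  have hmul' : Measurable fun p : G × H => p.1 * ((p.2⁻¹ : H) : G) :=
    measurable_fst.mul (measurable_subtype_coe.comp (measurable_inv.comp measurable_snd))
  have hρ1 : AEMeasurable (fun p : G × H => ρ p.1) (μ.prod ν) := hρ.comp_fst
  have hΔ : Measurable fun h : H => (Measure.modularCharacterFun h : ℝ≥0∞) :=
    (continuous_modularCharacterFun (K := H)).measurable.coe_nnreal_ennreal
  -- Insert 1 = ∫ χ(gh) dh, exchange, and replace g by gh⁻¹. The factor Δ_G(h) from the substitution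
  -- and Δ_G/Δ_H from ρ leave Δ_H(h), which turns ∫ χ'(gh⁻¹) dh into the constant c.
  calc ∫⁻ g, ρ g * χ' g ∂μ = ∫⁻ g, ∫⁻ h : H, ρ g * χ' g * χ (g * h) ∂ν ∂μ := by
        refine lintegral_congr fun g => ?_
        have hm : Measurable fun h : H => χ (g * h) :=
          hχ.comp (measurable_const_mul g |>.comp measurable_subtype_coe)
        rw [lintegral_const_mul _ hm, h1, mul_one]
    _ = ∫⁻ h : H, ∫⁻ g, ρ g * χ' g * χ (g * h) ∂μ ∂ν := by
        refine lintegral_lintegral_swap ?_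
        exact (hρ1.mul (hχ'.comp measurable_fst).aemeasurable).mul (hχ.comp hmul).aemeasurable
    _ = ∫⁻ h : H, ∫⁻ g, ρ g * χ g * (Measure.modularCharacterFun h * χ' (g * (h⁻¹ : H))) ∂μ ∂ν := by
        refine lintegral_congr fun h => ?_
        have h2 := lintegral_mul_right_eq_modular μ (h : G)
          (fun g => ρ (g * ((h⁻¹ : H) : G)) * χ' (g * ((h⁻¹ : H) : G)) * χ g)
        simp only [Subgroup.coe_inv, mul_inv_cancel_right] at h2
        rw [h2, ← lintegral_const_mul' _ _ ENNReal.coe_ne_top]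
        refine lintegral_congr fun g => ?_
        have h3 := hequiv (g * ((h⁻¹ : H) : G)) h
        rw [Subgroup.coe_inv, inv_mul_cancel_right] at h3
        rw [h3, Subgroup.coe_inv]
        have hH0 : Measure.modularCharacterFun h ≠ 0 := (Measure.modularCharacterFun_pos h).ne'
        have h4 : ((Measure.modularCharacterFun (h : G) : ℝ≥0) : ℝ≥0∞) =
            (Measure.modularCharacterFun (h : G) / Measure.modularCharacterFun h : ℝ≥0) *
              (Measure.modularCharacterFun h : ℝ≥0) := by
          rw [← ENNReal.coe_mul, div_mul_cancel₀ _ hH0]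
        rw [h4]
        ring
    _ = ∫⁻ g, ∫⁻ h : H, ρ g * χ g * (Measure.modularCharacterFun h * χ' (g * (h⁻¹ : H))) ∂ν ∂μ := by
        refine (lintegral_lintegral_swap ?_).symm
        exact (hρ1.mul (hχ.comp measurable_fst).aemeasurable).mul
          ((hΔ.comp measurable_snd).mul (hχ'.comp hmul')).aemeasurable
    _ = ∫⁻ g, c * (ρ g * χ g) ∂μ := by
        refine lintegral_congr fun g => ?_
        have hm : Measurable fun h : H => χ' (g * h) :=
          hχ'.comp (measurable_const_mul g |>.comp measurable_subtype_coe)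
        have hm' : Measurable fun h : H =>
            (Measure.modularCharacterFun h : ℝ≥0∞) * χ' (g * (h⁻¹ : H)) :=
          hΔ.mul (hm.comp measurable_inv)
        rw [lintegral_const_mul _ hm', hc _ hm, h1', mul_one, mul_comm]
    _ = _ := lintegral_const_mul' _ _ ENNReal.coe_ne_top

end QuotientIntegral

/-! ### Norms of sections and boundedness of left translations -/

section SectionNorm

variable {α : ℝ} {W : Type*} [AddCommGroup W] [Module ℝ W] {V : Type*} [AddCommGroup V] [Module ℂ V]

theorem Density.map_coeff (A : W ≃ₗ[ℝ] W) (z : Density α W V) (b : Frame W) :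
    (z.map A).coeff b = ((|LinearMap.det (A.symm : W →ₗ[ℝ] W)| ^ α : ℝ) : ℂ) • z.coeff b := by
  change z.coeff (b.map A.symm) = _
  rw [z.coeff_change b (b.map A.symm)]
  have h : ((b.map A.symm : Frame W) : _ → W) = (A.symm : W →ₗ[ℝ] W) ∘ b := by
    ext i; simp
  rw [h, Module.Basis.det_comp, b.det_self, mul_one]

variable {E : Type*} [NormedAddCommGroup E] [InnerProductSpace ℝ E] [FiniteDimensional ℝ E]
  {G : Type*} [TopologicalSpace G] [ChartedSpace E G] [Group G] [LieGroup 𝓘(ℝ, E) ∞ G] [T2Space G]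

theorem isotropy_symm (K : Subgroup G) (k : K) :
    (isotropy (E := E) K k).symm = isotropy (E := E) K k⁻¹ := by
  ext x
  rfl

variable (E) in
/-- The absolute value of the determinant of the isotropy representation. -/
noncomputable def isotropyModulus (K : Subgroup G) (k : K) : ℝ :=
  |LinearMap.det (isotropy (E := E) K k : TangentQuot E K →ₗ[ℝ] TangentQuot E K)|

theorem Density.map_isotropy_coeff (K : Subgroup G) (k : K) (z : Density α (TangentQuot E K) V)
    (b : Frame (TangentQuot E K)) :
    (z.map (isotropy K k)).coeff b = ((isotropyModulus E K k⁻¹ ^ α : ℝ) : ℂ) • z.coeff b := by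
  rw [Density.map_coeff, isotropy_symm]
  rfl

variable {V : Type*} [NormedAddCommGroup V] [InnerProductSpace ℂ V]
  [MeasurableSpace E] [BorelSpace E] [SecondCountableTopology G] [MeasurableSpace G] [BorelSpace G]
  {H : Subgroup G} {hH : IsClosed (H : Set G)} {τ : UnitaryRep H V}
  {F : G → Density (1 / 2) (TangentQuot E H) V}

theorem IsL2Section.coeff_mul (hF : IsL2Section H hH τ F) (g : G) (h : H)
    (b : Frame (TangentQuot E H)) :
    (F (g * h)).coeff b =
      ((isotropyModulus E H h ^ (1 / 2 : ℝ) : ℝ) : ℂ) • τ.hom h⁻¹ ((F g).coeff b) := by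
  rw [hF.1, Density.map_isotropy_coeff, inv_inv, map_smul]

/-- Squaring doubles the exponent 1/2 and unitarity removes τ, so ‖F‖² transforms as a 1-density, as
`exists_lintegral_cutoff_eq` requires. -/
theorem IsL2Section.enorm_sq_mul (hF : IsL2Section H hH τ F) (g : G) (h : H)
    (b : Frame (TangentQuot E H)) :
    ‖(F (g * h)).coeff b‖ₑ ^ 2 = ENNReal.ofReal (isotropyModulus E H h) * ‖(F g).coeff b‖ₑ ^ 2 := by
  have h0 : 0 ≤ isotropyModulus E H h := abs_nonneg _
  rw [hF.coeff_mul, enorm_smul, mul_pow]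
  congr 1
  · rw [← ofReal_norm, ← ENNReal.ofReal_pow (norm_nonneg _), Complex.norm_real,
      Real.norm_of_nonneg (Real.rpow_nonneg h0 _), ← Real.rpow_natCast, ← Real.rpow_mul h0]
    norm_num
  · rw [← ofReal_norm, ← ofReal_norm, (τ.hom h⁻¹).norm_map]

/-- Left translation is bounded on the square integrable sections. -/
theorem exists_lintegral_translate_le (E : Type*) [NormedAddCommGroup E] [InnerProductSpace ℝ E]
    [FiniteDimensional ℝ E] [MeasurableSpace E] [BorelSpace E] {G : Type*} [TopologicalSpace G]
    [ChartedSpace E G] [Group G] [LieGroup 𝓘(ℝ, E) ∞ G] [T2Space G] [SecondCountableTopology G]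
    [MeasurableSpace G] [BorelSpace G] (H : Subgroup G) (hH : IsClosed (H : Set G)) :
    ∃ c : ℝ≥0, ∀ {V : Type*} [NormedAddCommGroup V] [InnerProductSpace ℂ V] (τ : UnitaryRep H V)
      (F : G → Density (1 / 2) (TangentQuot E H) V), IsL2Section H hH τ F →
      ∀ (b : Frame (TangentQuot E H)) (k : G),
        ∫⁻ g, ‖(F (k⁻¹ * g)).coeff b‖ₑ ^ 2 ∂(quotMeasure E H hH) ≤
          c * ∫⁻ g, ‖(F g).coeff b‖ₑ ^ 2 ∂(quotMeasure E H hH) := by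
  have : IsTopologicalGroup G := topologicalGroup_of_lieGroup 𝓘(ℝ, E) ∞
  have : LocallyCompactSpace G := Manifold.locallyCompact_of_finiteDimensional 𝓘(ℝ, E)
  have : LocallyCompactSpace H := hH.isClosedEmbedding_subtypeVal.locallyCompactSpace
  obtain ⟨ν, hν, hχm, hχ⟩ := bruhat_spec H hH
  obtain ⟨c, hc⟩ := exists_lintegral_cutoff_eq (H := H) (Measure.haar : Measure G) ν
  refine ⟨c, fun τ F hF b k => le_of_eq ?_⟩
  have hq : quotMeasure E H hH =
      (Measure.haar : Measure G).withDensity fun g => (bruhat H hH g : ℝ≥0∞) := rfl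
  have hm : Measurable fun g => (bruhat H hH g : ℝ≥0∞) := hχm.coe_nnreal_ennreal
  have hfin : ∀ᵐ g ∂(Measure.haar : Measure G), (bruhat H hH g : ℝ≥0∞) < ⊤ :=
    Eventually.of_forall fun g => ENNReal.coe_lt_top
  set ρ : G → ℝ≥0∞ := fun g => ‖(F g).coeff b‖ₑ ^ 2
  have hρ : AEMeasurable ρ (Measure.haar : Measure G) := ((hF.2 b).1.enorm).pow_const 2
  rw [hq, lintegral_withDensity_eq_lintegral_mul_non_measurable _ hm hfin,
    lintegral_withDensity_eq_lintegral_mul_non_measurable _ hm hfin]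
  -- Left invariance moves the translation from F to χ. The translate χ(k ·) still integrates to 1
  -- over each left coset of H, so it is another admissible cutoff.
  have h1 := lintegral_mul_left_eq_self (μ := (Measure.haar : Measure G))
    (fun g => (bruhat H hH (k * g) : ℝ≥0∞) * ρ g) k⁻¹
  simp only [mul_inv_cancel_left] at h1
  have h2 := hc ρ (fun g => (bruhat H hH g : ℝ≥0∞)) (fun g => (bruhat H hH (k * g) : ℝ≥0∞)) hρ hm
    (hm.comp (measurable_const_mul k)) (fun g h => ?_) hχ (fun g => ?_)
  · simp only [mul_comm (ρ _)] at h2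
    exact h1.trans h2
  · have h3 := hF.enorm_sq_mul g h b
    rw [isotropyModulus, abs_det_isotropy hH h, ← NNReal.coe_div, ENNReal.ofReal_coe_nnreal] at h3
    exact h3
  · simp only [← mul_assoc]
    exact hχ (k * g)

end SectionNorm

/-! ### Nonstationary phase with parameters -/

section NonstationaryPhase

variable {E : Type*} [NormedAddCommGroup E] [InnerProductSpace ℝ E] [FiniteDimensional ℝ E]
  [MeasurableSpace E] [BorelSpace E] {Q : Type*} [NormedAddCommGroup Q] [NormedSpace ℝ Q]

theorem hasCompactSupport_slice {F : Type*} [Zero F] {a : E × Q → F}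
    (ha : HasCompactSupport a) (q : Q) : HasCompactSupport fun W => a (W, q) :=
  HasCompactSupport.intro (ha.isCompact.image continuous_fst) fun W hW =>
    image_eq_zero_of_notMem_tsupport fun h => hW ⟨(W, q), h, rfl⟩

theorem integrable_slice {a : E × Q → ℂ} (hac : Continuous a) (ha : HasCompactSupport a) (q : Q) :
    Integrable fun W => a (W, q) :=
  (hac.comp (Continuous.prodMk_left q)).integrable_of_hasCompactSupport
    (hasCompactSupport_slice ha q)

theorem exists_integral_slice_le {a : E × Q → ℂ} (hac : Continuous a) (ha : HasCompactSupport a) :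
    ∃ C, ∀ q, ∫ W, ‖a (W, q)‖ ≤ C := by
  obtain ⟨M, hM⟩ := hac.bounded_above_of_compact_support ha
  let K : Set E := Prod.fst '' tsupport a
  have hK : IsCompact K := ha.isCompact.image continuous_fst
  refine ⟨∫ W in K, M, fun q => ?_⟩
  rw [← setIntegral_eq_integral_of_forall_compl_eq_zero (s := K)]
  · exact integral_mono_of_nonneg (Eventually.of_forall fun _ => norm_nonneg _)
      (integrableOn_const hK.measure_lt_top.ne) (Eventually.of_forall fun W => hM _)
  · intro W hW
    rw [image_eq_zero_of_notMem_tsupport fun h => hW ⟨(W, q), h, rfl⟩, norm_zero]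

theorem norm_cexp_I_mul_mul (s x : ℝ) : ‖Complex.exp (Complex.I * s * x)‖ = 1 := by
  rw [mul_assoc, ← Complex.ofReal_mul, Complex.norm_exp_I_mul_ofReal]

/-- The principle of nonstationary phase, uniformly in parameters. -/
theorem nonstationary_phase {θ : E × Q → ℝ} (hθ : ContDiff ℝ ∞ θ) (M : ℕ) :
    ∀ {a : E × Q → ℂ}, ContDiff ℝ ∞ a → HasCompactSupport a →
      (∀ p ∈ tsupport a, ∃ v : E, fderiv ℝ θ p (v, 0) ≠ 0) →
      ∃ C, ∀ s : ℝ, 0 < s → ∀ q,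
        ‖∫ W, a (W, q) * Complex.exp (Complex.I * s * θ (W, q))‖ ≤ C * (s ^ M)⁻¹ := by
  induction M with
  | zero =>
    intro a ha hac _
    obtain ⟨C, hC⟩ := exists_integral_slice_le ha.continuous hac
    refine ⟨C, fun s _ q => ?_⟩
    rw [pow_zero, inv_one, mul_one]
    refine (norm_integral_le_integral_norm _).trans (le_of_eq_of_le ?_ (hC q))
    refine integral_congr_ae (Eventually.of_forall fun W => ?_)
    simp only [norm_mul, norm_cexp_I_mul_mul, mul_one]
  | succ M ih =>
    intro a ha hac hne
    let b := stdOrthonormalBasis ℝ E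
    let ι := Fin (Module.finrank ℝ E)
    let d : ι → E × Q → ℝ := fun j p => fderiv ℝ θ p (b j, 0)
    have hd : ∀ j, ContDiff ℝ ∞ (d j) := fun j =>
      (hθ.fderiv_right (m := ∞) (by simp)).clm_apply contDiff_const
    -- N is the squared gradient of the phase in the `E` directions. Integrating by parts along
    -- gradient/N gains one factor s⁻¹. The new amplitudes are supported inside `tsupport a`, so the
    -- nondegeneracy hypothesis persists through the induction.
    let N : E × Q → ℝ := fun p => ∑ j, d j p ^ 2
    have hN : ContDiff ℝ ∞ N := ContDiff.sum fun j _ => (hd j).pow 2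
    have hN0 : ∀ p ∈ tsupport a, N p ≠ 0 := by
      intro p hp h0
      obtain ⟨v, hv⟩ := hne p hp
      refine hv ?_
      have hz : ∀ j, d j p = 0 := fun j => by
        have := (Finset.sum_eq_zero_iff_of_nonneg (fun i _ => sq_nonneg (d i p))).1 h0 j
          (Finset.mem_univ j)
        exact pow_eq_zero_iff two_ne_zero |>.1 this
      have hL : (fderiv ℝ θ p).toLinearMap.comp (LinearMap.inl ℝ E Q) = 0 := by
        refine b.toBasis.ext fun j => ?_
        simpa [d] using hz j
      exact congrArg (fun f : E →ₗ[ℝ] ℝ => f v) hL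
    let c : ι → E × Q → ℂ := fun j p => a p * ((d j p / N p : ℝ) : ℂ)
    have hct : ∀ j, tsupport (c j) ⊆ tsupport a := fun j =>
      closure_mono (Function.support_mul_subset_left _ _)
    have hcs : ∀ j, HasCompactSupport (c j) := fun j => hac.mul_right
    have hc : ∀ j, ContDiff ℝ ∞ (c j) := fun j => by
      rw [contDiff_iff_contDiffAt]
      intro p
      by_cases hp : p ∈ tsupport a
      · exact ha.contDiffAt.mul (Complex.ofRealCLM.contDiff.contDiffAt.comp p
          ((hd j).contDiffAt.div hN.contDiffAt (hN0 p hp)))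
      · refine (contDiffAt_const (c := (0 : ℂ))).congr_of_eventuallyEq ?_
        filter_upwards [(isClosed_tsupport a).isOpen_compl.mem_nhds hp] with x hx
        simp [c, image_eq_zero_of_notMem_tsupport hx]
    let a' : ι → E × Q → ℂ := fun j p => fderiv ℝ (c j) p (b j, 0)
    have ha' : ∀ j, ContDiff ℝ ∞ (a' j) := fun j =>
      ((hc j).fderiv_right (m := ∞) (by simp)).clm_apply contDiff_const
    have hsub : ∀ j, Function.support (a' j) ⊆ tsupport (c j) := fun j p hp => by
      by_contra h
      refine hp ?_
      change fderiv ℝ (c j) p (b j, 0) = 0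
      rw [fderiv_of_notMem_tsupport ℝ h]; rfl
    have ha't : ∀ j, tsupport (a' j) ⊆ tsupport a := fun j =>
      (closure_minimal (hsub j) (isClosed_tsupport _)).trans (hct j)
    have ha's : ∀ j, HasCompactSupport (a' j) := fun j =>
      hac.isCompact.of_isClosed_subset (isClosed_tsupport _) (ha't j)
    choose C hC using fun j => ih (ha' j) (ha's j) fun p hp => hne p (ha't j hp)
    refine ⟨∑ j, C j, fun s hs q => ?_⟩
    let e : E × Q → ℂ := fun p => Complex.exp (Complex.I * s * θ p)
    have he : ContDiff ℝ ∞ e := by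
      have : ContDiff ℝ ∞ fun p => (Complex.I * s) * ((θ p : ℝ) : ℂ) :=
        contDiff_const.mul (Complex.ofRealCLM.contDiff.comp hθ)
      exact this.cexp
    have hed : ∀ j W, fderiv ℝ (fun W => e (W, q)) W (b j) =
        Complex.I * s * d j (W, q) * e (W, q) := fun j W => by
      have h1 : HasFDerivAt (fun W : E => (W, q)) (.inl ℝ E Q) W := hasFDerivAt_prodMk_left W q
      have h2 := ((hθ.differentiable (by simp)) (W, q)).hasFDerivAt.comp W h1
      have h3 := ((Complex.ofRealCLM.hasFDerivAt.comp W h2).const_mul (Complex.I * s)).cexp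
      rw [show (fun W => e (W, q)) = fun W => Complex.exp (Complex.I * s *
        (Complex.ofRealCLM ∘ (θ ∘ fun W => (W, q))) W) from rfl, h3.fderiv]
      simp only [_root_.smul_apply, ContinuousLinearMap.comp_apply, smul_eq_mul,
        Function.comp_apply, Complex.ofRealCLM_apply, ContinuousLinearMap.inl_apply]
      simp only [d, e]
      ring
    have hcd : ∀ j W, fderiv ℝ (fun W => c j (W, q)) W (b j) = a' j (W, q) := fun j W => by
      have h1 : HasFDerivAt (fun W : E => (W, q)) (.inl ℝ E Q) W := hasFDerivAt_prodMk_left W q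
      have h2 := (((hc j).differentiable (by simp)) (W, q)).hasFDerivAt.comp W h1
      rw [show (fun W => c j (W, q)) = c j ∘ fun W => (W, q) from rfl, h2.fderiv]
      rfl
    have hin : ContDiff ℝ ∞ fun W : E => (W, q) := contDiff_id.prodMk contDiff_const
    have hint : ∀ f : E × Q → ℂ, Continuous f → HasCompactSupport f →
        Integrable fun W => f (W, q) * e (W, q) := fun f hf hfs =>
      integrable_slice (hf.mul he.continuous) hfs.mul_right q
    have hibp : ∀ j, ∫ W, c j (W, q) * (Complex.I * s * d j (W, q) * e (W, q)) =
        -∫ W, a' j (W, q) * e (W, q) := fun j => by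
      have h0 := integral_mul_fderiv_eq_neg_fderiv_mul_of_integrable (μ := (volume : Measure E))
        (f := fun W => c j (W, q)) (g := fun W => e (W, q)) (v := b j) ?_ ?_ ?_
        (fun W _ => (((hc j).comp hin).differentiable (by simp)) W)
        (fun W _ => ((he.comp hin).differentiable (by simp)) W)
      · simp only [hed, hcd] at h0
        exact h0
      · simp only [hcd]
        exact hint _ (ha' j).continuous (ha's j)
      · simp only [hed]
        have h1 : Continuous fun p => c j p * (Complex.I * s * d j p) :=
          (hc j).continuous.mul (continuous_const.mul
            (Complex.continuous_ofReal.comp (hd j).continuous))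
        refine (hint _ h1 (hcs j).mul_right).congr (Eventually.of_forall fun W => ?_)
        simp only; ring
      · exact hint _ (hc j).continuous (hcs j)
    have hsum : ∀ W, a (W, q) * e (W, q) =
        ∑ j, (Complex.I * s)⁻¹ * (c j (W, q) * (Complex.I * s * d j (W, q) * e (W, q))) := by
      intro W
      have hs0 : (Complex.I * s : ℂ) ≠ 0 :=
        mul_ne_zero Complex.I_ne_zero (Complex.ofReal_ne_zero.2 hs.ne')
      by_cases hp : (W, q) ∈ tsupport a
      · have h1 : ∀ j, (Complex.I * s)⁻¹ * (c j (W, q) * (Complex.I * s * d j (W, q) * e (W, q))) =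
            a (W, q) * e (W, q) * ((d j (W, q) ^ 2 / N (W, q) : ℝ) : ℂ) := fun j => by
          simp only [c]
          have hsC : (s : ℂ) ≠ 0 := Complex.ofReal_ne_zero.2 hs.ne'
          push_cast
          field_simp
        simp only [h1]
        rw [← Finset.mul_sum, ← Complex.ofReal_sum, ← Finset.sum_div,
          show ∑ j, d j (W, q) ^ 2 = N (W, q) from rfl, div_self (hN0 _ hp), Complex.ofReal_one,
          mul_one]
      · simp [c, image_eq_zero_of_notMem_tsupport hp]
    have hfin : ∫ W, a (W, q) * e (W, q) =
        ∑ j, (Complex.I * s)⁻¹ * -∫ W, a' j (W, q) * e (W, q) := by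
      simp only [hsum]
      rw [integral_finsetSum]
      · refine Finset.sum_congr rfl fun j _ => ?_
        rw [integral_const_mul, hibp]
      · intro j _
        have h1 : Continuous fun p => c j p * (Complex.I * s * d j p) :=
          (hc j).continuous.mul (continuous_const.mul
            (Complex.continuous_ofReal.comp (hd j).continuous))
        refine ((hint _ h1 (hcs j).mul_right).const_mul (Complex.I * s)⁻¹).congr
          (Eventually.of_forall fun W => ?_)
        simp only; ring
    change ‖∫ W, a (W, q) * e (W, q)‖ ≤ _
    rw [hfin, Finset.sum_mul]
    refine (norm_sum_le _ _).trans (Finset.sum_le_sum fun j _ => ?_)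
    rw [norm_mul, norm_neg, norm_inv, norm_mul, Complex.norm_I, one_mul, Complex.norm_real,
      Real.norm_of_nonneg hs.le]
    calc s⁻¹ * ‖∫ W, a' j (W, q) * e (W, q)‖ ≤ s⁻¹ * (C j * (s ^ M)⁻¹) := by
          gcongr; exact hC j s hs q
      _ = C j * (s ^ (M + 1))⁻¹ := by rw [pow_succ, mul_inv]; ring

end NonstationaryPhase

/-! ### Decay of the smooth factor away from the cone -/

section OscillatoryDecay

theorem exists_contDiff_cutoff {F : Type*} [NormedAddCommGroup F] [NormedSpace ℝ F]
    [FiniteDimensional ℝ F] {K O : Set F} (hK : IsCompact K) (hO : IsOpen O) (hKO : K ⊆ O) :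
    ∃ β : F → ℝ, ContDiff ℝ ∞ β ∧ HasCompactSupport β ∧ (∀ x ∈ K, β x = 1) ∧ tsupport β ⊆ O := by
  obtain ⟨L, hL, hKL, hLO⟩ := exists_compact_between hK hO hKO
  obtain ⟨f, h1, h0, -⟩ := exists_contMDiffMap_one_nhds_of_subset_interior (n := (⊤ : ℕ∞)) 𝓘(ℝ, F)
    hK.isClosed hKL
  have ht : tsupport f ⊆ L := closure_minimal (fun x hx => by_contra fun h => hx (h0 x h))
    hL.isClosed
  exact ⟨f, f.contMDiff.contDiff, hL.of_isClosed_subset (isClosed_tsupport _) ht,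
    fun x hx => h1.self_of_nhdsSet x hx, ht.trans hLO⟩

variable {E : Type*} [NormedAddCommGroup E] [InnerProductSpace ℝ E] [FiniteDimensional ℝ E]
  [MeasurableSpace E] [BorelSpace E]

/-- If `D₁ m` is close to the identity, the Fourier transform in `W` of
`a (W, Y) exp (i t ζ (m (W, Y)))` decays rapidly away from the cone over a neighborhood of `ζ`. -/
theorem exists_fourier_decay {m : E × E → E} (hm : ContDiff ℝ ∞ m) {a : E × E → ℂ}
    (ha : ContDiff ℝ ∞ a) (hac : HasCompactSupport a) {δ : ℝ}
    (hδ : ∀ p ∈ tsupport a, ∀ v, ‖fderiv ℝ m p (v, 0) - v‖ ≤ δ * ‖v‖) {η : StrongDual ℝ E} {r : ℝ}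
    (hr : 0 < r) (hδ0 : 0 < δ) (hδr : δ * (‖η‖ + r) < r) (N : ℕ) :
    ∃ C, 0 ≤ C ∧ ∀ t : ℝ, 0 < t → ∀ ζ ∈ Metric.ball η r, ∀ ξ : StrongDual ℝ E,
      2 * r * t ≤ ‖ξ - t • η‖ → ∀ Y,
      ‖∫ W, a (W, Y) * Complex.exp (Complex.I * ((t * ζ (m (W, Y)) - ξ W : ℝ) : ℂ))‖ ≤
        C * ((t + ‖ξ‖) ^ N)⁻¹ := by
  -- The points (t, tζ, ξ)/(t + ‖ξ‖) range over this set. Its compactness, with the limit case t = 0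
  -- included, makes the estimate uniform, with t + ‖ξ‖ as large parameter.
  have hS : IsCompact {x : ℝ × StrongDual ℝ E × StrongDual ℝ E | 0 ≤ x.1 ∧ x.1 + ‖x.2.2‖ = 1 ∧
      ‖x.2.1 - x.1 • η‖ ≤ r * x.1 ∧ 2 * r * x.1 ≤ ‖x.2.2 - x.1 • η‖} := by
    refine Metric.isCompact_of_isClosed_isBounded ?_ ?_
    · have h1 : IsClosed {x : ℝ × StrongDual ℝ E × StrongDual ℝ E | 0 ≤ x.1} :=
        isClosed_le (by fun_prop) (by fun_prop)
      have h2 : IsClosed {x : ℝ × StrongDual ℝ E × StrongDual ℝ E | x.1 + ‖x.2.2‖ = 1} :=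
        isClosed_eq (by fun_prop) (by fun_prop)
      have h3 : IsClosed {x : ℝ × StrongDual ℝ E × StrongDual ℝ E |
          ‖x.2.1 - x.1 • η‖ ≤ r * x.1} := isClosed_le (by fun_prop) (by fun_prop)
      have h4 : IsClosed {x : ℝ × StrongDual ℝ E × StrongDual ℝ E |
          2 * r * x.1 ≤ ‖x.2.2 - x.1 • η‖} := isClosed_le (by fun_prop) (by fun_prop)
      exact h1.inter (h2.inter (h3.inter h4))
    · refine (Metric.isBounded_closedBall (x := (0 : ℝ × StrongDual ℝ E × StrongDual ℝ E))
        (r := 1 + ‖η‖ + r)).subset ?_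
      rintro ⟨κ, μ, ρ⟩ ⟨h0, h1, h2, -⟩
      simp only at h0 h1 h2
      have hκ : κ ≤ 1 := by linarith [norm_nonneg ρ]
      have hη := norm_nonneg η
      have h3 : ‖μ‖ ≤ ‖η‖ + r := by
        have := norm_le_norm_add_norm_sub' μ (κ • η)
        rw [norm_smul, Real.norm_of_nonneg h0] at this
        nlinarith
      simp only [mem_closedBall_zero_iff, Prod.norm_def, sup_le_iff, Real.norm_of_nonneg h0]
      refine ⟨by linarith, by linarith, by linarith⟩
  have hO : IsOpen {x : StrongDual ℝ E × StrongDual ℝ E | δ * ‖x.1‖ < ‖x.2 - x.1‖} := by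
    refine isOpen_lt ?_ ?_ <;> fun_prop
  obtain ⟨β, hβ, hβc, hβ1, hβt⟩ := exists_contDiff_cutoff (hS.image continuous_snd) hO (by
    rintro _ ⟨⟨κ, μ, ρ⟩, ⟨h0, h1, h2, h3⟩, rfl⟩
    simp only at h0 h1 h2 h3
    change δ * ‖μ‖ < ‖ρ - μ‖
    -- For κ > 0 one has ‖ρ - μ‖ ≥ 2rκ - rκ = rκ > δκ(‖η‖ + r) ≥ δ‖μ‖. For κ = 0, μ vanishes and ρ
    -- has norm 1.
    have h4 : ‖ρ - κ • η‖ ≤ ‖ρ - μ‖ + ‖μ - κ • η‖ := norm_sub_le_norm_sub_add_norm_sub _ _ _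
    have h5 := norm_le_norm_add_norm_sub' μ (κ • η)
    rw [norm_smul, Real.norm_of_nonneg h0] at h5
    rcases h0.eq_or_lt with h | h
    · subst h
      have : μ = 0 := by simpa using h2.trans (mul_zero r).le
      subst this
      simp only [zero_add] at h1
      simp [h1]
    · have h6 : δ * ‖μ‖ ≤ κ * (δ * (‖η‖ + r)) := by nlinarith
      nlinarith)
  let θ : E × (E × StrongDual ℝ E × StrongDual ℝ E) → ℝ :=
    fun p => p.2.2.1 (m (p.1, p.2.1)) - p.2.2.2 p.1
  have hθ : ContDiff ℝ ∞ θ := by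
    have h1 : ContDiff ℝ ∞ fun p : E × (E × StrongDual ℝ E × StrongDual ℝ E) => p.2.2.1 := by
      fun_prop
    have h2 : ContDiff ℝ ∞ fun p : E × (E × StrongDual ℝ E × StrongDual ℝ E) => p.2.2.2 := by
      fun_prop
    have h3 : ContDiff ℝ ∞ fun p : E × (E × StrongDual ℝ E × StrongDual ℝ E) =>
      (p.1, p.2.1) := by fun_prop
    exact (h1.clm_apply (hm.comp h3)).sub (h2.clm_apply contDiff_fst)
  -- The factor β cuts off the frequency parameters too, so that the amplitude is compactly
  -- supported jointly in all variables, as `nonstationary_phase` demands.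
  let A : E × (E × StrongDual ℝ E × StrongDual ℝ E) → ℂ :=
    fun p => a (p.1, p.2.1) * ((β p.2.2 : ℝ) : ℂ)
  have hA : ContDiff ℝ ∞ A := by
    have h3 : ContDiff ℝ ∞ fun p : E × (E × StrongDual ℝ E × StrongDual ℝ E) =>
      (p.1, p.2.1) := by fun_prop
    have h4 : ContDiff ℝ ∞ fun p : E × (E × StrongDual ℝ E × StrongDual ℝ E) => p.2.2 := by fun_prop
    exact (ha.comp h3).mul (Complex.ofRealCLM.contDiff.comp (hβ.comp h4))
  have hAt : ∀ p ∈ tsupport A, (p.1, p.2.1) ∈ tsupport a ∧ p.2.2 ∈ tsupport β := by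
    have hcl : IsClosed {p : E × (E × StrongDual ℝ E × StrongDual ℝ E) |
        (p.1, p.2.1) ∈ tsupport a ∧ p.2.2 ∈ tsupport β} :=
      ((isClosed_tsupport a).preimage (by fun_prop)).inter
        ((isClosed_tsupport β).preimage (by fun_prop))
    refine fun p hp => closure_minimal (fun x hx => ?_) hcl hp
    have hx' : A x ≠ 0 := hx
    refine ⟨subset_closure (left_ne_zero_of_mul hx'), subset_closure ?_⟩
    have := right_ne_zero_of_mul hx'
    simpa using this
  have hAc : HasCompactSupport A := by
    have hi : IsCompact ((fun x : (E × E) × (StrongDual ℝ E × StrongDual ℝ E) =>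
        (x.1.1, x.1.2, x.2)) ''
        (tsupport a ×ˢ tsupport β)) := (hac.isCompact.prod hβc.isCompact).image (by fun_prop)
    exact hi.of_isClosed_subset (isClosed_tsupport _) fun p hp =>
      ⟨((p.1, p.2.1), p.2.2), hAt p hp, rfl⟩
  obtain ⟨C, hC⟩ := nonstationary_phase hθ N hA hAc (by
    rintro ⟨W, Y, μ, ρ⟩ hp
    obtain ⟨h1, h2⟩ := hAt _ hp
    simp only at h1 h2
    by_contra! hz
    have hfd : ∀ v, fderiv ℝ θ (W, Y, μ, ρ) (v, 0) = μ (fderiv ℝ m (W, Y) (v, 0)) - ρ v := by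
      intro v
      have e1 : fderiv ℝ θ (W, Y, μ, ρ) (v, 0) =
          fderiv ℝ (fun x => θ (x, Y, μ, ρ)) W v := by
        have := HasFDerivAt.comp (f := fun x => (x, Y, μ, ρ)) W
          ((hθ.differentiable (by simp)) (W, Y, μ, ρ)).hasFDerivAt
          (hasFDerivAt_prodMk_left W (Y, μ, ρ))
        rw [show (fun x => θ (x, Y, μ, ρ)) = θ ∘ fun x => (x, Y, μ, ρ) from rfl, this.fderiv]
        rfl
      have e2 : HasFDerivAt (fun x => θ (x, Y, μ, ρ))
          (μ.comp ((fderiv ℝ m (W, Y)).comp (.inl ℝ E E)) - ρ) W :=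
        (μ.hasFDerivAt.comp W (((hm.differentiable (by simp)) (W, Y)).hasFDerivAt.comp W
          (hasFDerivAt_prodMk_left W Y))).sub ρ.hasFDerivAt
      rw [e1, e2.fderiv]
      rfl
    -- At a stationary point ρ = μ ∘ D₁m, and D₁m is δ-close to the identity. This is excluded on
    -- the support of β.
    have h3 : ‖ρ - μ‖ ≤ δ * ‖μ‖ := by
      refine ContinuousLinearMap.opNorm_le_bound _ (by positivity) fun v => ?_
      have h4 : (ρ - μ) v = μ (fderiv ℝ m (W, Y) (v, 0) - v) := by
        have := hz v
        rw [hfd] at this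
        rw [map_sub, _root_.sub_apply]
        linarith
      rw [h4]
      calc ‖μ (fderiv ℝ m (W, Y) (v, 0) - v)‖ ≤ ‖μ‖ * ‖fderiv ℝ m (W, Y) (v, 0) - v‖ :=
            μ.le_opNorm _
        _ ≤ ‖μ‖ * (δ * ‖v‖) := by gcongr; exact hδ _ h1 v
        _ = _ := by ring
    exact absurd (hβt h2) (not_lt.2 h3))
  refine ⟨|C|, abs_nonneg C, fun t ht ζ hζ ξ hξ Y => ?_⟩
  have hs : 0 < t + ‖ξ‖ := by positivity
  set s := t + ‖ξ‖ with hs_def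
  have hmem : ((s⁻¹ * t) • ζ, s⁻¹ • ξ) ∈ Prod.snd ''
      {x : ℝ × StrongDual ℝ E × StrongDual ℝ E | 0 ≤ x.1 ∧ x.1 + ‖x.2.2‖ = 1 ∧
      ‖x.2.1 - x.1 • η‖ ≤ r * x.1 ∧ 2 * r * x.1 ≤ ‖x.2.2 - x.1 • η‖} := by
    refine ⟨(s⁻¹ * t, (s⁻¹ * t) • ζ, s⁻¹ • ξ), ⟨by positivity, ?_, ?_, ?_⟩, rfl⟩
    · simp only [norm_smul, norm_inv, Real.norm_of_nonneg hs.le]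
      rw [← mul_add, ← hs_def, inv_mul_cancel₀ hs.ne']
    · simp only
      rw [show (s⁻¹ * t) • ζ - (s⁻¹ * t) • η = (s⁻¹ * t) • (ζ - η) from (smul_sub _ _ _).symm,
        norm_smul, Real.norm_of_nonneg (by positivity), mul_comm r]
      gcongr
      rw [← dist_eq_norm]; exact (Metric.mem_ball.1 hζ).le
    · simp only
      rw [mul_smul, show s⁻¹ • ξ - s⁻¹ • t • η = s⁻¹ • (ξ - t • η) from (smul_sub _ _ _).symm,
        norm_smul, norm_inv, Real.norm_of_nonneg hs.le]
      calc 2 * r * (s⁻¹ * t) = s⁻¹ * (2 * r * t) := by ring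
        _ ≤ _ := by gcongr
  have h1 := hC s hs (Y, (s⁻¹ * t) • ζ, s⁻¹ • ξ)
  have h2 : ∀ W, A (W, Y, (s⁻¹ * t) • ζ, s⁻¹ • ξ) *
      Complex.exp (Complex.I * s * θ (W, Y, (s⁻¹ * t) • ζ, s⁻¹ • ξ)) =
      a (W, Y) * Complex.exp (Complex.I * ((t * ζ (m (W, Y)) - ξ W : ℝ) : ℂ)) := by
    intro W
    simp only [A, θ, hβ1 _ hmem, Complex.ofReal_one, mul_one]
    rw [mul_assoc Complex.I, ← Complex.ofReal_mul]
    congr 4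
    simp only [_root_.smul_apply, smul_eq_mul]
    field_simp
  simp only [h2] at h1
  refine h1.trans ?_
  gcongr
  exact le_abs_self C

end OscillatoryDecay

/-! ### Pairing the two factors by Fourier inversion -/

section FourierInversion

variable {E : Type*} [NormedAddCommGroup E] [InnerProductSpace ℝ E] [FiniteDimensional ℝ E]
  [MeasurableSpace E] [BorelSpace E]

open scoped FourierTransform in
/-- The integral of a test function against a function on a subspace in terms of the Fourier
transforms of both. -/
theorem integral_mul_eq_integral_fourier {w : Submodule ℝ E} {f : w → ℂ} (hf : Integrable f)
    {b : E → ℂ} (hb : ContDiff ℝ ∞ b) (hbc : HasCompactSupport b) :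
    Integrable (𝓕 b) ∧ ∫ W : w, f W * b W =
      ∫ v : E, 𝓕 b v * ∫ W : w, f W *
        Complex.exp (Complex.I * ((2 * Real.pi * inner ℝ (v : E) (W : E) : ℝ) : ℂ)) := by
  have hF : Integrable (𝓕 b) := by
    have := (𝓕 (hbc.toSchwartzMap hb)).integrable (μ := (volume : Measure E))
    rwa [SchwartzMap.fourier_coe] at this
  refine ⟨hF, ?_⟩
  have hinv : ∀ W : E, b W = ∫ v : E,
      Complex.exp (Complex.I * ((2 * Real.pi * inner ℝ v W : ℝ) : ℂ)) * 𝓕 b v := fun W => by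
    have h1 := hb.continuous.fourierInv_fourier_eq
      (hb.continuous.integrable_of_hasCompactSupport hbc) hF
    conv_lhs => rw [← h1]
    rw [Real.fourierInv_eq']
    refine integral_congr_ae (Eventually.of_forall fun v => ?_)
    simp only [smul_eq_mul]
    rw [mul_comm Complex.I]
  have hi : Integrable (fun p : w × E => f p.1 *
      (Complex.exp (Complex.I * ((2 * Real.pi * inner ℝ (p.2 : E) (p.1 : E) : ℝ) : ℂ)) *
        𝓕 b p.2)) (volume.prod volume) := by
    refine (hf.mul_prod hF).mono ?_ (Eventually.of_forall fun p => ?_)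
    · refine hf.aestronglyMeasurable.comp_fst.mul (Continuous.aestronglyMeasurable ?_ |>.mul
        hF.aestronglyMeasurable.comp_snd)
      fun_prop
    · rw [norm_mul, norm_mul, norm_mul, Complex.norm_exp_I_mul_ofReal, one_mul]
  calc ∫ W : w, f W * b W = ∫ W : w, ∫ v : E, f W *
      (Complex.exp (Complex.I * ((2 * Real.pi * inner ℝ (v : E) (W : E) : ℝ) : ℂ)) * 𝓕 b v) := by
        refine integral_congr_ae (Eventually.of_forall fun W => ?_)
        simp only
        rw [integral_const_mul, ← hinv]
    _ = ∫ v : E, ∫ W : w, f W *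
      (Complex.exp (Complex.I * ((2 * Real.pi * inner ℝ (v : E) (W : E) : ℝ) : ℂ)) * 𝓕 b v) :=
        integral_integral_swap hi
    _ = _ := by
        refine integral_congr_ae (Eventually.of_forall fun v => ?_)
        simp only
        rw [← integral_const_mul]
        refine integral_congr_ae (Eventually.of_forall fun W => ?_)
        simp only
        ring

open scoped FourierTransform in
/-- If the Fourier transform of `f` decays near the cone over `ball η (2 * r)`, the oscillatory
integral of `f` with phase `ζ ∘ m`, where `D₁ m` is close to the identity, decays. -/
theorem exists_oscillatory_bound {m : E × E → E} (hm : ContDiff ℝ ∞ m) {a : E × E → ℂ}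
    (ha : ContDiff ℝ ∞ a) (hac : HasCompactSupport a) {δ : ℝ}
    (hδ : ∀ p ∈ tsupport a, ∀ v, ‖fderiv ℝ m p (v, 0) - v‖ ≤ δ * ‖v‖) {η : StrongDual ℝ E} {r : ℝ}
    (hr : 0 < r) (hδ0 : 0 < δ) (hδr : δ * (‖η‖ + r) < r) (N : ℕ) {A B : ℝ} (hA : 0 ≤ A)
    (hB : 0 ≤ B) :
    ∃ C, 0 ≤ C ∧ ∀ (w : Submodule ℝ E) (f : w → ℂ), Integrable f → ∀ L : ℝ, 0 ≤ L →
      ∫ W, ‖f W‖ ≤ B * L → ∀ t : ℝ, 0 < t →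
      (∀ ξ : StrongDual ℝ E, ‖ξ - t • η‖ < 2 * r * t →
        ‖∫ W : w, f W * Complex.exp (Complex.I * ((ξ W : ℝ) : ℂ))‖ ≤
          A * L * (t ^ (N + (Module.finrank ℝ E + 1)))⁻¹) →
      ∀ ζ ∈ Metric.ball η r, ∀ Y : E,
      ‖∫ W : w, f W * (a ((W : E), Y) *
        Complex.exp (Complex.I * ((t * ζ (m ((W : E), Y)) : ℝ) : ℂ)))‖ ≤ C * L * (t ^ N)⁻¹ := by
  set n := Module.finrank ℝ E
  obtain ⟨Cd, hCd0, hCd⟩ := exists_fourier_decay hm ha hac hδ hr hδ0 hδr (N + (n + 1))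
  obtain ⟨Ca, hCa⟩ := ha.continuous.bounded_above_of_compact_support hac
  have hCa0 : 0 ≤ Ca := (norm_nonneg _).trans (hCa 0)
  obtain ⟨Ci, hCi⟩ := exists_integral_slice_le ha.continuous hac
  have hCi0 : 0 ≤ Ci := (integral_nonneg fun _ => norm_nonneg _).trans (hCi 0)
  -- The n + 1 extra powers of decay asked of both factors pay for the integrability in the
  -- frequency v over the n-dimensional space.
  let J : ℝ := ∫ v : E, ((1 + ‖v‖) ^ (n + 1))⁻¹
  have hJi : Integrable fun v : E => ((1 + ‖v‖) ^ (n + 1))⁻¹ := by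
    have := integrable_one_add_norm (E := E) (μ := volume) (r := ((n + 1 : ℕ) : ℝ))
      (by exact_mod_cast Nat.lt_succ_self n)
    refine this.congr (Eventually.of_forall fun v => ?_)
    simp only
    rw [Real.rpow_neg (by positivity), Real.rpow_natCast]
  have hJ0 : 0 ≤ J := integral_nonneg fun v => by positivity
  let R : ℝ := 1 + ‖η‖ + 2 * r
  let D : ℝ := Ci * A * R ^ (n + 1) + Cd * B
  have hR0 : 0 ≤ R := by positivity
  have hD0 : 0 ≤ D := by positivity
  refine ⟨D * J + Ca * B, by positivity, fun w f hf L hL hfL t ht hdec ζ hζ Y => ?_⟩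
  let b : E → ℂ := fun W => a (W, Y) * Complex.exp (Complex.I * ((t * ζ (m (W, Y)) : ℝ) : ℂ))
  change ‖∫ W : w, f W * b W‖ ≤ _
  have hin : ContDiff ℝ ∞ fun W : E => (W, Y) := contDiff_id.prodMk contDiff_const
  have hb : ContDiff ℝ ∞ b := by
    refine (ha.comp hin).mul (ContDiff.cexp (contDiff_const.mul
      (Complex.ofRealCLM.contDiff.comp (contDiff_const.mul (ζ.contDiff.comp (hm.comp hin))))))
  have hbc : HasCompactSupport b := (hasCompactSupport_slice hac Y).mul_right
  have hbn : ∀ W, ‖b W‖ = ‖a (W, Y)‖ := fun W => by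
    simp only [b, norm_mul, Complex.norm_exp_I_mul_ofReal, mul_one]
  -- For t < 1 the trivial bound suffices because t^{-N} ≥ 1; below, t ≥ 1 is used to get 1 + ‖v‖ ≤
  -- R t in the cone.
  rcases lt_or_ge t 1 with ht1 | ht1
  · have h1 : ‖∫ W : w, f W * b W‖ ≤ ∫ W : w, ‖f W‖ * Ca := by
      refine norm_integral_le_of_norm_le (hf.norm.mul_const _) (Eventually.of_forall fun W => ?_)
      rw [norm_mul, hbn]
      gcongr
      exact hCa _
    rw [integral_mul_const] at h1
    have h2 : (1 : ℝ) ≤ (t ^ N)⁻¹ := (one_le_inv₀ (by positivity)).2 (pow_le_one₀ ht.le ht1.le)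
    calc _ ≤ _ := h1
      _ ≤ B * L * Ca := by gcongr
      _ = (Ca * B) * L * 1 := by ring
      _ ≤ (D * J + Ca * B) * L * (t ^ N)⁻¹ := by
          gcongr
          exact le_add_of_nonneg_left (by positivity)
  obtain ⟨hF, heq⟩ := integral_mul_eq_integral_fourier hf hb hbc
  rw [heq]
  have key : ∀ v : E, ‖𝓕 b v * ∫ W : w, f W *
      Complex.exp (Complex.I * ((2 * Real.pi * inner ℝ (v : E) (W : E) : ℝ) : ℂ))‖ ≤
      D * L * (t ^ N)⁻¹ * ((1 + ‖v‖) ^ (n + 1))⁻¹ := by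
    intro v
    let ξ : StrongDual ℝ E := (2 * Real.pi) • innerSL ℝ v
    have hξ : ∀ W, ξ W = 2 * Real.pi * inner ℝ v W := fun W => rfl
    have hξn : ‖ξ‖ = 2 * Real.pi * ‖v‖ := by
      simp only [ξ]
      rw [norm_smul, innerSL_apply_norm, Real.norm_of_nonneg (by positivity)]
    have hvξ : ‖v‖ ≤ ‖ξ‖ := by
      rw [hξn]
      have := Real.pi_gt_three
      nlinarith [norm_nonneg v]
    simp only [← hξ]
    rw [norm_mul]
    have hFv : 𝓕 b v = ∫ W, a (W, Y) *
        Complex.exp (Complex.I * ((t * ζ (m (W, Y)) - ξ W : ℝ) : ℂ)) := by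
      rw [Real.fourier_eq']
      refine integral_congr_ae (Eventually.of_forall fun W => ?_)
      simp only [b, smul_eq_mul]
      rw [mul_left_comm, ← Complex.exp_add, hξ, real_inner_comm]
      congr 2
      push_cast
      ring
    -- In the cone the transform of f decays and ‖v‖ is at most of order t, so spare powers of t⁻¹
    -- become powers of (1 + ‖v‖)⁻¹. Off the cone the transform of b decays in t + ‖ξ‖, and f is
    -- estimated by its L¹ norm.
    by_cases hc : ‖ξ - t • η‖ < 2 * r * t
    · have h1 : ‖𝓕 b v‖ ≤ Ci := by
        rw [Real.fourier_eq]
        refine (norm_integral_le_integral_norm _).trans (le_of_eq_of_le ?_ (hCi Y))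
        refine integral_congr_ae (Eventually.of_forall fun W => ?_)
        simp only [Circle.norm_smul, hbn]
      have h2 : 1 + ‖v‖ ≤ R * t := by
        have h3 := norm_le_norm_add_norm_sub' ξ (t • η)
        have h5 : ‖t • η‖ = t * ‖η‖ := by rw [norm_smul, Real.norm_of_nonneg ht.le]
        rw [h5] at h3
        simp only [R]
        nlinarith
      have h4 : (t ^ (n + 1))⁻¹ ≤ R ^ (n + 1) * ((1 + ‖v‖) ^ (n + 1))⁻¹ := by
        rw [inv_le_iff_one_le_mul₀ (by positivity), mul_right_comm, ← mul_pow,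
          ← div_eq_mul_inv, one_le_div (by positivity)]
        gcongr
      calc _ ≤ Ci * (A * L * (t ^ (N + (n + 1)))⁻¹) := by gcongr; exact hdec ξ hc
        _ = Ci * A * L * (t ^ N)⁻¹ * (t ^ (n + 1))⁻¹ := by rw [pow_add, mul_inv]; ring
        _ ≤ Ci * A * L * (t ^ N)⁻¹ * (R ^ (n + 1) * ((1 + ‖v‖) ^ (n + 1))⁻¹) := by gcongr
        _ = (Ci * A * R ^ (n + 1)) * L * (t ^ N)⁻¹ * ((1 + ‖v‖) ^ (n + 1))⁻¹ := by ring
        _ ≤ _ := by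
          gcongr
          exact le_add_of_nonneg_right (by positivity)
    · have h1 : ‖𝓕 b v‖ ≤ Cd * ((t + ‖ξ‖) ^ (N + (n + 1)))⁻¹ := by
        rw [hFv]
        exact hCd t ht ζ hζ ξ (not_lt.1 hc) Y
      have h2 : ((t + ‖ξ‖) ^ (N + (n + 1)))⁻¹ ≤ (t ^ N)⁻¹ * ((1 + ‖v‖) ^ (n + 1))⁻¹ := by
        rw [← mul_inv, pow_add]
        gcongr
        exact le_add_of_nonneg_right (norm_nonneg _)
      have h3 : ‖∫ W : w, f W * Complex.exp (Complex.I * ((ξ W : ℝ) : ℂ))‖ ≤ B * L := by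
        refine (norm_integral_le_integral_norm _).trans (le_of_eq_of_le ?_ hfL)
        refine integral_congr_ae (Eventually.of_forall fun W => ?_)
        simp only [norm_mul, Complex.norm_exp_I_mul_ofReal, mul_one]
      calc _ ≤ Cd * ((t ^ N)⁻¹ * ((1 + ‖v‖) ^ (n + 1))⁻¹) * (B * L) := by
            gcongr
            exact h1.trans (by gcongr)
        _ = (Cd * B) * L * (t ^ N)⁻¹ * ((1 + ‖v‖) ^ (n + 1))⁻¹ := by ring
        _ ≤ _ := by
          gcongr
          exact le_add_of_nonneg_left (by positivity)
  refine (norm_integral_le_of_norm_le (hJi.const_mul _) (Eventually.of_forall key)).trans ?_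
  rw [integral_const_mul]
  change D * L * (t ^ N)⁻¹ * J ≤ _
  calc D * L * (t ^ N)⁻¹ * J = D * J * L * (t ^ N)⁻¹ := by ring
    _ ≤ _ := by
      gcongr
      exact le_add_of_nonneg_right (by positivity)

end FourierInversion

/-! ### Volumes of balls in subspaces -/

section BallVolume

variable {E : Type*} [NormedAddCommGroup E] [InnerProductSpace ℝ E] [FiniteDimensional ℝ E]
  [MeasurableSpace E] [BorelSpace E]

theorem volume_ball_subspace (w : Submodule ℝ E) (ρ : ℝ) :
    volume (Metric.ball (0 : w) ρ) =
      volume (Metric.ball (0 : EuclideanSpace ℝ (Fin (Module.finrank ℝ w))) ρ) := by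
  let e := (stdOrthonormalBasis ℝ w).repr
  rw [← (stdOrthonormalBasis ℝ w).measurePreserving_repr.measure_preimage
    Metric.isOpen_ball.measurableSet.nullMeasurableSet]
  congr 1
  ext x
  simp

/-- The volumes of balls of a fixed radius in the subspaces of `E` are bounded from above and
from below. -/
theorem exists_volume_ball_bounds (E : Type*) [NormedAddCommGroup E] [InnerProductSpace ℝ E]
    [FiniteDimensional ℝ E] [MeasurableSpace E] [BorelSpace E] {ρ : ℝ} (hρ : 0 < ρ) :
    ∃ c C : ℝ, 0 < c ∧ ∀ w : Submodule ℝ E,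
      c ≤ (volume (Metric.ball (0 : w) ρ)).toReal ∧
        (volume (Metric.ball (0 : w) ρ)).toReal ≤ C := by
  let F : ℕ → ℝ := fun d => (volume (Metric.ball (0 : EuclideanSpace ℝ (Fin d)) ρ)).toReal
  have hF : ∀ d, 0 < F d := fun d => ENNReal.toReal_pos (Metric.measure_ball_pos _ _ hρ).ne'
    measure_ball_lt_top.ne
  -- The volume depends only on the dimension of the subspace, so only finitely many values occur.
  let S := Finset.range (Module.finrank ℝ E + 1)
  have hS : S.Nonempty := ⟨0, by simp [S]⟩
  refine ⟨S.inf' hS F, S.sup' hS F, (Finset.lt_inf'_iff hS).2 fun d _ => hF d, fun w => ?_⟩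
  have hw : Module.finrank ℝ w ∈ S :=
    Finset.mem_range.2 (Nat.lt_succ_of_le (Submodule.finrank_le w))
  rw [volume_ball_subspace]
  exact ⟨Finset.inf'_le F hw, Finset.le_sup' F hw⟩

end BallVolume

/-! ### A globally smooth model of multiplication near 0 -/

section LocalMultiplication

variable {E : Type*} [NormedAddCommGroup E] [InnerProductSpace ℝ E] [FiniteDimensional ℝ E]

theorem contDiff_det : ContDiff ℝ ∞ fun A : E →L[ℝ] E => A.det := by
  let b := stdOrthonormalBasis ℝ E
  have h : (fun A : E →L[ℝ] E => A.det) = fun A => ∑ σ : Equiv.Perm (Fin (Module.finrank ℝ E)),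
      (Equiv.Perm.sign σ : ℤ) • ∏ i, inner ℝ (b (σ i)) (A (b i)) := by
    ext A
    rw [ContinuousLinearMap.det, ← LinearMap.det_toMatrix b.toBasis, Matrix.det_apply]
    simp [LinearMap.toMatrix_apply, b.repr_apply_apply, Units.smul_def]
  rw [h]
  refine ContDiff.sum fun σ _ => ContDiff.const_smul _ (contDiff_prod fun i _ => ?_)
  exact contDiff_const.inner ℝ (contDiff_id.clm_apply contDiff_const)

/-- `m` is a smooth map that agrees near `0` with the multiplication of `G` in exponential
coordinates; `ρ` and `δ` quantify this. -/
structure IsLocalMul (G : Type*) [TopologicalSpace G] [ChartedSpace E G] [Group G]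
    [LieGroup 𝓘(ℝ, E) ∞ G] [T2Space G] (m : E × E → E) (ρ δ : ℝ) : Prop where
  contDiff : ContDiff ℝ ∞ m
  pos : 0 < ρ
  lieExp_eq : ∀ p ∈ Metric.ball (0 : E × E) (6 * ρ), (lieExp (m p) : G) = lieExp p.1 * lieExp p.2
  fderiv_left : ∀ p ∈ Metric.ball (0 : E × E) (6 * ρ), ∀ v, ‖fderiv ℝ m p (v, 0) - v‖ ≤ δ * ‖v‖
  det_pos : ∀ p ∈ Metric.ball (0 : E × E) (6 * ρ), 0 < ((fderiv ℝ m p).comp (.inr ℝ E E)).det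
  neg_left : ∀ p ∈ Metric.ball (0 : E × E) (6 * ρ), m (-p.1, m p) = p.2
  norm_lt : ∀ p ∈ Metric.ball (0 : E × E) ρ, ‖m p‖ < 3 * ρ

/-- `logMul` is only known to be smooth near the origin, while the oscillatory estimates are stated
for globally smooth maps; a bump function mediates. -/
theorem exists_contDiff_eventuallyEq {f : E × E → E} (hf : ∀ᶠ p in 𝓝 0, ContDiffAt ℝ ∞ f p) :
    ∃ m : E × E → E, ContDiff ℝ ∞ m ∧ m =ᶠ[𝓝 0] f := by
  obtain ⟨R, hR, hRf⟩ := Metric.eventually_nhds_iff_ball.1 hf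
  let β : ContDiffBump (0 : E × E) := ⟨R / 4, R / 2, by positivity, by linarith⟩
  refine ⟨fun p => β p • f p, ?_, ?_⟩
  · rw [contDiff_iff_contDiffAt]
    intro p
    by_cases hp : p ∈ Metric.ball 0 R
    · exact β.contDiffAt.smul (hRf p hp)
    · refine (contDiffAt_const (c := (0 : E))).congr_of_eventuallyEq ?_
      have hp' : p ∈ (Metric.closedBall (0 : E × E) (R / 2))ᶜ := fun h =>
        hp (Metric.closedBall_subset_ball (by linarith) h)
      filter_upwards [Metric.isClosed_closedBall.isOpen_compl.mem_nhds hp'] with x hx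
      rw [β.zero_of_le_dist, zero_smul]
      exact (not_le.1 fun h => hx (Metric.mem_closedBall.2 h)).le
  · filter_upwards [β.eventuallyEq_one] with p hp
    rw [hp, Pi.one_apply, one_smul]

variable {G : Type*} [TopologicalSpace G] [ChartedSpace E G] [Group G]
    [LieGroup 𝓘(ℝ, E) ∞ G] [T2Space G]

variable (G) in
theorem exists_isLocalMul {δ : ℝ} (hδ : 0 < δ) {U : Set E} (hU : U ∈ 𝓝 (0 : E)) :
    ∃ (m : E × E → E) (ρ : ℝ), IsLocalMul G m ρ δ ∧ Metric.ball (0 : E) ρ ⊆ U := by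
  obtain ⟨m, hm, hmf⟩ := exists_contDiff_eventuallyEq
    ((eventually_logMul E G).mono fun p hp => hp.1)
  have hD : HasFDerivAt m (ContinuousLinearMap.fst ℝ E E + ContinuousLinearMap.snd ℝ E E) 0 :=
    (hasStrictFDerivAt_logMul E G).hasFDerivAt.congr_of_eventuallyEq hmf
  have hm0 : m 0 = 0 := hmf.self_of_nhds.trans (logMul_zero E G)
  have hDc : Continuous (fderiv ℝ m) := hm.continuous_fderiv (by simp)
  have h1 : ∀ᶠ p in 𝓝 (0 : E × E), (lieExp (m p) : G) = lieExp p.1 * lieExp p.2 := by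
    filter_upwards [hmf, eventually_logMul E G] with p hp h
    rw [hp, h.2.2]
  have h2 : ∀ᶠ p in 𝓝 (0 : E × E), ‖(fderiv ℝ m p).comp (.inl ℝ E E) -
      ContinuousLinearMap.id ℝ E‖ < δ := by
    have hc : Continuous fun p => (fderiv ℝ m p).comp (.inl ℝ E E) :=
      hDc.clm_comp continuous_const
    have hn : Continuous fun p => ‖(fderiv ℝ m p).comp (.inl ℝ E E) -
      ContinuousLinearMap.id ℝ E‖ := by fun_prop
    refine hn.continuousAt.eventually_lt_const ?_
    have : (fderiv ℝ m 0).comp (.inl ℝ E E) = ContinuousLinearMap.id ℝ E := by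
      rw [hD.fderiv]; ext; simp
    simp only [this]
    simpa using hδ
  have h3 : ∀ᶠ p in 𝓝 (0 : E × E), 0 < ((fderiv ℝ m p).comp (.inr ℝ E E)).det := by
    have hc : Continuous fun p => ((fderiv ℝ m p).comp (.inr ℝ E E)).det :=
      ContinuousLinearMap.continuous_det.comp (hDc.clm_comp continuous_const)
    refine hc.continuousAt.eventually_const_lt ?_
    have : (fderiv ℝ m 0).comp (.inr ℝ E E) = ContinuousLinearMap.id ℝ E := by
      rw [hD.fderiv]; ext; simp
    simp only [this]
    simp [ContinuousLinearMap.det]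
  have ht : Tendsto (fun p : E × E => (-p.1, m p)) (𝓝 0) (𝓝 0) :=
    (continuous_fst.neg.prodMk hm.continuous).tendsto' _ _ (by simp [hm0])
  have h4 : ∀ᶠ p in 𝓝 (0 : E × E), m (-p.1, m p) = p.2 := by
    have hs := (continuous_snd.tendsto' (0 : E × E) 0 rfl).eventually (expChart_source_mem E G)
    filter_upwards [ht.eventually hmf, h1, hs] with p hp hp1 hps
    rw [hp, logMul, hp1, lieExp_neg, inv_mul_cancel_left, ← expChart_apply hps,
      (expChart E G).left_inv hps]
  -- In the sup norm the linear part p.1 + p.2 has norm at most 2‖p‖, and the remainder is at most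
  -- ‖p‖/2. The total is below the factor 3 in `norm_lt`.
  have h5 : ∀ᶠ p in 𝓝 (0 : E × E), ‖m p‖ ≤ 5 / 2 * ‖p‖ := by
    have := (hasFDerivAt_iff_isLittleO_nhds_zero.1 hD).def (c := 1 / 2) (by norm_num)
    filter_upwards [this] with p hp
    rw [zero_add, hm0, sub_zero] at hp
    have e1 := norm_fst_le p
    have e2 := norm_snd_le p
    have e3 := norm_le_norm_add_norm_sub' (m p) (p.1 + p.2)
    have e4 := norm_add_le p.1 p.2
    have e5 : (ContinuousLinearMap.fst ℝ E E + ContinuousLinearMap.snd ℝ E E) p = p.1 + p.2 := rfl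
    rw [e5] at hp
    linarith
  have h6 : ∀ᶠ p in 𝓝 (0 : E × E), p.1 ∈ U :=
    (continuous_fst.tendsto' (0 : E × E) 0 rfl).eventually hU
  obtain ⟨R, hR, hall⟩ := Metric.eventually_nhds_iff_ball.1
    (h1.and (h2.and (h3.and (h4.and (h5.and h6)))))
  have hR6 : 6 * (R / 6) = R := by ring
  refine ⟨m, R / 6, ⟨hm, by positivity, ?_, ?_, ?_, ?_, ?_⟩, ?_⟩
  · rw [hR6]; exact fun p hp => (hall p hp).1
  · rw [hR6]
    intro p hp v
    exact (((fderiv ℝ m p).comp (.inl ℝ E E) - ContinuousLinearMap.id ℝ E).le_opNorm v).trans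
      (mul_le_mul_of_nonneg_right (hall p hp).2.1.le (norm_nonneg _))
  · rw [hR6]; exact fun p hp => (hall p hp).2.2.1
  · rw [hR6]; exact fun p hp => (hall p hp).2.2.2.1
  · intro p hp
    have h := (hall p (Metric.ball_subset_ball (by linarith) hp)).2.2.2.2.1
    rw [mem_ball_zero_iff] at hp
    linarith
  · intro x hx
    refine (hall (x, 0) ?_).2.2.2.2.2
    rw [mem_ball_zero_iff] at hx ⊢
    rw [Prod.norm_def]
    simp only [norm_zero, sup_lt_iff]
    exact ⟨by linarith, hR⟩

variable [MeasurableSpace E] [BorelSpace E] {m : E × E → E} {ρ δ : ℝ}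

/-- Substitution of `m (W, ·)` in an integral. -/
theorem IsLocalMul.integral_eq (h : IsLocalMul G m ρ δ) {W : E} (hW : ‖W‖ < ρ) {Ψ : E → ℂ}
    (hΨ : ∀ Y, ρ ≤ ‖Y‖ → Ψ Y = 0) {χ : E → ℝ} (hχ1 : ∀ Y, ‖Y‖ < 3 * ρ → χ Y = 1)
    (hχ0 : ∀ Y, 4 * ρ ≤ ‖Y‖ → χ Y = 0) :
    ∫ Y, Ψ Y =
      ∫ Y, ((χ Y * ((fderiv ℝ m (W, Y)).comp (.inr ℝ E E)).det : ℝ) : ℂ) * Ψ (m (W, Y)) := by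
  have hρ := h.pos
  have hmem : ∀ {V Y : E}, ‖V‖ < ρ → ‖Y‖ < 4 * ρ → (V, Y) ∈ Metric.ball (0 : E × E) (6 * ρ) := by
    intro V Y hV hY
    rw [mem_ball_zero_iff, Prod.norm_def, sup_lt_iff]
    exact ⟨by simp only; linarith, by simp only; linarith⟩
  have hmem' : ∀ {V Y : E}, ‖V‖ < ρ → ‖Y‖ < ρ → (V, Y) ∈ Metric.ball (0 : E × E) ρ := by
    intro V Y hV hY
    rw [mem_ball_zero_iff, Prod.norm_def, sup_lt_iff]
    exact ⟨hV, hY⟩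
  -- Multiplication by e^{-W} undoes that by e^W. So where Ψ(m(W,Y)) is nonzero on the 4ρ-ball, Y
  -- lies where χ = 1, and χ does not change the integral.
  have hsmall : ∀ Y, ‖Y‖ < 4 * ρ → ‖m (W, Y)‖ < ρ → ‖Y‖ < 3 * ρ := by
    intro Y hY hm
    have h1 := h.neg_left _ (hmem hW hY)
    have h2 := h.norm_lt (-W, m (W, Y)) (hmem' (by rwa [norm_neg]) hm)
    rwa [h1] at h2
  let S : Set E := Metric.ball 0 (4 * ρ)
  have hinj : InjOn (fun Y => m (W, Y)) S := by
    intro Y hY Z hZ he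
    simp only at he
    have h1 := h.neg_left _ (hmem hW (mem_ball_zero_iff.1 hY))
    have h2 := h.neg_left _ (hmem hW (mem_ball_zero_iff.1 hZ))
    simp only [he] at h1
    exact h1.symm.trans h2
  have hder : ∀ Y ∈ S, HasFDerivWithinAt (fun Y => m (W, Y))
      ((fderiv ℝ m (W, Y)).comp (.inr ℝ E E)) S Y := fun Y _ =>
    (HasFDerivAt.comp Y ((h.contDiff.differentiable (by simp)) (W, Y)).hasFDerivAt
      (hasFDerivAt_prodMk_right W Y)).hasFDerivWithinAt
  have hcv := integral_image_eq_integral_abs_det_fderiv_smul volume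
    (Metric.isOpen_ball.measurableSet : MeasurableSet S) hder hinj Ψ
  have h1 : ∫ Y in (fun Y => m (W, Y)) '' S, Ψ Y = ∫ Y, Ψ Y := by
    refine setIntegral_eq_integral_of_forall_compl_eq_zero fun Y hY => ?_
    refine hΨ Y (not_lt.1 fun hlt => hY ?_)
    have hnW : ‖-W‖ < ρ := by rwa [norm_neg]
    refine ⟨m (-W, Y), ?_, ?_⟩
    · have := h.norm_lt _ (hmem' hnW hlt)
      exact mem_ball_zero_iff.2 (by linarith)
    · have := h.neg_left _ (hmem (Y := Y) hnW (by linarith))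
      simpa using this
  rw [← h1, hcv, ← integral_indicator Metric.isOpen_ball.measurableSet]
  refine integral_congr_ae (Eventually.of_forall fun Y => ?_)
  simp only
  by_cases hY : ‖Y‖ < 4 * ρ
  · rw [indicator_of_mem (mem_ball_zero_iff.2 hY), abs_of_pos (h.det_pos _ (hmem hW hY)),
      Complex.real_smul]
    by_cases hm : ‖m (W, Y)‖ < ρ
    · rw [hχ1 Y (hsmall Y hY hm), one_mul]
    · rw [hΨ _ (not_lt.1 hm), mul_zero, mul_zero]
  · rw [indicator_of_notMem (fun hmem => hY (mem_ball_zero_iff.1 hmem)), hχ0 Y (not_lt.1 hY),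
      zero_mul, Complex.ofReal_zero, zero_mul]

end LocalMultiplication

/-! ### Stabilizers, fiber representations and condition U in scalar form -/

section Stabilizer

variable {E : Type*} [NormedAddCommGroup E] [InnerProductSpace ℝ E] [FiniteDimensional ℝ E]
  {G : Type*} [TopologicalSpace G] [ChartedSpace E G] [Group G] [LieGroup 𝓘(ℝ, E) ∞ G] [T2Space G]
  {H : Subgroup G}

theorem mem_stab_iff {g k : G} : k ∈ stab H g ↔ g⁻¹ * k * g ∈ H := by
  rw [MulAction.mem_stabilizer_iff, MulAction.Quotient.smul_coe, smul_eq_mul, eq_comm,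
    QuotientGroup.eq, mul_assoc]

theorem isClosed_stab (E : Type*) [NormedAddCommGroup E] [InnerProductSpace ℝ E]
    [FiniteDimensional ℝ E] {G : Type*} [TopologicalSpace G] [ChartedSpace E G] [Group G]
    [LieGroup 𝓘(ℝ, E) ∞ G] [T2Space G] {H : Subgroup G}
    (hH : IsClosed (H : Set G)) (g : G) : IsClosed (stab H g : Set G) := by
  have : IsTopologicalGroup G := topologicalGroup_of_lieGroup 𝓘(ℝ, E) ∞
  have h : (stab H g : Set G) = (fun k => g⁻¹ * k * g) ⁻¹' (H : Set G) := by
    ext k; exact mem_stab_iff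
  rw [h]
  exact hH.preimage (by fun_prop)

theorem mem_lieAlg_stab_iff (hH : IsClosed (H : Set G)) {g : G} {Y : E} :
    Y ∈ lieAlg E (stab H g) ↔ lieAd g⁻¹ Y ∈ lieAlg E H := by
  rw [mem_lieAlg_iff (isClosed_stab E hH g), mem_lieAlg_iff hH]
  refine forall_congr' fun t => ?_
  rw [mem_stab_iff, ← map_smul, lieExp_conj, inv_inv]

/-- The adjoint representation by linear automorphisms. -/
noncomputable def lieAdEquiv (g : G) : E ≃ₗ[ℝ] E :=
  LinearEquiv.ofLinearMap (lieAd g : E →L[ℝ] E).toLinearMap (lieAd g⁻¹ : E →L[ℝ] E).toLinearMap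
    (by
      ext Y
      have := lieAd_cancel (E := E) g⁻¹ Y
      rw [inv_inv] at this
      simp [this])
    (by
      ext Y
      simp [lieAd_cancel])

theorem map_lieAlg_stab (hH : IsClosed (H : Set G)) (g : G) :
    (lieAlg E (stab H g)).map (lieAdEquiv g⁻¹ : E ≃ₗ[ℝ] E).toLinearMap = lieAlg E H := by
  ext Y
  constructor
  · rintro ⟨Z, hZ, rfl⟩
    exact (mem_lieAlg_stab_iff hH).1 hZ
  · intro hY
    have h := lieAd_cancel (E := E) g Y
    exact ⟨lieAd g Y, (mem_lieAlg_stab_iff hH).2 (by rwa [h]), h⟩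

/-- Ad(g⁻¹) carries 𝔤_x to 𝔥 and conjugates the isotropy action at gH into that at the base point,
so the determinants agree. -/
theorem isotropyModulus_stab (hH : IsClosed (H : Set G)) (g : G) (k : stab H g) :
    isotropyModulus E (stab H g) k = isotropyModulus E H (conjHom H g k) := by
  let e : TangentQuot E (stab H g) ≃ₗ[ℝ] TangentQuot E H :=
    Submodule.Quotient.equiv _ _ (lieAdEquiv g⁻¹) (map_lieAlg_stab hH g)
  rw [isotropyModulus, isotropyModulus,
    ← LinearMap.det_conj (isotropy (E := E) (stab H g) k :
      TangentQuot E (stab H g) →ₗ[ℝ] TangentQuot E (stab H g)) e]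
  congr 2
  rw [← LinearMap.comp_assoc, LinearEquiv.comp_toLinearMap_symm_eq]
  refine Submodule.linearMap_qext _ (LinearMap.ext fun Y => ?_)
  change (Submodule.Quotient.mk (lieAd g⁻¹ (lieAd (k : G) Y)) : TangentQuot E H) =
    Submodule.Quotient.mk (lieAd (g⁻¹ * k * g) (lieAd g⁻¹ Y))
  congr 1
  rw [← ContinuousLinearMap.comp_apply, ← ContinuousLinearMap.comp_apply, ← lieAd_mul,
    ← lieAd_mul]
  simp [mul_assoc]

variable (E) in
theorem continuous_isotropyModulus [SecondCountableTopology G] (hH : IsClosed (H : Set G)) :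
    Continuous (isotropyModulus E H) := by
  have : IsTopologicalGroup G := topologicalGroup_of_lieGroup 𝓘(ℝ, E) ∞
  have : LocallyCompactSpace G := Manifold.locallyCompact_of_finiteDimensional 𝓘(ℝ, E)
  have : LocallyCompactSpace H := hH.isClosedEmbedding_subtypeVal.locallyCompactSpace
  have : SecondCountableTopology H :=
    TopologicalSpace.Subtype.secondCountableTopology (H : Set G)
  borelize E
  have h : isotropyModulus E H = fun k : H =>
      (Measure.modularCharacterFun (k : G) : ℝ) / Measure.modularCharacterFun k :=
    funext fun k => abs_det_isotropy hH k
  rw [h]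
  have h1 : Continuous fun k : H => (Measure.modularCharacterFun (k : G) : ℝ) :=
    NNReal.continuous_coe.comp (continuous_modularCharacterFun.comp continuous_subtype_val)
  have h2 : Continuous fun k : H => (Measure.modularCharacterFun k : ℝ) :=
    NNReal.continuous_coe.comp continuous_modularCharacterFun
  exact h1.div h2 fun k => (NNReal.coe_pos.2 (Measure.modularCharacterFun_pos k)).ne'

theorem continuous_subExp (hH : IsClosed (H : Set G)) :
    Continuous (subExp H : lieAlg E H → H) := by
  refine continuous_induced_rng.2 ?_
  refine Continuous.congr (f := fun Y : lieAlg E H => (lieExp (Y : E) : G)) ?_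
    fun Y => (subExp_coe hH Y).symm
  exact (continuous_lieExp E G).comp continuous_subtype_val

variable {V : Type*} [NormedAddCommGroup V] [InnerProductSpace ℂ V]

/-- Strong continuity upgrades to joint continuity because all the operators are 1-Lipschitz. -/
theorem UnitaryRep.continuous_apply {K : Type*} [Group K] [TopologicalSpace K]
    (τ : UnitaryRep K V) : Continuous fun p : K × V => τ.hom p.1 p.2 :=
  continuous_prod_of_continuous_lipschitzWith' _ 1 (fun k => (τ.hom k).isometry.lipschitz)
    τ.continuous_hom

variable (E) in
/-- The matrix coefficients of the representation `τ_x ⊗ σ_x` of the stabilizer of `x = g H` in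
terms of a unit density. -/
noncomputable def fiberCoeff (H : Subgroup G) (τ : UnitaryRep H V) (g : G) (v₁ v₂ : V)
    (k : stab H g) : ℂ :=
  inner ℂ v₂ ((fiberRep E H τ g).hom k v₁) *
    ((isotropyModulus E (stab H g) k⁻¹ ^ (1 / 2 : ℝ) : ℝ) : ℂ)

theorem norm_fiberCoeff_le (τ : UnitaryRep H V) (g : G) (v₁ v₂ : V) (k : stab H g) :
    ‖fiberCoeff E H τ g v₁ v₂ k‖ ≤
      ‖v₁‖ * ‖v₂‖ * isotropyModulus E (stab H g) k⁻¹ ^ (1 / 2 : ℝ) := by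
  have h0 : 0 ≤ isotropyModulus E (stab H g) k⁻¹ := abs_nonneg _
  rw [fiberCoeff, norm_mul, Complex.norm_real, Real.norm_of_nonneg (Real.rpow_nonneg h0 _)]
  gcongr
  refine (norm_inner_le_norm _ _).trans ?_
  rw [((fiberRep E H τ g).hom k).norm_map, mul_comm]

theorem continuous_fiberCoeff [SecondCountableTopology G] (hH : IsClosed (H : Set G))
    (τ : UnitaryRep H V) (g : G) : Continuous fun p : lieAlg E (stab H g) × V × V =>
      fiberCoeff E H τ g p.2.1 p.2.2 (subExp (stab H g) p.1) := by
  have : IsTopologicalGroup G := topologicalGroup_of_lieGroup 𝓘(ℝ, E) ∞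
  have hK := isClosed_stab E hH g
  have h1 : Continuous fun p : lieAlg E (stab H g) × V × V => subExp (stab H g) p.1 :=
    (continuous_subExp hK).comp continuous_fst
  have h2 : Continuous fun p : lieAlg E (stab H g) × V × V =>
      (fiberRep E H τ g).hom (subExp (stab H g) p.1) p.2.1 :=
    (fiberRep E H τ g).continuous_apply.comp (h1.prodMk (continuous_fst.comp continuous_snd))
  have h3 : Continuous fun p : lieAlg E (stab H g) × V × V =>
      isotropyModulus E (stab H g) (subExp (stab H g) p.1)⁻¹ ^ (1 / 2 : ℝ) :=
    ((continuous_isotropyModulus E hK).comp h1.inv).rpow_const fun _ => Or.inr (by norm_num)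
  exact ((continuous_snd.comp continuous_snd).inner h2).mul (Complex.continuous_ofReal.comp h3)

/-- The density with coefficient `1` at the frame `b`. -/
noncomputable def Density.unit (α : ℝ) {W : Type*} [AddCommGroup W] [Module ℝ W] (b : Frame W) :
    Density α W ℂ where
  coeff b' := ((|b.det b'| ^ α : ℝ) : ℂ)
  coeff_change b₁ b₂ := by
    have h : b.det b₂ = b.det b₁ * b₁.det b₂ := by
      rw [Module.Basis.det_apply, Module.Basis.det_apply, Module.Basis.det_apply, ← Matrix.det_mul,
        Module.Basis.toMatrix_mul_toMatrix]
    rw [h, abs_mul, Real.mul_rpow (abs_nonneg _) (abs_nonneg _), smul_eq_mul,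
      ← Complex.ofReal_mul, mul_comm]

theorem Density.unit_coeff (α : ℝ) {W : Type*} [AddCommGroup W] [Module ℝ W] (b : Frame W) :
    (Density.unit α b).coeff b = 1 := by
  simp [Density.unit, b.det_self]

variable [MeasurableSpace E] [BorelSpace E]

/-- Condition U tested on the half density with coefficient 1 in a frame. The frequencies tξ with ξ
in Ω become a cone around tη. Its aperture 2r leaves room for ζ in the ball of radius r and a margin
r for the nonstationary region. -/
theorem WavefrontConditionU.exists_bounds {τ : UnitaryRep H V} (hU : WavefrontConditionU E H τ)
    {η : StrongDual ℝ E} (hη : η ∉ inducedSet H (subgroupWF E H τ)) :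
    ∃ r > 0, ∃ U ∈ 𝓝 (0 : E),
      (∀ φ : E → ℂ, ContDiff ℝ ∞ φ → HasCompactSupport φ → tsupport φ ⊆ U →
        ∀ N : ℕ, ∃ C, 0 ≤ C ∧ ∀ t : ℝ, 0 < t → ∀ ξ : StrongDual ℝ E, ‖ξ - t • η‖ < 2 * r * t →
          ∀ (g : G) (v₁ v₂ : V),
          ‖∫ Y : lieAlg E (stab H g), fiberCoeff E H τ g v₁ v₂ (subExp (stab H g) Y) * φ (Y : E) *
              Complex.exp (Complex.I * ((ξ (Y : E) : ℝ) : ℂ))‖ ≤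
            C * (‖v₁‖ * ‖v₂‖) * (t ^ N)⁻¹) ∧
      ∃ C, 0 ≤ C ∧ ∀ (g : G) (Y : lieAlg E (stab H g)), (Y : E) ∈ U →
        isotropyModulus E (stab H g) (subExp (stab H g) Y)⁻¹ ^ (1 / 2 : ℝ) ≤ C := by
  obtain ⟨Ω, hΩ, -, U, hU0, h1, C, h2⟩ := hU η hη
  obtain ⟨ε, hε, hεΩ⟩ := Metric.mem_nhds_iff.1 hΩ
  refine ⟨ε / 2, by positivity, U, hU0, fun φ hφ hφc hφU N => ?_, |C|, abs_nonneg C,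
    fun g Y hY => ?_⟩
  · obtain ⟨C, hC⟩ := h1 φ hφ hφc hφU N
    refine ⟨|C|, abs_nonneg C, fun t ht ξ hξ g v₁ v₂ => ?_⟩
    have hmem : t⁻¹ • ξ ∈ Ω := by
      refine hεΩ ?_
      rw [Metric.mem_ball, dist_eq_norm]
      have e : ξ - t • η = t • (t⁻¹ • ξ - η) := by
        rw [smul_sub t (t⁻¹ • ξ) η, smul_inv_smul₀ ht.ne']
      rw [e, norm_smul, Real.norm_of_nonneg ht.le] at hξ
      refine lt_of_mul_lt_mul_left (hξ.trans_eq ?_) ht.le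
      ring
    let b : Frame (TangentQuot E (stab H g)) := Module.finBasis ℝ _
    have h := hC t ht _ hmem g v₁ v₂ (Density.unit _ b) (Density.unit _ b) b
    rw [Density.unit_coeff, norm_one, mul_one, mul_one] at h
    refine (le_of_eq_of_le ?_ h).trans (by gcongr; exact le_abs_self C)
    congr 1
    refine integral_congr_ae (Eventually.of_forall fun Y => ?_)
    simp only [fiberCoeff, Density.pair, halfDensityRep, Density.map_isotropy_coeff,
      Density.unit_coeff, smul_eq_mul, mul_one, RCLike.inner_apply, map_one]
    congr 2
    rw [mul_assoc, ← Complex.ofReal_mul, _root_.smul_apply, smul_eq_mul,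
      mul_inv_cancel_left₀ ht.ne']
  · let b : Frame (TangentQuot E (stab H g)) := Module.finBasis ℝ _
    have h := h2 g Y hY (Density.unit _ b) b
    rw [halfDensityRep, Density.map_isotropy_coeff, Density.unit_coeff, smul_eq_mul, mul_one,
      norm_one, mul_one, Complex.norm_real] at h
    exact (le_abs_self _).trans (h.trans (le_abs_self C))

variable [SecondCountableTopology G] [MeasurableSpace G] [BorelSpace G]
  {hH : IsClosed (H : Set G)} {τ : UnitaryRep H V} {F : G → Density (1 / 2) (TangentQuot E H) V}

/-- Here e^{-Z} g = e^{-Y} g · (g⁻¹ e^{-W} g) with the last factor in H, so equivariance of F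
applies. This is how the fiber representations of condition U enter the coefficients of the induced
representation. -/
theorem IsL2Section.inner_coeff_mul (hF : IsL2Section H hH τ F) (b : Frame (TangentQuot E H))
    (g : G) (W : lieAlg E (stab H g)) {Y Z : E} (hZ : (lieExp Z : G) = lieExp (W : E) * lieExp Y)
    (v : V) :
    inner ℂ v ((F ((lieExp Z)⁻¹ * g)).coeff b) =
      fiberCoeff E H τ g ((F ((lieExp Y)⁻¹ * g)).coeff b) v (subExp (stab H g) W) := by
  set k := subExp (stab H g) W
  have hk : (k : G) = lieExp (W : E) := subExp_coe (isClosed_stab E hH g) W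
  have h1 : (lieExp Z : G)⁻¹ * g = (lieExp Y)⁻¹ * g * (conjHom H g k⁻¹ : H) := by
    have : ((conjHom H g k⁻¹ : H) : G) = g⁻¹ * (k : G)⁻¹ * g := rfl
    rw [this, hZ, hk]
    simp [mul_assoc]
  rw [h1, hF.coeff_mul, inner_smul_right, ← isotropyModulus_stab hH, ← map_inv, inv_inv, fiberCoeff,
    mul_comm]
  rfl

end Stabilizer

/-! ### The estimate for one point of the base, uniform in that point -/

section SliceBound

variable {E : Type*} [NormedAddCommGroup E] [InnerProductSpace ℝ E] [FiniteDimensional ℝ E]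
  [MeasurableSpace E] [BorelSpace E]
  {G : Type*} [TopologicalSpace G] [ChartedSpace E G] [Group G] [LieGroup 𝓘(ℝ, E) ∞ G] [T2Space G]
  [SecondCountableTopology G] [MeasurableSpace G] [BorelSpace G]
  {H : Subgroup G} {hH : IsClosed (H : Set G)}
  {V : Type*} [NormedAddCommGroup V] [InnerProductSpace ℂ V] {τ : UnitaryRep H V}

/-- With `exists_volume_ball_bounds` this bounds the mass of α on every stabilizer algebra, from
above for the L¹ norm of f and from below for dividing by the mass. -/
theorem integral_bump_mul_bounds {w : Submodule ℝ E} (α : ContDiffBump (0 : E)) :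
    Integrable (fun W : w => α (W : E)) ∧
      (volume (Metric.ball (0 : w) α.rIn)).toReal ≤ ∫ W : w, α (W : E) ∧
      ∫ W : w, α (W : E) ≤ (volume (Metric.ball (0 : w) α.rOut)).toReal := by
  have hc : Continuous fun W : w => α (W : E) := α.continuous.comp continuous_subtype_val
  have h0 : ∀ W : w, W ∉ Metric.ball (0 : w) α.rOut → α (W : E) = 0 := fun W hW => by
    refine α.zero_of_le_dist ?_
    rw [dist_zero_right]
    exact not_lt.1 fun h => hW (mem_ball_zero_iff.2 h)
  have hi : Integrable fun W : w => α (W : E) :=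
    hc.integrable_of_hasCompactSupport (HasCompactSupport.intro (isCompact_closedBall 0 α.rOut)
      fun W hW => h0 W fun h => hW (Metric.ball_subset_closedBall h))
  refine ⟨hi, ?_, ?_⟩
  · calc (volume (Metric.ball (0 : w) α.rIn)).toReal
        = ∫ W in Metric.ball (0 : w) α.rIn, (1 : ℝ) := by simp [measureReal_def]
      _ = ∫ W in Metric.ball (0 : w) α.rIn, α (W : E) := by
          refine setIntegral_congr_fun Metric.isOpen_ball.measurableSet fun W hW => ?_
          refine (α.one_of_mem_closedBall ?_).symm
          rw [mem_closedBall_zero_iff]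
          exact (mem_ball_zero_iff.1 hW).le
      _ ≤ _ := setIntegral_le_integral hi (Eventually.of_forall fun W => α.nonneg)
  · calc ∫ W : w, α (W : E) = ∫ W in Metric.ball (0 : w) α.rOut, α (W : E) :=
          (setIntegral_eq_integral_of_forall_compl_eq_zero h0).symm
      _ ≤ ∫ W in Metric.ball (0 : w) α.rOut, (1 : ℝ) :=
          setIntegral_mono hi.integrableOn (integrableOn_const measure_ball_lt_top.ne)
            fun W => α.le_one
      _ = _ := by simp [measureReal_def]

/-- If `α (W) I` is an integral over `Y` for all `W` in a subspace, `I` can be estimated by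
exchanging the order of integration. -/
theorem integral_mul_norm_le_of_average {w : Submodule ℝ E} {α : w → ℝ} (hα : Integrable α)
    (hα0 : ∀ W, 0 ≤ α W) {f : V → w → ℂ} (hf : Continuous fun p : w × V => f p.2 p.1) {K : ℝ}
    (hfle : ∀ x W, ‖f x W‖ ≤ K * ‖x‖ * α W) {u : E → V} (hu : Integrable u) {a : E × E → ℂ}
    (ha : Continuous a) {Ca : ℝ} (hCa : ∀ p, ‖a p‖ ≤ Ca) {I : ℂ} {D : ℝ}
    (hD : ∀ Y, ‖∫ W, f (u Y) W * a ((W : E), Y)‖ ≤ D * ‖u Y‖)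
    (hI : ∀ W : w, ((α W : ℝ) : ℂ) * I = ∫ Y, f (u Y) W * a ((W : E), Y)) :
    (∫ W, α W) * ‖I‖ ≤ D * ∫ Y, ‖u Y‖ := by
  have hi : Integrable (fun p : w × E => f (u p.2) p.1 * a ((p.1 : E), p.2))
      (volume.prod volume) := by
    refine ((hα.mul_prod hu.norm).const_mul (K * Ca)).mono' ?_ (Eventually.of_forall fun p => ?_)
    · have h1 : AEStronglyMeasurable (fun p : w × E => (p.1, u p.2)) (volume.prod volume) :=
        aestronglyMeasurable_id.comp_fst.prodMk hu.aestronglyMeasurable.comp_snd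
      have h2 : Continuous fun p : w × E => ((p.1 : E), p.2) := by fun_prop
      exact (hf.comp_aestronglyMeasurable h1).mul (ha.comp h2).aestronglyMeasurable
    · have h0 : 0 ≤ K * ‖u p.2‖ * α p.1 := (norm_nonneg _).trans (hfle _ _)
      rw [norm_mul]
      calc ‖f (u p.2) p.1‖ * ‖a ((p.1 : E), p.2)‖ ≤ (K * ‖u p.2‖ * α p.1) * Ca := by
            gcongr
            · exact hfle _ _
            · exact hCa _
        _ = _ := by ring
  have h1 : ((∫ W, α W : ℝ) : ℂ) * I = ∫ Y, ∫ W, f (u Y) W * a ((W : E), Y) := by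
    rw [← integral_integral_swap hi, ← integral_complex_ofReal, ← integral_mul_const]
    exact integral_congr_ae (Eventually.of_forall hI)
  have h2 : (∫ W, α W) * ‖I‖ = ‖∫ Y, ∫ W, f (u Y) W * a ((W : E), Y)‖ := by
    rw [← h1, norm_mul, Complex.norm_real, Real.norm_of_nonneg (integral_nonneg hα0)]
  rw [h2, ← integral_const_mul]
  exact norm_integral_le_of_norm_le (hu.norm.const_mul D) (Eventually.of_forall hD)

/-- The contribution of one point `g` to the Fourier transform of a matrix coefficient. -/
theorem WavefrontConditionU.exists_slice_bound (hH : IsClosed (H : Set G))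
    (hU : WavefrontConditionU E H τ) {η : StrongDual ℝ E}
    (hη : η ∉ inducedSet H (subgroupWF E H τ)) :
    ∃ r > 0, ∃ ρ > 0, ∀ φ : E → ℂ, ContDiff ℝ ∞ φ → (∀ Y, ρ ≤ ‖Y‖ → φ Y = 0) → ∀ N : ℕ,
      ∃ C, 0 ≤ C ∧ ∀ F : G → Density (1 / 2) (TangentQuot E H) V, IsL2Section H hH τ F →
        ∀ (b : Frame (TangentQuot E H)) (v : V) (g : G),
        IntegrableOn (fun Y : E => (F ((lieExp Y)⁻¹ * g)).coeff b) (Metric.ball 0 (4 * ρ)) →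
        ∀ t : ℝ, 0 < t → ∀ ζ ∈ Metric.ball η r,
        ‖∫ Y : E, inner ℂ v ((F ((lieExp Y)⁻¹ * g)).coeff b) * φ Y *
            Complex.exp (Complex.I * t * ζ Y)‖ ≤
          C * (‖v‖ * ∫ Y in Metric.ball (0 : E) (4 * ρ), ‖(F ((lieExp Y)⁻¹ * g)).coeff b‖) *
            (t ^ N)⁻¹ := by
  obtain ⟨r, hr, U, hU0, h1, Cs, hCs0, hCs⟩ := hU.exists_bounds hη
  -- Chosen so that δ(‖η‖ + r) < r, the smallness needed for nonstationarity off the cone.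
  let δ : ℝ := r / (‖η‖ + r + 1)
  have hδ0 : 0 < δ := by positivity
  have hδr : δ * (‖η‖ + r) < r := by
    rw [div_mul_eq_mul_div, div_lt_iff₀ (by positivity)]
    nlinarith
  obtain ⟨m, ρ, hm, hρU⟩ := exists_isLocalMul G hδ0 hU0
  have hρ := hm.pos
  refine ⟨r, hr, ρ, hρ, fun φ hφ hφ0 N => ?_⟩
  -- α is the averaging weight on 𝔤_x. χ₁ equals 1 where α ≠ 0, so it only makes the amplitude
  -- compactly supported in W. χ₂ is the cutoff in Y for the substitution by m(W, ·).
  let α : ContDiffBump (0 : E) := ⟨ρ / 4, ρ / 2, by positivity, by linarith⟩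
  let χ₁ : ContDiffBump (0 : E) := ⟨ρ, 2 * ρ, by positivity, by linarith⟩
  let χ₂ : ContDiffBump (0 : E) := ⟨3 * ρ, 4 * ρ, by positivity, by linarith⟩
  let J : E × E → ℝ := fun p => ((fderiv ℝ m p).comp (.inr ℝ E E)).det
  have hJ : ContDiff ℝ ∞ J := contDiff_det.comp
    ((hm.contDiff.fderiv_right (m := ∞) (by simp)).clm_comp contDiff_const)
  let a : E × E → ℂ := fun p => ((χ₁ p.1 * χ₂ p.2 * J p : ℝ) : ℂ) * φ (m p)
  have ha : ContDiff ℝ ∞ a := (Complex.ofRealCLM.contDiff.comp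
    (((χ₁.contDiff.comp contDiff_fst).mul (χ₂.contDiff.comp contDiff_snd)).mul hJ)).mul
      (hφ.comp hm.contDiff)
  have hat : tsupport a ⊆
      Metric.closedBall (0 : E) (2 * ρ) ×ˢ Metric.closedBall (0 : E) (4 * ρ) := by
    refine closure_minimal (fun p hp => ?_)
      (Metric.isClosed_closedBall.prod Metric.isClosed_closedBall)
    by_contra hc
    refine hp ?_
    rw [mem_prod, not_and_or, mem_closedBall_zero_iff, mem_closedBall_zero_iff, not_le,
      not_le] at hc
    rcases hc with hc | hc
    · have : χ₁ p.1 = 0 := χ₁.zero_of_le_dist (by rw [dist_zero_right]; exact hc.le)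
      simp [a, this]
    · have : χ₂ p.2 = 0 := χ₂.zero_of_le_dist (by rw [dist_zero_right]; exact hc.le)
      simp [a, this]
  have hac : HasCompactSupport a := ((isCompact_closedBall _ _).prod
    (isCompact_closedBall _ _)).of_isClosed_subset (isClosed_tsupport _) hat
  have hmem : ∀ {W Y : E}, ‖W‖ < 6 * ρ → ‖Y‖ < 6 * ρ →
      (W, Y) ∈ Metric.ball (0 : E × E) (6 * ρ) := by
    intro W Y hW hY
    rw [mem_ball_zero_iff, Prod.norm_def, sup_lt_iff]
    exact ⟨hW, hY⟩
  have hδa : ∀ p ∈ tsupport a, ∀ v, ‖fderiv ℝ m p (v, 0) - v‖ ≤ δ * ‖v‖ := by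
    rintro ⟨W, Y⟩ hp
    obtain ⟨hW, hY⟩ := hat hp
    rw [mem_closedBall_zero_iff] at hW hY
    exact hm.fderiv_left _ (hmem (by linarith) (by linarith))
  obtain ⟨Ca, hCa⟩ := ha.continuous.bounded_above_of_compact_support hac
  have hαU : tsupport (fun Y => ((α Y : ℝ) : ℂ)) ⊆ U := by
    refine subset_trans (closure_minimal (fun Y hY => ?_) Metric.isClosed_closedBall)
      ((Metric.closedBall_subset_ball (by linarith : ρ / 2 < ρ)).trans hρU)
    by_contra hc
    refine hY ?_
    have : α Y = 0 := α.zero_of_le_dist (not_le.1 fun h => hc (Metric.mem_closedBall.2 h)).le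
    simp [this]
  obtain ⟨A, hA0, hA⟩ := h1 (fun Y => ((α Y : ℝ) : ℂ))
    (Complex.ofRealCLM.contDiff.comp α.contDiff)
    (α.hasCompactSupport.comp_left Complex.ofReal_zero) hαU (N + (Module.finrank ℝ E + 1))
  obtain ⟨_, Cv, -, hCv⟩ := exists_volume_ball_bounds E (ρ := ρ / 2) (by positivity)
  obtain ⟨cv, _, hcv0, hcv⟩ := exists_volume_ball_bounds E (ρ := ρ / 4) (by positivity)
  have hCv0 : 0 ≤ Cv := ENNReal.toReal_nonneg.trans (hCv ⊥).2
  obtain ⟨C, hC0, hC⟩ := exists_oscillatory_bound hm.contDiff ha hac hδa hr hδ0 hδr N hA0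
    (B := Cs * Cv) (by positivity)
  refine ⟨C / cv, by positivity, fun F hF b v g hint t ht ζ hζ => ?_⟩
  -- Truncation makes u globally integrable for Fubini; the amplitude vanishes outside this ball
  -- anyway.
  let u : E → V := (Metric.ball (0 : E) (4 * ρ)).indicator fun Y => (F ((lieExp Y)⁻¹ * g)).coeff b
  have hu : Integrable u := hint.integrable_indicator Metric.isOpen_ball.measurableSet
  have hun : ∫ Y, ‖u Y‖ =
      ∫ Y in Metric.ball (0 : E) (4 * ρ), ‖(F ((lieExp Y)⁻¹ * g)).coeff b‖ := by
    rw [← integral_indicator Metric.isOpen_ball.measurableSet]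
    simp only [u, norm_indicator_eq_indicator_norm]
  let w := lieAlg E (stab H g)
  obtain ⟨hαi, hαl, hαu⟩ := integral_bump_mul_bounds (w := w) α
  have hα0 : ∀ W : w, α (W : E) ≠ 0 → ‖(W : E)‖ < ρ / 2 := fun W hW => by
    by_contra h
    exact hW (α.zero_of_le_dist (by rw [dist_zero_right]; exact not_lt.1 h))
  let f : V → w → ℂ := fun x W =>
    fiberCoeff E H τ g x v (subExp (stab H g) W) * ((α (W : E) : ℝ) : ℂ)
  have hfle : ∀ x W, ‖f x W‖ ≤ ‖v‖ * Cs * ‖x‖ * α (W : E) := by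
    intro x W
    by_cases hW : α (W : E) = 0
    · simp [f, hW]
    · have hWU : (W : E) ∈ U := hρU (mem_ball_zero_iff.2 (by linarith [hα0 W hW]))
      rw [norm_mul, Complex.norm_real, Real.norm_of_nonneg α.nonneg]
      gcongr
      · exact α.nonneg
      · refine (norm_fiberCoeff_le τ g x v _).trans ?_
        calc _ ≤ ‖x‖ * ‖v‖ * Cs := by gcongr; exact hCs g W hWU
          _ = _ := by ring
  have hcf : Continuous fun p : w × V => f p.2 p.1 :=
    ((continuous_fiberCoeff hH τ g).comp
      (continuous_fst.prodMk (continuous_snd.prodMk continuous_const))).mul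
      (Complex.continuous_ofReal.comp (α.continuous.comp
        (continuous_subtype_val.comp continuous_fst)))
  have hfi : ∀ x, Integrable (f x) := fun x =>
    (hαi.const_mul (‖v‖ * Cs * ‖x‖)).mono'
      (hcf.comp (Continuous.prodMk_left x)).aestronglyMeasurable
      (Eventually.of_forall (hfle x))
  have hfn : ∀ x, ∫ W, ‖f x W‖ ≤ Cs * Cv * (‖x‖ * ‖v‖) := fun x => by
    refine (integral_mono (hfi x).norm (hαi.const_mul (‖v‖ * Cs * ‖x‖)) (hfle x)).trans ?_
    rw [integral_const_mul]
    calc ‖v‖ * Cs * ‖x‖ * ∫ W : w, α (W : E) ≤ ‖v‖ * Cs * ‖x‖ * Cv := by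
          gcongr; exact hαu.trans (hCv w).2
      _ = _ := by ring
  let a' : E × E → ℂ := fun p => a p * Complex.exp (Complex.I * ((t * ζ (m p) : ℝ) : ℂ))
  have ha' : Continuous a' := ha.continuous.mul (Complex.continuous_exp.comp
    (continuous_const.mul (Complex.continuous_ofReal.comp (continuous_const.mul
      (ζ.continuous.comp hm.contDiff.continuous)))))
  have hCa' : ∀ p, ‖a' p‖ ≤ Ca := fun p => by
    rw [norm_mul, Complex.norm_exp_I_mul_ofReal, mul_one]
    exact hCa p
  have hD : ∀ Y, ‖∫ W, f (u Y) W * a' ((W : E), Y)‖ ≤ C * ‖v‖ * (t ^ N)⁻¹ * ‖u Y‖ := fun Y =>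
    (hC w (f (u Y)) (hfi _) (‖u Y‖ * ‖v‖) (by positivity) (hfn _) t ht
      (fun ξ hξ => hA t ht ξ hξ g (u Y) v) ζ hζ Y).trans_eq (by ring)
  let Ψ : E → ℂ := fun Y => inner ℂ v ((F ((lieExp Y)⁻¹ * g)).coeff b) * φ Y *
    Complex.exp (Complex.I * t * ζ Y)
  change ‖∫ Y, Ψ Y‖ ≤ _
  have hΨ0 : ∀ Y, ρ ≤ ‖Y‖ → Ψ Y = 0 := fun Y hY => by simp [Ψ, hφ0 Y hY]
  -- Wherever α(W) ≠ 0, substitute m(W, Y) for Y. The Jacobian is absorbed in a, and equivariance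
  -- turns the section at the new point into a fiber coefficient at W.
  have key : ∀ W : w, ((α (W : E) : ℝ) : ℂ) * ∫ Y, Ψ Y = ∫ Y, f (u Y) W * a' ((W : E), Y) := by
    intro W
    by_cases hW : α (W : E) = 0
    · simp [f, hW]
    · have hWn := hα0 W hW
      rw [hm.integral_eq (by linarith) hΨ0 (χ := χ₂) (fun Y hY => χ₂.one_of_mem_closedBall
          (mem_closedBall_zero_iff.2 hY.le)) (fun Y hY => χ₂.zero_of_le_dist (by
          rwa [dist_zero_right])), ← integral_const_mul]
      refine integral_congr_ae (Eventually.of_forall fun Y => ?_)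
      simp only
      by_cases hY : ‖Y‖ < 4 * ρ
      · have hχ : χ₁ (W : E) = 1 := χ₁.one_of_mem_closedBall
          (mem_closedBall_zero_iff.2 (by simp only [χ₁]; linarith))
        have huY : u Y = (F ((lieExp Y)⁻¹ * g)).coeff b :=
          indicator_of_mem (mem_ball_zero_iff.2 hY) _
        simp only [Ψ, f, a', a, J]
        rw [hF.inner_coeff_mul b g W (hm.lieExp_eq _ (hmem (by linarith) (by linarith))) v, huY, hχ]
        push_cast
        ring_nf
      · have hχ : χ₂ Y = 0 := χ₂.zero_of_le_dist (by rw [dist_zero_right]; exact not_lt.1 hY)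
        simp [a', a, hχ]
  have hpos : cv ≤ ∫ W : w, α (W : E) := (hcv w).1.trans hαl
  have hle : (∫ W : w, α (W : E)) * ‖∫ Y, Ψ Y‖ ≤ C * ‖v‖ * (t ^ N)⁻¹ * ∫ Y, ‖u Y‖ :=
    integral_mul_norm_le_of_average hαi (fun _ => α.nonneg) hcf hfle hu ha' hCa' hD key
  rw [← hun]
  have h3 : cv * ‖∫ Y, Ψ Y‖ ≤ C * ‖v‖ * (t ^ N)⁻¹ * ∫ Y, ‖u Y‖ :=
    (by gcongr : cv * ‖∫ Y, Ψ Y‖ ≤ (∫ W : w, α (W : E)) * ‖∫ Y, Ψ Y‖).trans hle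
  calc ‖∫ Y, Ψ Y‖ = cv * ‖∫ Y, Ψ Y‖ / cv := by field_simp
    _ ≤ C * ‖v‖ * (t ^ N)⁻¹ * (∫ Y, ‖u Y‖) / cv := by gcongr
    _ = _ := by ring

end SliceBound

/-! ### Integration over the base and decay of the matrix coefficients -/

section InducedCoefficients

variable {E : Type*} [NormedAddCommGroup E] [InnerProductSpace ℝ E] [FiniteDimensional ℝ E]
  [MeasurableSpace E] [BorelSpace E]
  {G : Type*} [TopologicalSpace G] [ChartedSpace E G] [Group G] [LieGroup 𝓘(ℝ, E) ∞ G] [T2Space G]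
  [SecondCountableTopology G] [MeasurableSpace G] [BorelSpace G]
  {H : Subgroup G} {hH : IsClosed (H : Set G)}
  {V : Type*} [NormedAddCommGroup V] [InnerProductSpace ℂ V] {τ : UnitaryRep H V}

variable (E) in
theorem quotMeasure_absolutelyContinuous (H : Subgroup G) (hH : IsClosed (H : Set G)) :
    quotMeasure E H hH ≪ lieHaar E G := by
  have : IsTopologicalGroup G := topologicalGroup_of_lieGroup 𝓘(ℝ, E) ∞
  have : LocallyCompactSpace G := Manifold.locallyCompact_of_finiteDimensional 𝓘(ℝ, E)
  exact withDensity_absolutelyContinuous _ _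

theorem sigmaFinite_bruhatMeasure {G : Type*} [Group G] [TopologicalSpace G] [IsTopologicalGroup G]
    [LocallyCompactSpace G] [SecondCountableTopology G] [MeasurableSpace G] [BorelSpace G]
    (H : Subgroup G) (hH : IsClosed (H : Set G)) : SigmaFinite (bruhatMeasure H hH) :=
  SigmaFinite.withDensity (bruhat H hH)

instance sigmaFinite_quotMeasure : SigmaFinite (quotMeasure E H hH) :=
  have : IsTopologicalGroup G := topologicalGroup_of_lieGroup 𝓘(ℝ, E) ∞
  have : LocallyCompactSpace G := Manifold.locallyCompact_of_finiteDimensional 𝓘(ℝ, E)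
  sigmaFinite_bruhatMeasure H hH

instance sigmaFinite_lieHaar : SigmaFinite (lieHaar E G) := by
  have : IsTopologicalGroup G := topologicalGroup_of_lieGroup 𝓘(ℝ, E) ∞
  have : LocallyCompactSpace G := Manifold.locallyCompact_of_finiteDimensional 𝓘(ℝ, E)
  exact inferInstanceAs (SigmaFinite (Measure.haar : Measure G))

/-- For fixed Y the map is a left translation, which preserves Haar measure. `quotMeasure` need not
be invariant, so joint measurability of translated sections is derived from Haar measure and then
passed on by absolute continuity. -/
theorem quasiMeasurePreserving_translate (μ : Measure E) [SFinite μ] :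
    Measure.QuasiMeasurePreserving (fun p : G × E => (lieExp p.2 : G)⁻¹ * p.1)
      ((lieHaar E G).prod μ) (lieHaar E G) := by
  have : IsTopologicalGroup G := topologicalGroup_of_lieGroup 𝓘(ℝ, E) ∞
  have : LocallyCompactSpace G := Manifold.locallyCompact_of_finiteDimensional 𝓘(ℝ, E)
  have hc : Continuous fun p : G × E => (lieExp p.2 : G)⁻¹ * p.1 :=
    ((continuous_lieExp E G).comp continuous_snd).inv.mul continuous_fst
  refine QuasiMeasurePreserving.prod_of_left hc.measurable (Eventually.of_forall fun Y => ?_)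
  have h := measurePreserving_mul_left (Measure.haar : Measure G) (lieExp Y)⁻¹
  exact h.quasiMeasurePreserving

variable {F F₁ F₂ : G → Density (1 / 2) (TangentQuot E H) V}

theorem IsL2Section.aestronglyMeasurable_translate (hF : IsL2Section H hH τ F)
    (b : Frame (TangentQuot E H)) (μ : Measure E) [SFinite μ] :
    AEStronglyMeasurable (fun p : G × E => (F ((lieExp p.2)⁻¹ * p.1)).coeff b)
      ((quotMeasure E H hH).prod μ) :=
  ((hF.2 b).1.comp_quasiMeasurePreserving (quasiMeasurePreserving_translate μ)).mono_ac
    ((quotMeasure_absolutelyContinuous E H hH).prod Measure.AbsolutelyContinuous.rfl)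

theorem integrable_sq_of_lintegral {X : Type*} [MeasurableSpace X] {μ : Measure X} {f : X → V}
    (hf : AEStronglyMeasurable f μ) (h : ∫⁻ x, ‖f x‖ₑ ^ 2 ∂μ < ⊤) :
    Integrable (fun x => ‖f x‖ ^ 2) μ := by
  refine ⟨hf.norm.pow 2, ?_⟩
  rw [hasFiniteIntegral_iff_enorm]
  simpa [enorm_pow] using h

theorem IsL2Section.lintegral_lt_top (hF : IsL2Section H hH τ F) (b : Frame (TangentQuot E H)) :
    ∫⁻ g, ‖(F g).coeff b‖ₑ ^ 2 ∂(quotMeasure E H hH) < ⊤ := by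
  have := lintegral_rpow_enorm_lt_top_of_eLpNorm_lt_top two_ne_zero ENNReal.ofNat_ne_top
    (hF.2 b).2.eLpNorm_lt_top
  simpa using this

/-- By Tonelli, the bound of `exists_lintegral_translate_le`, uniform in the translation, is
integrated over a finite measure in Y. -/
theorem IsL2Section.integrable_translate_sq (hF : IsL2Section H hH τ F)
    (b : Frame (TangentQuot E H)) (μ : Measure E) [IsFiniteMeasure μ] :
    Integrable (fun p : G × E => ‖(F ((lieExp p.2)⁻¹ * p.1)).coeff b‖ ^ 2)
      ((quotMeasure E H hH).prod μ) := by
  obtain ⟨c, hc⟩ := exists_lintegral_translate_le E H hH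
  have hm := hF.aestronglyMeasurable_translate b μ
  refine integrable_sq_of_lintegral hm ?_
  rw [lintegral_prod_symm _ (hm.enorm.pow_const 2)]
  refine (lintegral_mono fun Y => hc τ F hF b (lieExp Y)).trans_lt ?_
  rw [lintegral_const]
  exact ENNReal.mul_lt_top (ENNReal.mul_lt_top ENNReal.coe_lt_top (hF.lintegral_lt_top b))
    (measure_lt_top μ _)

theorem IsL2Section.integrable_norm_mul_norm (hF₁ : IsL2Section H hH τ F₁)
    (hF₂ : IsL2Section H hH τ F₂) (b : Frame (TangentQuot E H)) (μ : Measure E)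
    [IsFiniteMeasure μ] :
    Integrable (fun p : G × E => ‖(F₂ p.1).coeff b‖ * ‖(F₁ ((lieExp p.2)⁻¹ * p.1)).coeff b‖)
      ((quotMeasure E H hH).prod μ) := by
  have h2 : Integrable (fun p : G × E => ‖(F₂ p.1).coeff b‖ ^ 2) ((quotMeasure E H hH).prod μ) :=
    (integrable_sq_of_lintegral (hF₂.2 b).2.1 (hF₂.lintegral_lt_top b)).comp_fst μ
  refine (h2.add (hF₁.integrable_translate_sq b μ)).mono' ((hF₂.2 b).2.1.comp_fst.norm.mul
    (hF₁.aestronglyMeasurable_translate b μ).norm) (Eventually.of_forall fun p => ?_)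
  rw [norm_mul, norm_norm, norm_norm, Pi.add_apply]
  nlinarith [sq_nonneg (‖(F₂ p.1).coeff b‖ - ‖(F₁ ((lieExp p.2)⁻¹ * p.1)).coeff b‖),
    norm_nonneg (F₂ p.1 |>.coeff b), norm_nonneg ((F₁ ((lieExp p.2)⁻¹ * p.1)).coeff b)]

theorem IsL2Section.ae_integrable_translate (hF : IsL2Section H hH τ F)
    (b : Frame (TangentQuot E H)) (μ : Measure E) [IsFiniteMeasure μ] :
    ∀ᵐ g ∂(quotMeasure E H hH),
      Integrable (fun Y : E => (F ((lieExp Y)⁻¹ * g)).coeff b) μ := by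
  filter_upwards [(hF.integrable_translate_sq b μ).prod_right_ae,
    (hF.aestronglyMeasurable_translate b μ).prodMk_left] with g h1 h2
  refine ((integrable_const (1 : ℝ)).add h1).mono' h2 (Eventually.of_forall fun Y => ?_)
  simp only [Pi.add_apply]
  nlinarith [sq_nonneg (‖(F ((lieExp Y)⁻¹ * g)).coeff b‖ - 1),
    norm_nonneg ((F ((lieExp Y)⁻¹ * g)).coeff b)]

/-- The slice bound integrated over g, after Fubini. The quantifier order matters: r is chosen
before the coefficient. -/
theorem WavefrontConditionU.exists_coeff_bound (hU : WavefrontConditionU E H τ)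
    {η : StrongDual ℝ E} (hη : η ∉ inducedSet H (subgroupWF E H τ)) :
    ∃ r > 0, ∀ c ∈ inducedCoeffs E H hH τ, ∀ ζ ∈ Metric.ball η r,
      ζ ∉ waveFrontAtZero fun Y : E => c (lieExp Y) := by
  obtain ⟨r, hr, ρ, hρ, hb⟩ := hU.exists_slice_bound hH hη
  refine ⟨r, hr, ?_⟩
  rintro _ ⟨F₁, F₂, hF₁, hF₂, rfl⟩ ζ₀ hζ₀
  let φ₀ : ContDiffBump (0 : E) := ⟨ρ / 2, ρ, by positivity, by linarith⟩
  let φ : E → ℂ := fun Y => ((φ₀ Y : ℝ) : ℂ)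
  have hφ : ContDiff ℝ ∞ φ := Complex.ofRealCLM.contDiff.comp φ₀.contDiff
  have hφc : HasCompactSupport φ := φ₀.hasCompactSupport.comp_left Complex.ofReal_zero
  have hφ0 : ∀ Y, ρ ≤ ‖Y‖ → φ Y = 0 := fun Y hY => by
    have : φ₀ Y = 0 := φ₀.zero_of_le_dist (by rwa [dist_zero_right])
    simp [φ, this]
  have hφ1 : ∀ Y, ‖φ Y‖ ≤ 1 := fun Y => by
    rw [Complex.norm_real, Real.norm_of_nonneg φ₀.nonneg]
    exact φ₀.le_one
  refine not_not.2 ⟨φ, hφ, hφc, ?_, Metric.ball η r, Metric.isOpen_ball.mem_nhds hζ₀, fun N => ?_⟩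
  · have : φ₀ (0 : E) = 1 := φ₀.one_of_mem_closedBall (by simp [φ₀.rIn_pos.le])
    simp [φ, this]
  obtain ⟨C, hC0, hC⟩ := hb φ hφ hφ0 N
  let b : Frame (TangentQuot E H) := Module.finBasis ℝ (TangentQuot E H)
  let q := quotMeasure E H hH
  let μ : Measure E := volume.restrict (Metric.ball 0 (4 * ρ))
  have : IsFiniteMeasure μ := ⟨by simp [μ, measure_ball_lt_top]⟩
  let P : G × E → ℝ := fun p => ‖(F₂ p.1).coeff b‖ * ‖(F₁ ((lieExp p.2)⁻¹ * p.1)).coeff b‖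
  have hP : Integrable P (q.prod μ) := hF₁.integrable_norm_mul_norm hF₂ b μ
  refine ⟨C * ∫ p, P p ∂(q.prod μ), fun t ht ζ hζ => ?_⟩
  let Θ : G → E → ℂ := fun g Y => inner ℂ ((F₂ g).coeff b) ((F₁ ((lieExp Y)⁻¹ * g)).coeff b) *
    φ Y * Complex.exp (Complex.I * t * ζ Y)
  have hΘ : Integrable (fun p : G × E => Θ p.1 p.2) (q.prod μ) := by
    have hc : Continuous fun Y : E => Complex.exp (Complex.I * t * ζ Y) := by fun_prop
    refine hP.mono' (((((hF₂.2 b).2.1.comp_fst).inner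
      (hF₁.aestronglyMeasurable_translate b μ)).mul
      (hφ.continuous.comp continuous_snd).aestronglyMeasurable).mul
        (hc.comp continuous_snd).aestronglyMeasurable) (Eventually.of_forall fun p => ?_)
    simp only [Θ, P]
    rw [norm_mul, norm_mul, norm_cexp_I_mul_mul, mul_one]
    calc _ ≤ (‖(F₂ p.1).coeff b‖ * ‖(F₁ ((lieExp p.2)⁻¹ * p.1)).coeff b‖) * 1 := by
          gcongr
          · exact norm_inner_le_norm _ _
          · exact hφ1 _
      _ = _ := mul_one _
  have hμ : ∀ f : E → ℂ, (∀ Y, φ Y = 0 → f Y = 0) → ∫ Y, f Y ∂μ = ∫ Y, f Y := fun f hf =>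
    setIntegral_eq_integral_of_forall_compl_eq_zero fun Y hY => hf Y (hφ0 Y (by
      have := not_lt.1 fun h => hY (mem_ball_zero_iff.2 h)
      linarith))
  -- φ vanishes outside the ball of radius ρ, so restricting Y to the ball of radius 4ρ costs
  -- nothing and gives the finite measure μ for Fubini.
  have h1 : ∫ Y : E, densityIntegral H hH (fun g => (F₁ ((lieExp Y)⁻¹ * g)).pair (F₂ g)) * φ Y *
      Complex.exp (Complex.I * t * ζ Y) = ∫ g, ∫ Y, Θ g Y ∂μ ∂q := by
    rw [integral_integral_swap hΘ, ← hμ _ fun Y hY => by rw [hY, mul_zero, zero_mul]]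
    refine integral_congr_ae (Eventually.of_forall fun Y => ?_)
    simp only [Θ]
    rw [integral_mul_const, integral_mul_const]
    rfl
  have h2 : ∀ᵐ g ∂q, ‖∫ Y, Θ g Y ∂μ‖ ≤ C * (∫ Y, P (g, Y) ∂μ) * (t ^ N)⁻¹ := by
    filter_upwards [hF₁.ae_integrable_translate b μ] with g hg
    have h3 := hC F₁ hF₁ b ((F₂ g).coeff b) g hg t ht ζ hζ
    rw [hμ (Θ g) fun Y hY => by simp only [Θ, hY, mul_zero, zero_mul]]
    rw [← integral_const_mul] at h3
    exact h3
  change ‖∫ Y : E, densityIntegral H hH (fun g => (F₁ ((lieExp Y)⁻¹ * g)).pair (F₂ g)) * φ Y *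
      Complex.exp (Complex.I * t * ζ Y)‖ ≤ _
  rw [h1, integral_prod _ hP, ← integral_const_mul, ← integral_mul_const]
  exact norm_integral_le_of_norm_le ((hP.integral_prod_left.const_mul C).mul_const _) h2

end InducedCoefficients
end InducedWaveFront

open InducedWaveFront
theorem theorem3
    {E : Type*} [NormedAddCommGroup E] [InnerProductSpace ℝ E] [FiniteDimensional ℝ E]
    [MeasurableSpace E] [BorelSpace E]
    {G : Type*} [TopologicalSpace G] [ChartedSpace E G] [Group G] [LieGroup 𝓘(ℝ, E) ∞ G]
    [T2Space G] [SecondCountableTopology G] [MeasurableSpace G] [BorelSpace G]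
    (H : Subgroup G) (hH : IsClosed (H : Set G))
    {V : Type*} [NormedAddCommGroup V] [InnerProductSpace ℂ V] [CompleteSpace V]
    (τ : UnitaryRep H V) (hU : WavefrontConditionU E H τ) :
    inducedWF E H hH τ ⊆ inducedSet H (subgroupWF E H τ) := by
  intro η hη
  by_contra hη'
  obtain ⟨r, hr, h⟩ := hU.exists_coeff_bound (hH := hH) hη'
  -- One ball around η avoids the wave front sets of all coefficients, hence η is not in the closure
  -- of their union.
  obtain ⟨ζ, hζ, hζ'⟩ := mem_closure_iff_nhds.1 hη _ (Metric.ball_mem_nhds η hr)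
  obtain ⟨c, hc, hcζ⟩ := mem_iUnion₂.1 hζ'
  exact h c hc ζ hζ hcζ
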